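/- Let $n\ge 1$, $\sigma>-1$, $H=\{y\in\mathbb{R}^n : y_n>0\}$, and let $I=(s_1,s_2)$ with $-\infty\le s_1<s_2\le\infty$. For $\tau\in\{\sigma,1+\sigma\}$ let $L^2_\tau(H)=L^2(H,\,y_n^{\tau}\,dy)$, and let $\overline H$ be the closure of $H$. For a set $\omega\subset\mathbb{R}\times\mathbb{R}^n$, let $C_c^\infty(\omega)$ be the set of functions $\varphi:\omega\to\mathbb{R}$ whose support is a compact subset of $\omega$ and which extend to a function in $C_c^\infty(\mathbb{R}\times\mathbb{R}^n)$. Write $I_\ell=[s_1,s_2)$ if $s_1>-\infty$ and $I_\ell=I$ if $s_1=-\infty$. Let $f\in L^1(I;L^2_\sigma(H))$ and $u_0\in L^2_\sigma(H)$, where $u_0=0$ if $s_1=-\infty$. A $\sigma$-solution to $f$ on $I\times\overline H$ with initial value $u_0$ is a function $u\in L^2_{loc}(I_\ell;L^2_\sigma(H))$ whose distributional spatial gradient satisfies $\nabla_y u\in L^2(I;L^2_{1+\sigma}(H))$ and for which $$-\int_I\langle u,\partial_s\varphi\rangle_{L^2_\sigma(H)}\,ds+\int_I\langle\nabla_y u,\nabla_y\varphi\rangle_{L^2_{1+\sigma}(H)}\,ds=\int_I\langle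 f,\varphi\rangle_{L^2_\sigma(H)}\,ds+\langle u_0,\varphi(s_1)\rangle_{L^2_\sigma(H)}$$ for all $\varphi\in C_c^\infty(I_\ell\times\overline H)$, where the last term is absent if $s_1=-\infty$. (This is the weak form of $\partial_s u-y_n\Delta_y u-(1+\sigma)\partial_{y_n}u=f$.) Proposition 3.1. There exists a $\sigma$-solution $u$ to $f$ on $I\times\overline H$ with initial value $u_0$, and it is unique up to equality for almost every $s\in I$. After modification on a null set of times, $u$ is a bounded continuous function on the closure of $I$ with values in $L^2_\sigma(H)$, with $u(s_1)=u_0$, and it satisfies the energy identity $$\frac12\|u(s_2)\|_{L^2_\sigma(H)}^2+\int_I\|\nabla_y u\|_{L^2_{1+\sigma}(H)}^2\,ds=\frac12\|u(s_1)\|_{L^2_\sigma(H)}^2+\int_I\langle f,u\rangle_{L^2_\sigma(H)}\,ds .$$ Here, at an infinite end point, $u(s_i)$ denotes the limit of $u(s)$ in $L^2_\sigma(H)$ as $s\to s_i$, which exists. -/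

import Mathlib

open MeasureTheory Set
open scoped ContDiff

noncomputable section

namespace HalfSpace

/-- Euclidean space `ℝⁿ` with `n = d + 1 ≥ 1`; the distinguished coordinate `y_n` is the last one. -/
abbrev Space (d : ℕ) : Type := EuclideanSpace ℝ (Fin (d + 1))

/-- The open upper half space `H = {y | y_n > 0}`. -/
def upper (d : ℕ) : Set (Space d) := {y | 0 < y (Fin.last d)}

/-- The closed upper half space. -/
def closedUpper (d : ℕ) : Set (Space d) := {y | 0 ≤ y (Fin.last d)}

/-- The weighted measure `dμ_σ = y_n ^ σ dy` on `H`. -/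
def weighted (d : ℕ) (σ : ℝ) : Measure (Space d) :=
  (volume.restrict (upper d)).withDensity fun y => ENNReal.ofReal (y (Fin.last d) ^ σ)

/-- The Hilbert space `L²_σ(H)` of real functions. -/
abbrev L2 (d : ℕ) (σ : ℝ) : Type := Lp ℝ 2 (weighted d σ)

/-- The Hilbert space `L²_σ(H)` of vector fields. -/
abbrev L2Vec (d : ℕ) (σ : ℝ) : Type := Lp (Space d) 2 (weighted d σ)

/-- The open time interval `I = (s₁, s₂)`, with possibly infinite end points. -/
def timeI (s₁ s₂ : EReal) : Set ℝ := {s | s₁ < (s : EReal) ∧ (s : EReal) < s₂}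

/-- The interval `I` closed at its left end point; `-∞` is never an element. -/
def timeIleft (s₁ s₂ : EReal) : Set ℝ := {s | s₁ ≤ (s : EReal) ∧ (s : EReal) < s₂}

/-- `u ∈ L²_loc(J; X)`: square integrable (in the sense of Bochner) on all compact subsets of `J`. -/
def MemL2Loc {X : Type*} [NormedAddCommGroup X] (u : ℝ → X) (J : Set ℝ) : Prop :=
  ∀ K : Set ℝ, IsCompact K → K ⊆ J → MemLp u 2 (volume.restrict K)

/-- `g` is the distributional gradient of `v` on the open half space `H`. -/
def IsWeakGradient {d : ℕ} (v : Space d → ℝ) (g : Space d → Space d) : Prop :=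
  ∀ ψ : Space d → ℝ, ContDiff ℝ ∞ ψ → HasCompactSupport ψ → tsupport ψ ⊆ upper d →
    ∀ i, ∫ y in upper d, v y * (gradient ψ y) i = - ∫ y in upper d, (g y) i * ψ y

/-- The spatial gradient of `u` exists in the sense of distributions, is given by `G`, and
`G ∈ L²(I; L²_{1+σ}(H))`. -/
def HasSpatialGradient {d : ℕ} {σ : ℝ} (s₁ s₂ : EReal) (u : ℝ → L2 d σ)
    (G : ℝ → L2Vec d (1 + σ)) : Prop :=
  MemLp G 2 (volume.restrict (timeI s₁ s₂)) ∧
    ∀ᵐ s ∂(volume.restrict (timeI s₁ s₂)), IsWeakGradient (u s) (G s)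

/-- `Φ` is a smooth compactly supported extension to `ℝ × ℝⁿ` of an element of `C_c^∞(W)`, where
`W` need not be open: the support of the restriction of `Φ` to `W` is a compact subset of `W`. -/
def IsTestOn {d : ℕ} (W : Set (ℝ × Space d)) (Φ : ℝ × Space d → ℝ) : Prop :=
  ContDiff ℝ ∞ Φ ∧ HasCompactSupport Φ ∧
    ∃ K : Set (ℝ × Space d), IsCompact K ∧ K ⊆ W ∧ ∀ p ∈ W, p ∉ K → Φ p = 0

/-- `u` is a `σ`-solution to `f` on `I × closure H` with initial value `u₀`, where `I = (s₁, s₂)`,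
i.e. a weak solution of `∂ₛ u - y_n Δ u - (1 + σ) ∂_{y_n} u = f`. For `s₁ = -∞` this is used only
with `u₀ = 0`, and the term with `u₀` then vanishes. -/
def IsSigmaSolution {d : ℕ} {σ : ℝ} (s₁ s₂ : EReal) (f : ℝ → L2 d σ) (u₀ : L2 d σ)
    (u : ℝ → L2 d σ) : Prop :=
  MemL2Loc u (timeIleft s₁ s₂) ∧
    ∃ G : ℝ → L2Vec d (1 + σ), HasSpatialGradient s₁ s₂ u G ∧
      ∀ Φ : ℝ × Space d → ℝ, IsTestOn (timeIleft s₁ s₂ ×ˢ closedUpper d) Φ →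
        - (∫ s in timeI s₁ s₂,
              ∫ y, u s y * deriv (fun t : ℝ => Φ (t, y)) s ∂(weighted d σ))
          + (∫ s in timeI s₁ s₂,
              ∫ y, inner ℝ (G s y) (gradient (fun z => Φ (s, z)) y) ∂(weighted d (1 + σ)))
        = (∫ s in timeI s₁ s₂, ∫ y, f s y * Φ (s, y) ∂(weighted d σ))
          + ∫ y, u₀ y * Φ (s₁.toReal, y) ∂(weighted d σ)

end HalfSpace

end

/-! Let D be the weak gradient from L²_σ(H) to L²_{1+σ}(H) on its maximal domain. It is closed and
densely defined, and the weak form of the equation reads ∂ₛu + D*Du = f; the natural boundary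
condition is encoded in the test functions, which need not vanish at y_n = 0. The result is thus one
about a nonnegative self-adjoint operator, once testing with smooth functions is known to be the
same as testing with the whole domain of D.

Abstract half. Unbounded operators are avoided by means of J = (1 + D*D)⁻¹, E = DJ and B = 1 - J =
D*DJ, linked by ⟪Ex, Ey⟫ = ⟪Bx, Jy⟫; the equation becomes ∂ₛJu = Jf - Bu. The bounded dissipative
operators -B(J + ε)⁻¹ generate contraction semigroups, which converge to S(t) = exp(-tD*D) as ε → 0
(Yosida), and Duhamel's formula gives a bounded continuous u. Injectivity of D yields S(t) → 0
strongly (`tendsto_S_atTop`), hence the limits at infinite end points. The regularizations P ε u =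
J(J + ε)⁻¹u lie in the domain and satisfy an exact energy identity. Applied to P ε u - P δ u, it
shows that the gradients are Cauchy in L²(I); since the graph is closed, the limit is the gradient
of u, and energy identity and weak form pass to the limit (`exists_gradient`).

Uniqueness. A competing solution is only locally square integrable in time. The difference w of two
solutions, extended by zero to the left of s₁, solves the homogeneous equation on (-∞, s₂). A
convolution W of w in time is smooth with JW' = -BW, so ‖EW‖² is nonincreasing; it tends to 0 at -∞
because the gradient is square integrable in time. Hence EW = 0 and W = 0.

Concrete half. It remains that D is injective and that test functions are dense in its graph
(`exists_test_eLpNorm_sub_le`). Mollification samples only points farther from the boundary, so it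
is smooth up to the boundary, and it contracts L²_{1+σ} because the weight y_n^{1+σ} increases with
height. This fails in L²_σ when σ < 0; there a Hardy inequality along vertical lines bounds a
function of bounded support by its gradient. On a ball of radius R its constant grows like R^{1/2},
while multiplication by the gradient of a cutoff has norm of order R^{-1/2} from L²_σ to L²_{1+σ}.
The two factors balance, and letting R → ∞ gives injectivity. -/

noncomputable section

set_option linter.unusedSectionVars false

open Filter Topology

/-! ### Resolvent pairs: bounds and the regularization P ε. -/

section

open scoped RealInnerProductSpace

/-- The resolvent `J = (1 + D* D)⁻¹` of a nonnegative self-adjoint operator given as `D* D`, together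
with the bounded operator `E = D J`. -/
structure ResolventPair (H K : Type*) [NormedAddCommGroup H] [InnerProductSpace ℝ H]
    [NormedAddCommGroup K] [InnerProductSpace ℝ K] where
  J : H →L[ℝ] H
  E : H →L[ℝ] K
  symm : ∀ x y, ⟪J x, y⟫ = ⟪x, J y⟫
  inner_E : ∀ x y, ⟪E x, E y⟫ = ⟪x - J x, J y⟫
  inj : ∀ x, E x = 0 → x = 0

namespace ResolventPair

variable {H K : Type*} [NormedAddCommGroup H] [InnerProductSpace ℝ H]
  [NormedAddCommGroup K] [InnerProductSpace ℝ K] (A : ResolventPair H K)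

/-- `B = 1 - J = D* D J`. -/
def B : H →L[ℝ] H := ContinuousLinearMap.id ℝ H - A.J

theorem B_apply (x : H) : A.B x = x - A.J x := rfl

theorem J_B (x : H) : A.J (A.B x) = A.B (A.J x) := by simp [B_apply]

theorem B_symm (x y : H) : ⟪A.B x, y⟫ = ⟪x, A.B y⟫ := by
  simp [B_apply, inner_sub_left, inner_sub_right, A.symm]

theorem inner_B_J (x : H) : ⟪A.B x, A.J x⟫ = ‖A.E x‖ ^ 2 := by
  rw [← real_inner_self_eq_norm_sq, A.inner_E, B_apply]

/-- The resolvent equation x = Jx + D*DJx tested with Jx. The contraction bounds for J and B follow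
from it. -/
theorem norm_J_sq_add (x : H) : ‖A.J x‖ ^ 2 + ‖A.E x‖ ^ 2 = ⟪A.J x, x⟫ := by
  rw [← A.inner_B_J, B_apply, inner_sub_left, real_inner_self_eq_norm_sq, real_inner_comm]
  ring

theorem inner_J_nonneg (x : H) : 0 ≤ ⟪A.J x, x⟫ := by
  rw [← A.norm_J_sq_add]; positivity

theorem norm_J_le (x : H) : ‖A.J x‖ ≤ ‖x‖ := by
  have h := A.norm_J_sq_add x
  have h2 := real_inner_le_norm (A.J x) x
  by_contra! hlt
  nlinarith [norm_nonneg (A.J x), norm_nonneg x, sq_nonneg ‖A.E x‖]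

theorem inner_B_nonneg (x : H) : 0 ≤ ⟪A.B x, x⟫ := by
  rw [B_apply, inner_sub_left, real_inner_self_eq_norm_sq]
  nlinarith [real_inner_le_norm (A.J x) x, A.norm_J_le x, norm_nonneg x]

theorem norm_B_le (x : H) : ‖A.B x‖ ≤ ‖x‖ := by
  have h : ‖A.B x‖ ^ 2 ≤ ‖x‖ ^ 2 := by
    rw [B_apply, norm_sub_sq_real, real_inner_comm]
    nlinarith [A.norm_J_sq_add x, sq_nonneg ‖A.E x‖, A.inner_J_nonneg x]
  exact le_of_sq_le_sq h (norm_nonneg _)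

theorem norm_E_sq_le (x : H) : ‖A.E x‖ ^ 2 ≤ ⟪A.B x, x⟫ := by
  have : ⟪A.B x, x⟫ = ‖A.B x‖ ^ 2 + ‖A.E x‖ ^ 2 := by
    rw [← A.inner_B_J, ← real_inner_self_eq_norm_sq, ← inner_add_right]; simp [B_apply]
  rw [this]; nlinarith [sq_nonneg ‖A.B x‖]

/-- By `inner_E` and symmetry, BJ = E*E. In `tendsto_S_atTop` this turns decay of the gradient into
decay of the function. -/
theorem norm_B_J_le (x : H) : ‖A.B (A.J x)‖ ≤ ‖A.E‖ * ‖A.E x‖ := by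
  have h : ‖A.B (A.J x)‖ ^ 2 = ⟪A.E x, A.E (A.B (A.J x))⟫ := by
    rw [A.inner_E, ← B_apply, ← A.symm, A.J_B, real_inner_self_eq_norm_sq]
  have h2 := (real_inner_le_norm (A.E x) (A.E (A.B (A.J x)))).trans
    (mul_le_mul_of_nonneg_left (A.E.le_opNorm (A.B (A.J x))) (norm_nonneg _))
  rcases (norm_nonneg (A.B (A.J x))).eq_or_lt with h0 | h0
  · rw [← h0]; positivity
  · nlinarith

theorem J_inj (x : H) (hx : A.J x = 0) : x = 0 := by
  apply A.inj
  have := A.norm_J_sq_add x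
  rw [hx] at this
  simpa using this

theorem J_B_inj (x : H) (hx : A.J (A.B x) = 0) : x = 0 := by
  apply A.inj
  have : ‖A.E x‖ ^ 2 = 0 := by rw [← A.inner_B_J, ← A.symm, hx, inner_zero_left]
  simpa using this

/-- `R ε = (J + ε)⁻¹`. -/
def R (ε : ℝ) : H →L[ℝ] H := Ring.inverse (A.J + ε • (1 : H →L[ℝ] H))

/-- `P ε = J (J + ε)⁻¹`. -/
def P (ε : ℝ) : H →L[ℝ] H := A.J ∘L A.R ε

theorem P_apply (ε : ℝ) (x : H) : A.P ε x = A.J (A.R ε x) := rfl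

variable [CompleteSpace H]

/-- The orthogonal complement of the range of a symmetric operator is its kernel. -/
theorem denseRange_of_symm {T : H →L[ℝ] H} (hT : ∀ x y, ⟪T x, y⟫ = ⟪x, T y⟫)
    (hinj : ∀ x, T x = 0 → x = 0) : DenseRange T := by
  have h : (LinearMap.range (T : H →ₗ[ℝ] H)).topologicalClosure = ⊤ := by
    rw [Submodule.topologicalClosure_eq_top_iff, LinearMap.IsSymmetric.orthogonal_range hT]
    rw [Submodule.eq_bot_iff]
    intro x hx
    exact hinj x (by simpa using hx)
  have h2 := Submodule.dense_iff_topologicalClosure_eq_top.mpr h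
  rw [LinearMap.coe_range] at h2
  exact h2

theorem denseRange_J : DenseRange A.J := denseRange_of_symm A.symm A.J_inj

theorem denseRange_J_B : DenseRange (A.J ∘L A.B) :=
  denseRange_of_symm (fun x y => by
    simp only [ContinuousLinearMap.comp_apply]; rw [A.symm, A.B_symm, A.J_B]) A.J_B_inj

theorem isUnit_J_add {ε : ℝ} (hε : 0 < ε) : IsUnit (A.J + ε • (1 : H →L[ℝ] H)) := by
  refine ContinuousLinearMap.isUnit_of_forall_le_norm_inner_map _ (c := ⟨ε, hε.le⟩) hε fun x => ?_
  have h : ⟪(A.J + ε • (1 : H →L[ℝ] H)) x, x⟫ = ⟪A.J x, x⟫ + ε * ‖x‖ ^ 2 := by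
    simp [inner_add_left, inner_smul_left]
  rw [h, Real.norm_eq_abs]
  refine le_trans ?_ (le_abs_self _)
  have := A.inner_J_nonneg x
  show ‖x‖ ^ 2 * ε ≤ _
  linarith

variable {ε : ℝ}

theorem J_R_add (hε : 0 < ε) (x : H) : A.J (A.R ε x) + ε • A.R ε x = x := by
  have := congrArg (fun T : H →L[ℝ] H => T x) (Ring.mul_inverse_cancel _ (A.isUnit_J_add hε))
  simpa [R] using this

theorem R_J_add (hε : 0 < ε) (x : H) : A.R ε (A.J x + ε • x) = x := by
  have := congrArg (fun T : H →L[ℝ] H => T x) (Ring.inverse_mul_cancel _ (A.isUnit_J_add hε))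
  simpa [R] using this

theorem R_comm (hε : 0 < ε) {T : H →L[ℝ] H} (hT : ∀ x, T (A.J x) = A.J (T x)) (x : H) :
    T (A.R ε x) = A.R ε (T x) := by
  conv_rhs => rw [← A.J_R_add hε x]
  rw [map_add, map_smul, hT, A.R_J_add hε]

theorem J_R (hε : 0 < ε) (x : H) : A.J (A.R ε x) = A.R ε (A.J x) := A.R_comm hε (fun _ => rfl) x

theorem B_R (hε : 0 < ε) (x : H) : A.B (A.R ε x) = A.R ε (A.B x) :=
  A.R_comm hε (fun x => (A.J_B x).symm) x

theorem norm_P_le (hε : 0 < ε) (x : H) : ‖A.P ε x‖ ≤ ‖x‖ := by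
  have h : ‖A.P ε x‖ ^ 2 ≤ ‖x‖ ^ 2 := by
    conv_rhs => rw [← A.J_R_add hε x]
    rw [norm_add_sq_real, inner_smul_right, P_apply]
    have := A.inner_J_nonneg (A.R ε x)
    have : 0 ≤ 2 * (ε * ⟪A.J (A.R ε x), A.R ε x⟫) := by positivity
    nlinarith [sq_nonneg ‖ε • A.R ε x‖]
  exact le_of_sq_le_sq h (norm_nonneg _)

end ResolventPair

/-- An ε/3 argument. It allows each strong limit below to be checked on a dense range, where an
explicit rate is available. -/
theorem isClosed_setOf_tendsto_of_lipschitz {ι X Y : Type*} [PseudoMetricSpace X]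
    [PseudoMetricSpace Y] {T : ι → X → Y} {L : X → Y} {l : Filter ι} (C : ℝ)
    (hT : ∀ᶠ k in l, ∀ x y, dist (T k x) (T k y) ≤ C * dist x y)
    (hL : ∀ x y, dist (L x) (L y) ≤ C * dist x y) :
    IsClosed {x | Tendsto (fun k => T k x) l (𝓝 (L x))} := by
  refine isClosed_of_closure_subset fun x hx => ?_
  rw [mem_ofPred_eq, Metric.tendsto_nhds]
  intro δ hδ
  obtain ⟨y, hy, hxy⟩ := Metric.mem_closure_iff.mp hx (δ / 3 / (|C| + 1)) (by positivity)
  have hC : C * dist x y ≤ δ / 3 := by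
    calc C * dist x y ≤ (|C| + 1) * dist x y := by
          gcongr; linarith [le_abs_self C]
      _ ≤ (|C| + 1) * (δ / 3 / (|C| + 1)) := by gcongr
      _ = δ / 3 := by field_simp
  filter_upwards [Metric.tendsto_nhds.mp hy (δ / 3) (by positivity), hT] with k hk hk'
  have h1 := hk' x y
  have h2 := hL y x
  rw [dist_comm y x] at h2
  calc dist (T k x) (L x) ≤ dist (T k x) (T k y) + dist (T k y) (L y) + dist (L y) (L x) :=
        dist_triangle4 _ _ _ _
    _ < δ := by linarith

namespace ResolventPair

variable {H K : Type*} [NormedAddCommGroup H] [InnerProductSpace ℝ H]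
  [NormedAddCommGroup K] [InnerProductSpace ℝ K] (A : ResolventPair H K) [CompleteSpace H]

/-- On the range of J the error is explicit, P ε Jy - Jy = -ε P ε y; contractivity of P ε and
density do the rest. -/
theorem tendsto_P (x : H) : Tendsto (fun ε => A.P ε x) (𝓝[>] 0) (𝓝 x) := by
  refine A.denseRange_J.induction_on (p := fun x => Tendsto (fun ε => A.P ε x) (𝓝[>] 0) (𝓝 x)) x
    (isClosed_setOf_tendsto_of_lipschitz (L := id) 1 ?_ (by simp)) fun y => ?_
  · filter_upwards [self_mem_nhdsWithin] with ε hε x y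
    rw [dist_eq_norm, ← map_sub, one_mul, dist_eq_norm]
    exact A.norm_P_le hε _
  · rw [tendsto_iff_norm_sub_tendsto_zero]
    refine squeeze_zero' (g := fun ε : ℝ => ε * ‖y‖) (.of_forall fun _ => norm_nonneg _) ?_ ?_
    · filter_upwards [self_mem_nhdsWithin] with ε hε
      have h : A.P ε (A.J y) - A.J y = -(ε • A.P ε y) := by
        have h1 := A.J_R_add hε (A.J y)
        rw [A.P_apply ε y, A.J_R hε y, P_apply]
        apply eq_neg_of_add_eq_zero_left
        rw [sub_add_eq_add_sub, h1, sub_self]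
      rw [h, norm_neg, norm_smul, Real.norm_of_nonneg (le_of_lt hε)]
      exact mul_le_mul_of_nonneg_left (A.norm_P_le hε y) (le_of_lt hε)
    · have : Tendsto (fun ε : ℝ => ε * ‖y‖) (𝓝 0) (𝓝 (0 * ‖y‖)) := tendsto_id.mul_const _
      rw [zero_mul] at this
      exact this.mono_left nhdsWithin_le_nhds

end ResolventPair

/-! ### The contraction semigroup of -D*D by Yosida approximation. -/

namespace ResolventPair

variable {H K : Type*} [NormedAddCommGroup H] [InnerProductSpace ℝ H]
  [NormedAddCommGroup K] [InnerProductSpace ℝ K] (A : ResolventPair H K)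

/-- The bounded generator `-(1 - J) (J + ε)⁻¹`, which approximates `-D* D`. -/
def generator (ε : ℝ) : H →L[ℝ] H := -(A.B ∘L A.R ε)

theorem generator_apply (ε : ℝ) (x : H) : A.generator ε x = -A.B (A.R ε x) := rfl

/-- The semigroup generated by `generator ε`. -/
def expSemigroup (ε t : ℝ) : H →L[ℝ] H := NormedSpace.exp (t • A.generator ε)

theorem expSemigroup_zero (ε : ℝ) (x : H) : A.expSemigroup ε 0 x = x := by
  simp [expSemigroup]

theorem expSemigroup_comm {ε t : ℝ} {T : H →L[ℝ] H} (hT : Commute T (A.generator ε)) (x : H) :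
    T (A.expSemigroup ε t x) = A.expSemigroup ε t (T x) := by
  have h : Commute T (A.expSemigroup ε t) := (hT.smul_right t).exp_right
  exact congrArg (fun U : H →L[ℝ] H => U x) h.eq

variable [CompleteSpace H]

theorem hasDerivAt_expSemigroup (ε t : ℝ) :
    HasDerivAt (A.expSemigroup ε) (A.expSemigroup ε t * A.generator ε) t :=
  hasDerivAt_exp_smul_const (𝕂 := ℝ) (A.generator ε) t

theorem hasDerivAt_expSemigroup' (ε t : ℝ) :
    HasDerivAt (A.expSemigroup ε) (A.generator ε * A.expSemigroup ε t) t :=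
  hasDerivAt_exp_smul_const' (𝕂 := ℝ) (A.generator ε) t

theorem hasDerivAt_expSemigroup_apply (ε t : ℝ) (x : H) :
    HasDerivAt (fun t => A.expSemigroup ε t x) (A.generator ε (A.expSemigroup ε t x)) t :=
  ((ContinuousLinearMap.apply ℝ H x).hasFDerivAt.comp_hasDerivAt t
    (A.hasDerivAt_expSemigroup' ε t))

variable {ε δ : ℝ}

theorem commute_J_generator (hε : 0 < ε) : Commute A.J (A.generator ε) := by
  refine ContinuousLinearMap.ext fun x => ?_
  change A.J (A.generator ε x) = A.generator ε (A.J x)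
  simp only [generator_apply, map_neg, A.J_B, A.J_R hε]

theorem commute_generator (hε : 0 < ε) (hδ : 0 < δ) :
    Commute (A.generator δ) (A.generator ε) := by
  refine ContinuousLinearMap.ext fun x => ?_
  change A.generator δ (A.generator ε x) = A.generator ε (A.generator δ x)
  simp only [generator_apply, map_neg, neg_neg]
  rw [← A.B_R hδ (A.R ε x), A.R_comm hε (A.J_R hδ · |>.symm), ← A.B_R hε (A.R δ x)]

/-- Insert x = (J + ε) R ε x in the second slot: the part with J contributes ‖E R ε x‖² and the part
with ε is nonnegative because B ≥ 0. -/
theorem inner_generator_nonpos (hε : 0 < ε) (x : H) : ⟪A.generator ε x, x⟫ ≤ 0 := by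
  have h : ⟪A.B (A.R ε x), x⟫ = ‖A.E (A.R ε x)‖ ^ 2 + ε * ⟪A.B (A.R ε x), A.R ε x⟫ := by
    rw [← A.inner_B_J, ← inner_smul_right, ← inner_add_right, A.J_R_add hε]
  rw [generator_apply, inner_neg_left, h]
  have := A.inner_B_nonneg (A.R ε x)
  have := mul_nonneg hε.le this
  nlinarith [sq_nonneg ‖A.E (A.R ε x)‖]

theorem norm_expSemigroup_le (hε : 0 < ε) {t : ℝ} (ht : 0 ≤ t) (x : H) :
    ‖A.expSemigroup ε t x‖ ≤ ‖x‖ := by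
  have hd : ∀ t, HasDerivAt (fun t => ‖A.expSemigroup ε t x‖ ^ 2)
      (2 * ⟪A.expSemigroup ε t x, A.generator ε (A.expSemigroup ε t x)⟫) t := fun t =>
    (A.hasDerivAt_expSemigroup_apply ε t x).norm_sq
  have hanti : Antitone fun t => ‖A.expSemigroup ε t x‖ ^ 2 :=
    antitone_of_deriv_nonpos (fun t => (hd t).differentiableAt) fun t => by
      rw [(hd t).deriv, real_inner_comm]
      linarith [A.inner_generator_nonpos hε (A.expSemigroup ε t x)]
  have h := hanti ht
  simp only [A.expSemigroup_zero] at h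
  exact le_of_sq_le_sq h (norm_nonneg _)

/-- The path r ↦ exp((t-r)A_δ) exp(rA_ε)x joins the two values. Since the generators commute, its
derivative is the same product applied to (A_ε - A_δ)x, which contractivity bounds uniformly in r.
-/
theorem norm_expSemigroup_sub_le (hε : 0 < ε) (hδ : 0 < δ) {t : ℝ} (ht : 0 ≤ t) (x : H) :
    ‖A.expSemigroup ε t x - A.expSemigroup δ t x‖ ≤
      ‖A.generator ε x - A.generator δ x‖ * t := by
  have hd : ∀ r, HasDerivAt (fun r => A.expSemigroup δ (t - r) (A.expSemigroup ε r x))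
      (A.expSemigroup δ (t - r) (A.expSemigroup ε r (A.generator ε x - A.generator δ x))) r := by
    intro r
    have h1 : HasDerivAt (fun r => A.expSemigroup δ (t - r))
        (-(A.expSemigroup δ (t - r) * A.generator δ)) r := by
      have := (A.hasDerivAt_expSemigroup δ (t - r)).scomp r ((hasDerivAt_id r).const_sub t)
      rw [neg_one_smul] at this
      exact this
    have h2 := h1.clm_apply (A.hasDerivAt_expSemigroup_apply ε r x)
    convert h2 using 1
    rw [map_sub, map_sub, ← A.expSemigroup_comm (A.commute_generator hε hε),
      ← A.expSemigroup_comm (A.commute_generator hε hδ)]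
    simp only [neg_apply]
    change _ = -(A.expSemigroup δ (t - r) (A.generator δ (A.expSemigroup ε r x))) + _
    abel
  have h := norm_image_sub_le_of_norm_deriv_le_segment' (a := 0) (b := t)
    (C := ‖A.generator ε x - A.generator δ x‖) (fun r _ => (hd r).hasDerivWithinAt)
    (fun r hr => (A.norm_expSemigroup_le hδ (by linarith [hr.2]) _).trans
      (A.norm_expSemigroup_le hε hr.1 _)) t ⟨ht, le_rfl⟩
  simpa [A.expSemigroup_zero] using h

theorem generator_J (hε : 0 < ε) (x : H) : A.generator ε (A.J x) = -A.B (A.P ε x) := by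
  rw [generator_apply, P_apply, A.J_R hε]

/-- On Jy the generators converge, being equal to -B P ε y, so the preceding comparison makes the
family Cauchy; contractivity extends this from the dense range of J. -/
theorem exists_tendsto_expSemigroup {t : ℝ} (ht : 0 ≤ t) (x : H) :
    ∃ y, Tendsto (fun ε => A.expSemigroup ε t x) (𝓝[>] 0) (𝓝 y) := by
  rw [← cauchy_map_iff_exists_tendsto, cauchy_map_iff]
  refine ⟨inferInstance, ?_⟩
  rw [Metric.uniformity_eq_comap_nhds_zero, tendsto_comap_iff]
  have hpos : ∀ᶠ p : ℝ × ℝ in 𝓝[>] 0 ×ˢ 𝓝[>] 0, 0 < p.1 ∧ 0 < p.2 :=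
    prod_mem_prod self_mem_nhdsWithin self_mem_nhdsWithin
  refine A.denseRange_J.induction_on (p := fun x => Tendsto (fun p : ℝ × ℝ =>
    dist (A.expSemigroup p.1 t x) (A.expSemigroup p.2 t x)) (𝓝[>] 0 ×ˢ 𝓝[>] 0) (𝓝 0)) x
    (isClosed_setOf_tendsto_of_lipschitz (L := fun _ => 0) 2 ?_ (by simp)) fun y => ?_
  · filter_upwards [hpos] with p hp x y
    refine (dist_dist_dist_le _ _ _ _).trans ?_
    rw [dist_eq_norm (A.expSemigroup p.1 t x), dist_eq_norm (A.expSemigroup p.2 t x), ← map_sub,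
      ← map_sub, two_mul, dist_eq_norm]
    exact add_le_add (A.norm_expSemigroup_le hp.1 ht _) (A.norm_expSemigroup_le hp.2 ht _)
  · have hlim : Tendsto (fun p : ℝ × ℝ => ‖A.B (A.P p.2 y) - A.B (A.P p.1 y)‖ * t)
        (𝓝[>] 0 ×ˢ 𝓝[>] 0) (𝓝 0) := by
      have h := (A.B.continuous.tendsto y).comp (A.tendsto_P y)
      simpa using (((h.comp tendsto_snd).sub (h.comp tendsto_fst)).norm).mul_const t
    refine squeeze_zero' (.of_forall fun _ => dist_nonneg) ?_ hlim
    filter_upwards [hpos] with p hp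
    rw [dist_eq_norm]
    refine (A.norm_expSemigroup_sub_le hp.1 hp.2 ht _).trans (le_of_eq ?_)
    rw [A.generator_J hp.1, A.generator_J hp.2]
    congr 2; abel

/-- The contraction semigroup `exp (-t D* D)` for `t ≥ 0`, extended by the identity to `t ≤ 0`. -/
def S (t : ℝ) (x : H) : H := limUnder (𝓝[>] 0) fun ε => A.expSemigroup ε (max t 0) x

theorem tendsto_S (t : ℝ) (x : H) :
    Tendsto (fun ε => A.expSemigroup ε (max t 0) x) (𝓝[>] 0) (𝓝 (A.S t x)) :=
  tendsto_nhds_limUnder (A.exists_tendsto_expSemigroup (le_max_right t 0) x)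

theorem S_of_nonpos {t : ℝ} (ht : t ≤ 0) (x : H) : A.S t x = x := by
  refine tendsto_nhds_unique (A.tendsto_S t x) ?_
  simp [max_eq_right ht, A.expSemigroup_zero]

theorem S_sub (t : ℝ) (x y : H) : A.S t (x - y) = A.S t x - A.S t y := by
  refine tendsto_nhds_unique (A.tendsto_S t (x - y)) ?_
  simpa using (A.tendsto_S t x).sub (A.tendsto_S t y)

theorem norm_S_le (t : ℝ) (x : H) : ‖A.S t x‖ ≤ ‖x‖ := by
  refine le_of_tendsto (A.tendsto_S t x).norm ?_
  filter_upwards [self_mem_nhdsWithin] with ε hε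
  exact A.norm_expSemigroup_le hε (le_max_right t 0) x

theorem dist_S_le (t : ℝ) (x y : H) : dist (A.S t x) (A.S t y) ≤ dist x y := by
  rw [dist_eq_norm, ← S_sub, dist_eq_norm]; exact A.norm_S_le t _

theorem S_zero_right (t : ℝ) : A.S t 0 = 0 := by
  have := A.S_sub t 0 0
  simpa using this

theorem S_comm {T : H →L[ℝ] H} (hT : ∀ ε > 0, Commute T (A.generator ε)) (t : ℝ) (x : H) :
    T (A.S t x) = A.S t (T x) := by
  refine tendsto_nhds_unique ((T.continuous.tendsto _).comp (A.tendsto_S t x))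
    ((A.tendsto_S t (T x)).congr' ?_)
  filter_upwards [self_mem_nhdsWithin] with ε hε
  exact (A.expSemigroup_comm (hT ε hε) x).symm

theorem J_S (t : ℝ) (x : H) : A.J (A.S t x) = A.S t (A.J x) :=
  A.S_comm (fun _ hε => A.commute_J_generator hε) t x

/-- On the range of J the approximate generators are bounded uniformly in ε, by ‖B P ε x‖ ≤ ‖x‖, so
orbits starting there are Lipschitz in time. -/
theorem norm_S_J_sub_le (s t : ℝ) (x : H) :
    ‖A.S t (A.J x) - A.S s (A.J x)‖ ≤ ‖x‖ * |t - s| := by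
  refine le_of_tendsto ((A.tendsto_S t (A.J x)).sub (A.tendsto_S s (A.J x))).norm ?_
  filter_upwards [self_mem_nhdsWithin] with ε hε
  have h := Convex.norm_image_sub_le_of_norm_hasDerivWithin_le (s := Ici (0 : ℝ)) (C := ‖x‖)
    (fun r _ => (A.hasDerivAt_expSemigroup_apply ε r (A.J x)).hasDerivWithinAt)
    (fun r hr => by
      rw [A.expSemigroup_comm (Commute.refl _), A.generator_J hε]
      exact (A.norm_expSemigroup_le hε hr _).trans ((norm_neg _).trans_le
        ((A.norm_B_le _).trans (A.norm_P_le hε x)))) (convex_Ici 0)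
    (le_max_right s 0) (le_max_right t 0)
  refine h.trans (mul_le_mul_of_nonneg_left ?_ (norm_nonneg _))
  rw [Real.norm_eq_abs]
  exact abs_max_sub_max_le_abs _ _ _

theorem continuous_S_apply (x : H) : Continuous fun t => A.S t x := by
  rw [continuous_iff_continuousAt]
  intro s
  refine A.denseRange_J.induction_on (p := fun x => Tendsto (fun t => A.S t x) (𝓝 s)
    (𝓝 (A.S s x))) x (isClosed_setOf_tendsto_of_lipschitz 1
    (.of_forall fun t x y => by simpa using A.dist_S_le t x y)
    (fun x y => by simpa using A.dist_S_le s x y)) fun y => ?_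
  rw [tendsto_iff_norm_sub_tendsto_zero]
  refine squeeze_zero (fun _ => norm_nonneg _) (fun t => A.norm_S_J_sub_le s t y) ?_
  have h : Continuous fun t : ℝ => ‖y‖ * |t - s| := by fun_prop
  simpa using h.tendsto s

theorem continuous_S : Continuous fun p : ℝ × H => A.S p.1 p.2 := by
  rw [continuous_iff_continuousAt]
  rintro ⟨s, x⟩
  refine tendsto_of_tendsto_of_dist (f₁ := fun p : ℝ × H => A.S p.1 x) ?_ ?_
  · exact ((A.continuous_S_apply x).comp continuous_fst).tendsto (s, x)
  · refine squeeze_zero (fun _ => dist_nonneg) (fun p => A.dist_S_le p.1 x p.2) ?_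
    have h : Continuous fun p : ℝ × H => dist x p.2 := by fun_prop
    simpa using h.tendsto (s, x)

/-- The integrated semigroup equation with J applied, so that no domain condition on x is needed. It
holds for each ε with B P ε in place of B, and ‖x‖ dominates the integrands as ε → 0. -/
theorem J_S_eq {t : ℝ} (ht : 0 ≤ t) (x : H) :
    A.J (A.S t x) = A.J x - ∫ r in (0 : ℝ)..t, A.B (A.S r x) := by
  have hε : ∀ ε > 0, A.J (A.expSemigroup ε (max t 0) x) =
      A.J x - ∫ r in (0 : ℝ)..t, A.B (A.P ε (A.expSemigroup ε (max r 0) x)) := by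
    intro ε hε
    have hd : ∀ r, HasDerivAt (fun r => A.J (A.expSemigroup ε r x))
        (-A.B (A.P ε (A.expSemigroup ε r x))) r := fun r => by
      have := A.J.hasFDerivAt.comp_hasDerivAt r (A.hasDerivAt_expSemigroup_apply ε r x)
      rw [← A.generator_J hε]
      have h : A.generator ε (A.J (A.expSemigroup ε r x)) =
          A.J (A.generator ε (A.expSemigroup ε r x)) :=
        (congrArg (fun U : H →L[ℝ] H => U (A.expSemigroup ε r x))
          (A.commute_J_generator hε).eq).symm
      rw [h]
      exact this
    have hc : Continuous fun r => A.expSemigroup ε r x :=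
      continuous_iff_continuousAt.mpr fun r =>
        (A.hasDerivAt_expSemigroup_apply ε r x).continuousAt
    have h := intervalIntegral.integral_eq_sub_of_hasDerivAt (fun r _ => hd r) (a := 0) (b := t)
      (Continuous.intervalIntegrable (by fun_prop) _ _)
    rw [intervalIntegral.integral_neg, A.expSemigroup_zero] at h
    rw [max_eq_left ht, eq_sub_iff_add_eq, ← eq_sub_iff_add_eq', ← neg_sub, ← h, neg_neg]
    refine intervalIntegral.integral_congr fun r hr => ?_
    rw [uIcc_of_le ht] at hr
    simp only [max_eq_left hr.1]
  refine tendsto_nhds_unique ((A.J.continuous.tendsto _).comp (A.tendsto_S t x)) ?_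
  have hlim : Tendsto (fun ε => ∫ r in (0 : ℝ)..t, A.B (A.P ε (A.expSemigroup ε (max r 0) x)))
      (𝓝[>] 0) (𝓝 (∫ r in (0 : ℝ)..t, A.B (A.S r x))) := by
    refine intervalIntegral.tendsto_integral_filter_of_dominated_convergence (fun _ => ‖x‖)
      ?_ ?_ (by simp) ?_
    · refine .of_forall fun ε => Continuous.aestronglyMeasurable ?_
      have hc : Continuous fun r => A.expSemigroup ε r x :=
        continuous_iff_continuousAt.mpr fun r =>
          (A.hasDerivAt_expSemigroup_apply ε r x).continuousAt
      have : Continuous fun r : ℝ => A.expSemigroup ε (max r 0) x := hc.comp (by fun_prop)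
      fun_prop
    · filter_upwards [self_mem_nhdsWithin] with ε hε
      exact .of_forall fun r _ => (A.norm_B_le _).trans ((A.norm_P_le hε _).trans
        (A.norm_expSemigroup_le hε (le_max_right r 0) x))
    · refine .of_forall fun r _ => (A.B.continuous.tendsto _).comp ?_
      refine tendsto_of_tendsto_of_dist (A.tendsto_P (A.S r x)) ?_
      have h := tendsto_iff_dist_tendsto_zero.mp (A.tendsto_S r x)
      refine squeeze_zero' (.of_forall fun _ => dist_nonneg) ?_ h
      filter_upwards [self_mem_nhdsWithin] with ε hε
      rw [dist_comm, dist_eq_norm, ← map_sub, dist_eq_norm]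
      exact A.norm_P_le hε _
  refine (tendsto_const_nhds.sub hlim).congr' ?_
  filter_upwards [self_mem_nhdsWithin] with ε h
  exact (hε ε h).symm

theorem hasDerivAt_J_S {t : ℝ} (ht : 0 < t) (x : H) :
    HasDerivAt (fun t => A.J (A.S t x)) (-A.B (A.S t x)) t := by
  have hc : Continuous fun r => A.B (A.S r x) := A.B.continuous.comp (A.continuous_S_apply x)
  have h := (hc.integral_hasStrictDerivAt 0 t).hasDerivAt.const_sub (A.J x)
  refine h.congr_of_eventuallyEq ?_
  filter_upwards [lt_mem_nhds ht] with s hs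
  exact A.J_S_eq hs.le x

/-- By density of the range of JB it suffices to treat JBx. The dissipation ∫ 2‖E S(t)x‖² dt is at
most ‖Jx‖², and ‖S(t)JBx‖ = ‖BJ S(t)x‖ ≤ ‖E‖ ‖E S(t)x‖. As the left side is nonincreasing in t,
integrability forces it to decay like t^{-1/2}. -/
theorem tendsto_S_atTop (x : H) : Tendsto (fun t => A.S t x) atTop (𝓝 0) := by
  refine A.denseRange_J_B.induction_on (p := fun x => Tendsto (fun t => A.S t x) atTop (𝓝 0)) x
    (isClosed_setOf_tendsto_of_lipschitz (L := fun _ => 0) 1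
    (.of_forall fun t x y => by simpa using A.dist_S_le t x y) (by simp)) fun x => ?_
  have hd : ∀ z t, 0 < t → HasDerivAt (fun t => ‖A.J (A.S t z)‖ ^ 2)
      (-(2 * ‖A.E (A.S t z)‖ ^ 2)) t := fun z t ht => by
    convert (A.hasDerivAt_J_S ht z).norm_sq using 1
    rw [inner_neg_right, real_inner_comm, A.inner_B_J]; ring
  have hc : ∀ z, Continuous fun t => A.J (A.S t z) := fun z =>
    A.J.continuous.comp (A.continuous_S_apply z)
  have hanti : ∀ z, AntitoneOn (fun t => ‖A.J (A.S t z)‖ ^ 2) (Ici 0) := fun z => by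
    refine antitoneOn_of_deriv_nonpos (convex_Ici 0) ((hc z).norm.pow 2).continuousOn ?_ ?_
    · intro t ht
      rw [interior_Ici] at ht
      exact (hd z t ht).differentiableAt.differentiableWithinAt
    · intro t ht
      rw [interior_Ici] at ht
      rw [(hd z t ht).deriv]
      nlinarith [sq_nonneg ‖A.E (A.S t z)‖]
  have hBS : ∀ t, A.J (A.S t (A.B x)) = A.B (A.J (A.S t x)) := fun t => by
    rw [← A.J_B, A.S_comm (T := A.B)]
    intro ε hε
    have h := A.commute_J_generator hε
    exact (Commute.one_left _).sub_left h
  have hEc : Continuous fun t => ‖A.E (A.S t x)‖ ^ 2 :=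
    ((A.E.continuous.comp (A.continuous_S_apply x)).norm).pow 2
  have hE : ∀ T, 0 ≤ T → ∫ t in (0 : ℝ)..T, 2 * ‖A.E (A.S t x)‖ ^ 2 ≤ ‖A.J x‖ ^ 2 := by
    intro T hT
    have h := intervalIntegral.integral_eq_sub_of_hasDerivAt_of_le (a := 0) (b := T) hT
      ((hc x).norm.pow 2).continuousOn (fun t ht => hd x t ht.1)
      ((hEc.const_mul 2).neg.intervalIntegrable _ _)
    rw [intervalIntegral.integral_neg] at h
    change _ = ‖A.J (A.S T x)‖ ^ 2 - ‖A.J (A.S 0 x)‖ ^ 2 at h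
    rw [A.S_of_nonpos le_rfl] at h
    nlinarith [sq_nonneg ‖A.J (A.S T x)‖]
  -- A nonincreasing function is at most its mean over (0, T); the mean is bounded by the
  -- dissipation integral.
  have hbound : ∀ T, 0 < T → ‖A.S T (A.J (A.B x))‖ ^ 2 ≤ ‖A.E‖ ^ 2 * ‖A.J x‖ ^ 2 / T := by
    intro T hT
    rw [le_div_iff₀ hT, ← A.J_S]
    calc ‖A.J (A.S T (A.B x))‖ ^ 2 * T = ∫ _ in (0 : ℝ)..T, ‖A.J (A.S T (A.B x))‖ ^ 2 := by
          simp [mul_comm]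
      _ ≤ ∫ t in (0 : ℝ)..T, ‖A.E‖ ^ 2 * ‖A.E (A.S t x)‖ ^ 2 := by
          refine intervalIntegral.integral_mono_on hT.le (by simp)
            ((hEc.const_mul _).intervalIntegrable _ _) fun t ht => ?_
          refine (hanti (A.B x) ht.1 hT.le ht.2).trans ?_
          simp only [hBS]
          rw [← mul_pow]
          exact pow_le_pow_left₀ (norm_nonneg _) (A.norm_B_J_le _) 2
      _ ≤ ‖A.E‖ ^ 2 * ‖A.J x‖ ^ 2 := by
          rw [intervalIntegral.integral_const_mul]
          refine mul_le_mul_of_nonneg_left ?_ (sq_nonneg _)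
          have h := hE T hT.le
          rw [intervalIntegral.integral_const_mul] at h
          have : 0 ≤ ∫ t in (0 : ℝ)..T, ‖A.E (A.S t x)‖ ^ 2 :=
            intervalIntegral.integral_nonneg hT.le fun _ _ => sq_nonneg _
          linarith
  have hsq : Tendsto (fun T => ‖A.S T (A.J (A.B x))‖ ^ 2) atTop (𝓝 0) := by
    refine squeeze_zero' (.of_forall fun _ => sq_nonneg _) ?_
      (tendsto_const_nhds.div_atTop tendsto_id (a := ‖A.E‖ ^ 2 * ‖A.J x‖ ^ 2))
    filter_upwards [eventually_gt_atTop 0] with T hT using hbound T hT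
  rw [tendsto_zero_iff_norm_tendsto_zero]
  simpa [Real.sqrt_sq] using hsq.sqrt

end ResolventPair

/-! ### Product rule for primitives of Bochner integrable functions. -/

section InnerPrimitive

variable {H : Type*} [NormedAddCommGroup H] [InnerProductSpace ℝ H] [CompleteSpace H]

/-- Fubini on the square (a, b]², split along the diagonal into two triangles. This replaces
pointwise differentiation, since the source is only integrable in time. -/
theorem inner_intervalIntegral_intervalIntegral {g h : ℝ → H} {a b : ℝ} (hab : a ≤ b)
    (hg : IntervalIntegrable g volume a b) (hh : IntervalIntegrable h volume a b) :
    ⟪∫ s in a..b, g s, ∫ s in a..b, h s⟫ =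
      (∫ s in a..b, ⟪g s, ∫ t in a..s, h t⟫) + ∫ s in a..b, ⟪∫ t in a..s, g t, h s⟫ := by
  rw [intervalIntegrable_iff_integrableOn_Ioc_of_le hab] at hg hh
  simp only [intervalIntegral.integral_of_le hab]
  set ν := volume.restrict (Ioc a b) with hν
  have hI : Integrable (fun z : ℝ × ℝ => ⟪g z.1, h z.2⟫) (ν.prod ν) :=
    Integrable.op_fst_snd (op := fun x y : H => ⟪x, y⟫) (by fun_prop)
      ⟨1, fun x y => by simpa using abs_real_inner_le_norm x y⟩ hg hh
  have hT : MeasurableSet {z : ℝ × ℝ | z.2 ≤ z.1} := measurableSet_le measurable_snd measurable_fst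
  have h0 : ⟪∫ s, g s ∂ν, ∫ s, h s ∂ν⟫ = ∫ z, ⟪g z.1, h z.2⟫ ∂(ν.prod ν) := by
    rw [integral_prod _ hI, real_inner_comm, ← integral_inner hg]
    refine integral_congr_ae (.of_forall fun s => ?_)
    simp only
    rw [integral_inner hh, real_inner_comm]
  rw [h0, ← integral_add_compl hT hI, ← integral_indicator hT, ← integral_indicator hT.compl,
    integral_prod _ (hI.indicator hT), integral_prod_symm _ (hI.indicator hT.compl)]
  -- The closed triangle t ≤ s has slices `Iic s` and its complement has slices `Iio s`; the set `A`
  -- covers both, as they differ by a null set.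
  have key : ∀ (k : ℝ → H) (x : H) (s : ℝ), s ∈ Ioc a b → IntegrableOn k (Ioc a b) →
      ∀ A : Set ℝ, A =ᵐ[volume] Iic s → MeasurableSet A →
      ∫ t, A.indicator (fun t => ⟪x, k t⟫) t ∂ν = ⟪x, ∫ t in a..s, k t⟫ := by
    intro k x s hs hk A hA hAm
    rw [integral_indicator hAm, hν, Measure.restrict_restrict hAm, intervalIntegral.integral_of_le
      hs.1.le, integral_inner]
    · have : (A ∩ Ioc a b : Set ℝ) =ᵐ[volume] Ioc a s := by
        have h2 : Iic s ∩ Ioc a b = Ioc a s := by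
          ext t; simp only [mem_inter_iff, mem_Iic, mem_Ioc]
          exact ⟨fun h => ⟨h.2.1, h.1⟩, fun h => ⟨h.2, h.1, h.2.trans hs.2⟩⟩
        rw [← h2]
        exact hA.inter (ae_eq_refl _)
      rw [setIntegral_congr_set this]
    · exact hk.mono_set inter_subset_right
  congr 1
  · refine integral_congr_ae ?_
    filter_upwards [ae_restrict_mem measurableSet_Ioc] with s hs
    rw [← key h (g s) s hs hh (Iic s) (ae_eq_refl _) measurableSet_Iic]
    refine integral_congr_ae (.of_forall fun t => ?_)
    simp [indicator_apply]
  · refine integral_congr_ae ?_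
    filter_upwards [ae_restrict_mem measurableSet_Ioc] with s hs
    rw [real_inner_comm, ← key g (h s) s hs hg (Iio s) Iio_ae_eq_Iic measurableSet_Iio]
    refine integral_congr_ae (.of_forall fun t => ?_)
    simp [indicator_apply, real_inner_comm]

/-- The product rule for the inner product of two primitives. -/
theorem inner_sub_inner_eq_integral {p q g h : ℝ → H} {a b : ℝ} (hab : a ≤ b)
    (hg : IntervalIntegrable g volume a b) (hh : IntervalIntegrable h volume a b)
    (hp : ∀ s ∈ Icc a b, p s - p a = ∫ t in a..s, g t)
    (hq : ∀ s ∈ Icc a b, q s - q a = ∫ t in a..s, h t) :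
    ⟪p b, q b⟫ - ⟪p a, q a⟫ = ∫ s in a..b, (⟪g s, q s⟫ + ⟪p s, h s⟫) := by
  have hkey := inner_intervalIntegral_intervalIntegral hab hg hh
  rw [← hp b (right_mem_Icc.mpr hab), ← hq b (right_mem_Icc.mpr hab)] at hkey
  have e1 : ∫ s in a..b, ⟪g s, ∫ t in a..s, h t⟫ = ∫ s in a..b, ⟪g s, q s - q a⟫ :=
    intervalIntegral.integral_congr fun s hs => by
      rw [uIcc_of_le hab] at hs; simp only [hq s hs]
  have e2 : ∫ s in a..b, ⟪∫ t in a..s, g t, h s⟫ = ∫ s in a..b, ⟪p s - p a, h s⟫ :=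
    intervalIntegral.integral_congr fun s hs => by
      rw [uIcc_of_le hab] at hs; simp only [hp s hs]
  rw [e1, e2] at hkey
  have cont : ∀ (k l : ℝ → H), IntervalIntegrable l volume a b →
      (∀ s ∈ Icc a b, k s - k a = ∫ t in a..s, l t) → ContinuousOn k (Icc a b) := by
    intro k l hl hk
    have h1 := intervalIntegral.continuousOn_primitive_interval (μ := volume) (f := l) (a := a)
      (b := b) (by
        rw [uIcc_of_le hab, integrableOn_Icc_iff_integrableOn_Ioc]
        exact (intervalIntegrable_iff_integrableOn_Ioc_of_le hab).mp hl)
    rw [uIcc_of_le hab] at h1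
    refine (h1.const_add (k a)).congr fun s hs => ?_
    change k s = k a + ∫ t in a..s, l t
    rw [← hk s hs]; abel
  have int : ∀ (k l : ℝ → H), IntervalIntegrable l volume a b → ContinuousOn k (Icc a b) →
      IntervalIntegrable (fun s => ⟪l s, k s⟫) volume a b := by
    intro k l hl hk
    rw [intervalIntegrable_iff_integrableOn_Ioc_of_le hab] at hl ⊢
    obtain ⟨C, hC⟩ := isCompact_Icc.exists_bound_of_continuousOn hk
    have hm : AEStronglyMeasurable k (volume.restrict (Ioc a b)) :=
      (hk.mono Ioc_subset_Icc_self).aestronglyMeasurable measurableSet_Ioc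
    refine (hl.norm.mul_const C).mono' (hl.aestronglyMeasurable.inner hm) ?_
    filter_upwards [ae_restrict_mem measurableSet_Ioc] with s hs
    exact (norm_inner_le_norm _ _).trans
      (mul_le_mul_of_nonneg_left (hC s (Ioc_subset_Icc_self hs)) (norm_nonneg _))
  have cp := cont p g hg hp
  have cq := cont q h hh hq
  have i1 := int _ _ hg cq
  have i2 := int _ _ hh cp
  have i3 := int (fun _ => q a) _ hg continuousOn_const
  have i4 := int (fun _ => p a) _ hh continuousOn_const
  simp only [real_inner_comm] at i2 i4
  simp only [inner_sub_left, inner_sub_right] at hkey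
  rw [intervalIntegral.integral_sub i1 i3, intervalIntegral.integral_sub i2 i4] at hkey
  have f3 : ∫ s in a..b, ⟪g s, q a⟫ = ⟪p b - p a, q a⟫ := by
    rw [hp b (right_mem_Icc.mpr hab), real_inner_comm]
    simp only [intervalIntegral.integral_of_le hab]
    rw [← integral_inner ((intervalIntegrable_iff_integrableOn_Ioc_of_le hab).mp hg)]
    simp only [real_inner_comm]
  have f4 : ∫ s in a..b, ⟪p a, h s⟫ = ⟪p a, q b - q a⟫ := by
    rw [hq b (right_mem_Icc.mpr hab)]
    simp only [intervalIntegral.integral_of_le hab]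
    rw [← integral_inner ((intervalIntegrable_iff_integrableOn_Ioc_of_le hab).mp hh)]
  rw [f3, f4] at hkey
  rw [intervalIntegral.integral_add i1 i2]
  simp only [inner_sub_left, inner_sub_right] at hkey
  linarith

end InnerPrimitive

/-! ### Duhamel's formula. -/

namespace ResolventPair

variable {H K : Type*} [NormedAddCommGroup H] [InnerProductSpace ℝ H] [CompleteSpace H]
  [NormedAddCommGroup K] [InnerProductSpace ℝ K] (A : ResolventPair H K)

/-- Duhamel's formula. -/
def duhamel (s₀ : ℝ) (u₀ : H) (F : ℝ → H) (s : ℝ) : H :=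
  A.S (s - s₀) u₀ + ∫ r in Iic s, A.S (s - r) (F r)

variable {F : ℝ → H}

theorem aestronglyMeasurable_S_comp {α : Type*} [MeasurableSpace α] {μ : Measure α} {τ : α → ℝ}
    {G : α → H} (hτ : AEStronglyMeasurable τ μ) (hG : AEStronglyMeasurable G μ) :
    AEStronglyMeasurable (fun r => A.S (τ r) (G r)) μ := by
  have h := Continuous.comp_aestronglyMeasurable (g := fun p : ℝ × H => A.S p.1 p.2)
    A.continuous_S (hτ.prodMk hG)
  exact h

theorem integrable_S_comp {α : Type*} [MeasurableSpace α] {μ : Measure α} {τ : α → ℝ}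
    {G : α → H} (hτ : AEStronglyMeasurable τ μ) (hG : Integrable G μ) :
    Integrable (fun r => A.S (τ r) (G r)) μ :=
  hG.norm.mono' (A.aestronglyMeasurable_S_comp hτ hG.aestronglyMeasurable)
    (.of_forall fun _ => A.norm_S_le _ _)

/-- Dominated convergence with majorant ‖F r‖, uniform in s. Continuity and both limits at infinity
come from this one statement. -/
theorem tendsto_duhamel_integral (hF : Integrable F) {l : Filter ℝ} [l.IsCountablyGenerated]
    {L : ℝ → H}
    (h : ∀ᵐ r, Tendsto (fun s => (Iic s).indicator (fun r => A.S (s - r) (F r)) r) l (𝓝 (L r))) :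
    Tendsto (fun s => ∫ r in Iic s, A.S (s - r) (F r)) l (𝓝 (∫ r, L r)) := by
  simp_rw [← integral_indicator measurableSet_Iic]
  refine tendsto_integral_filter_of_dominated_convergence (fun r => ‖F r‖) ?_ ?_ hF.norm h
  · refine .of_forall fun s => (A.integrable_S_comp ?_ hF).aestronglyMeasurable.indicator
      measurableSet_Iic
    exact (continuous_const.sub continuous_id).aestronglyMeasurable
  · exact .of_forall fun s => .of_forall fun r =>
      (norm_indicator_le_norm_self _ _).trans (A.norm_S_le _ _)

theorem continuous_duhamel (s₀ : ℝ) (u₀ : H) (hF : Integrable F) :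
    Continuous (A.duhamel s₀ u₀ F) := by
  refine ((A.continuous_S_apply u₀).comp (continuous_sub_right s₀)).add ?_
  rw [continuous_iff_continuousAt]
  intro s
  rw [ContinuousAt, ← integral_indicator measurableSet_Iic]
  refine A.tendsto_duhamel_integral hF ?_
  -- At r = s the cutoff r ≤ s jumps; this single point is discarded.
  have hne : ∀ᵐ r : ℝ, r ≠ s := by simp [ae_iff, measure_singleton]
  filter_upwards [hne] with r hr
  rcases hr.lt_or_gt with hr | hr
  · rw [indicator_of_mem (mem_Iic.mpr hr.le)]
    refine Tendsto.congr' ?_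
      (((A.continuous_S_apply (F r)).comp (continuous_sub_right r)).tendsto s)
    filter_upwards [lt_mem_nhds hr] with t ht
    rw [indicator_of_mem (mem_Iic.mpr ht.le)]; rfl
  · rw [indicator_of_notMem (by simpa using hr)]
    refine tendsto_const_nhds.congr' ?_
    filter_upwards [gt_mem_nhds hr] with t ht
    rw [indicator_of_notMem (by simpa using ht)]

theorem tendsto_duhamel_atTop (s₀ : ℝ) (u₀ : H) (hF : Integrable F) :
    Tendsto (A.duhamel s₀ u₀ F) atTop (𝓝 0) := by
  have h1 : Tendsto (fun s => A.S (s - s₀) u₀) atTop (𝓝 0) :=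
    (A.tendsto_S_atTop u₀).comp (tendsto_atTop_add_const_right _ _ tendsto_id)
  have h2 := A.tendsto_duhamel_integral hF (l := atTop) (L := fun _ => 0) <| .of_forall fun r => by
    refine Tendsto.congr' ?_
      ((A.tendsto_S_atTop (F r)).comp (tendsto_atTop_add_const_right atTop (-r) tendsto_id))
    filter_upwards [eventually_ge_atTop r] with t ht
    rw [indicator_of_mem (mem_Iic.mpr ht)]; rfl
  rw [integral_zero] at h2
  have h3 := h1.add h2
  rw [add_zero] at h3
  exact h3

/-- The initial value must be zero here, because S is the identity at negative times and the free
term would equal u₀ near -∞. -/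
theorem tendsto_duhamel_atBot (s₀ : ℝ) (hF : Integrable F) :
    Tendsto (A.duhamel s₀ 0 F) atBot (𝓝 0) := by
  have h2 := A.tendsto_duhamel_integral hF (l := atBot) (L := fun _ => 0) <| .of_forall fun r => by
    refine Tendsto.congr' ?_ tendsto_const_nhds
    filter_upwards [eventually_lt_atBot r] with t ht
    rw [indicator_of_notMem (by simpa using ht)]
  rw [integral_zero] at h2
  refine h2.congr fun s => ?_
  rw [duhamel, S_zero_right, zero_add]

theorem norm_duhamel_le (s₀ : ℝ) (u₀ : H) (hF : Integrable F) (s : ℝ) :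
    ‖A.duhamel s₀ u₀ F s‖ ≤ ‖u₀‖ + ∫ r, ‖F r‖ := by
  refine norm_add_le_of_le (A.norm_S_le _ _) ?_
  refine (norm_integral_le_of_norm_le hF.norm.integrableOn
    (.of_forall fun r => A.norm_S_le _ _)).trans ?_
  exact setIntegral_le_integral hF.norm (.of_forall fun _ => norm_nonneg _)

theorem duhamel_self {s₀ : ℝ} (u₀ : H) (hF : ∀ r ≤ s₀, F r = 0) :
    A.duhamel s₀ u₀ F s₀ = u₀ := by
  rw [duhamel, sub_self, A.S_of_nonpos le_rfl, setIntegral_eq_zero_of_forall_eq_zero, add_zero]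
  intro r hr
  rw [hF r hr, S_zero_right]

theorem J_S_sub_J_S {a b : ℝ} (ha : 0 ≤ a) (hab : a ≤ b) (x : H) :
    A.J (A.S b x) - A.J (A.S a x) = -∫ r in a..b, A.B (A.S r x) := by
  have hc : Continuous fun r => A.B (A.S r x) := A.B.continuous.comp (A.continuous_S_apply x)
  rw [A.J_S_eq ha, A.J_S_eq (ha.trans hab), ← intervalIntegral.integral_interval_sub_left
    (hc.intervalIntegrable 0 b) (hc.intervalIntegrable 0 a)]
  abel

/-- The equation for the response to a source concentrated at time r: before r nothing happens, at r
there is a jump by Jx, afterwards the semigroup equation holds. The three cases place r relative to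
a and b. -/
theorem J_indicator_S_sub {a b : ℝ} (hab : a ≤ b) (r : ℝ) (x : H) :
    A.J ((Iic b).indicator (fun r => A.S (b - r) x) r) -
      A.J ((Iic a).indicator (fun r => A.S (a - r) x) r) =
      (Ioc a b).indicator (fun _ => A.J x) r -
        ∫ t in a..b, A.B ((Iic t).indicator (fun r => A.S (t - r) x) r) := by
  have hc : Continuous fun t => A.B (A.S t x) := A.B.continuous.comp (A.continuous_S_apply x)
  rcases le_or_gt r a with hra | hra
  · rw [indicator_of_mem (mem_Iic.mpr (hra.trans hab)), indicator_of_mem (mem_Iic.mpr hra),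
      indicator_of_notMem (fun h => absurd hra (not_le.mpr h.1)),
      A.J_S_sub_J_S (sub_nonneg.mpr hra) (by linarith), zero_sub,
      ← intervalIntegral.integral_comp_sub_right (fun t => A.B (A.S t x)) r]
    congr 1
    refine intervalIntegral.integral_congr fun t ht => ?_
    rw [uIcc_of_le hab] at ht
    simp only [indicator_of_mem (mem_Iic.mpr (hra.trans ht.1))]
  rcases le_or_gt r b with hrb | hrb
  · rw [indicator_of_mem (mem_Iic.mpr hrb), indicator_of_notMem (by simpa using hra),
      indicator_of_mem (show r ∈ Ioc a b from ⟨hra, hrb⟩), map_zero, sub_zero,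
      A.J_S_eq (sub_nonneg.mpr hrb)]
    congr 1
    have h0 : ∫ t in (0 : ℝ)..b - r, A.B (A.S t x) = ∫ t in r..b, A.B (A.S (t - r) x) := by
      rw [intervalIntegral.integral_comp_sub_right (fun t => A.B (A.S t x)) r, sub_self]
    rw [h0, intervalIntegral.integral_of_le hrb, intervalIntegral.integral_of_le hab,
      ← integral_indicator measurableSet_Ioc, ← integral_indicator measurableSet_Ioc]
    refine integral_congr_ae ?_
    have hne : ∀ᵐ t : ℝ, t ≠ r := by simp [ae_iff, measure_singleton]
    filter_upwards [hne] with t ht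
    by_cases htb : t ≤ b <;> by_cases hrt : r ≤ t
    · have : r < t := lt_of_le_of_ne hrt (Ne.symm ht)
      simp [indicator_apply, htb, hrt, this, hra.trans this]
    · have : ¬ r < t := fun h => hrt h.le
      simp [indicator_apply, hrt, this]
    · simp [indicator_apply, htb]
    · simp [indicator_apply, htb]
  · rw [indicator_of_notMem (by simpa using hrb), indicator_of_notMem (by simpa using hra),
      indicator_of_notMem (fun h => absurd hrb (not_lt.mpr h.2)), sub_self, zero_sub, zero_eq_neg]
    refine (intervalIntegral.integral_congr fun t ht => ?_).trans intervalIntegral.integral_zero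
    rw [uIcc_of_le hab] at ht
    simp only [indicator_of_notMem (show r ∉ Iic t by simpa using ht.2.trans_lt hrb), map_zero]

/-- Integrate `J_indicator_S_sub` over r with x = F r and exchange the integrals. The alternative
`u₀ = 0 ∨ s₀ ≤ a` is needed because S is frozen at negative times, so the free term solves the
equation only after s₀. -/
theorem J_duhamel_sub (s₀ : ℝ) (u₀ : H) (hF : Integrable F) {a b : ℝ} (hab : a ≤ b)
    (ha : u₀ = 0 ∨ s₀ ≤ a) :
    A.J (A.duhamel s₀ u₀ F b) - A.J (A.duhamel s₀ u₀ F a) =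
      ∫ s in a..b, (A.J (F s) - A.B (A.duhamel s₀ u₀ F s)) := by
  have hV : A.J (A.S (b - s₀) u₀) - A.J (A.S (a - s₀) u₀) =
      -∫ s in a..b, A.B (A.S (s - s₀) u₀) := by
    rcases ha with rfl | ha
    · simp [S_zero_right]
    · rw [A.J_S_sub_J_S (sub_nonneg.mpr ha) (by linarith),
        ← intervalIntegral.integral_comp_sub_right (fun t => A.B (A.S t u₀)) s₀]
  have hm : ∀ s, Integrable ((Iic s).indicator fun r => A.S (s - r) (F r)) := fun s =>
    (A.integrable_S_comp (continuous_const.sub continuous_id).aestronglyMeasurable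
      hF).indicator measurableSet_Iic
  have hprod0 : Integrable (Function.uncurry fun (t r : ℝ) =>
      A.B ((Iic t).indicator (fun r => A.S (t - r) (F r)) r))
      ((volume.restrict (Ioc a b)).prod volume) := by
    have h1 : Integrable (fun z : ℝ × ℝ => F z.2) ((volume.restrict (Ioc a b)).prod volume) :=
      hF.comp_snd _
    have h2 : Integrable (fun z : ℝ × ℝ => A.S (z.1 - z.2) (F z.2))
        ((volume.restrict (Ioc a b)).prod volume) :=
      A.integrable_S_comp (continuous_fst.sub continuous_snd).aestronglyMeasurable h1
    have h3 := A.B.integrable_comp (h2.indicator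
      (measurableSet_le measurable_snd measurable_fst : MeasurableSet {z : ℝ × ℝ | z.2 ≤ z.1}))
    refine h3.congr (.of_forall fun z => ?_)
    simp [Function.uncurry, indicator_apply]
  have hprod := hprod0
  rw [← uIoc_of_le hab] at hprod
  have hW : A.J (∫ r in Iic b, A.S (b - r) (F r)) - A.J (∫ r in Iic a, A.S (a - r) (F r)) =
      (∫ s in a..b, A.J (F s)) - ∫ s in a..b, A.B (∫ r in Iic s, A.S (s - r) (F r)) := by
    simp_rw [← integral_indicator measurableSet_Iic]
    rw [← A.J.integral_comp_comm (hm b), ← A.J.integral_comp_comm (hm a),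
      ← integral_sub (A.J.integrable_comp (hm b)) (A.J.integrable_comp (hm a))]
    have e : ∀ r, A.J ((Iic b).indicator (fun r => A.S (b - r) (F r)) r) -
        A.J ((Iic a).indicator (fun r => A.S (a - r) (F r)) r) =
        (Ioc a b).indicator (fun r => A.J (F r)) r -
          ∫ t in a..b, A.B ((Iic t).indicator (fun r => A.S (t - r) (F r)) r) := fun r => by
      have := A.J_indicator_S_sub hab r (F r)
      simpa only [indicator_apply] using this
    simp_rw [e]
    rw [integral_sub ((A.J.integrable_comp hF).indicator measurableSet_Ioc), integral_indicator
      measurableSet_Ioc, ← intervalIntegral.integral_of_le hab]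
    · congr 1
      have := intervalIntegral_integral_swap hprod
      rw [← this]
      refine intervalIntegral.integral_congr fun t _ => ?_
      exact A.B.integral_comp_comm (hm t)
    · have := hprod.swap.integral_prod_left
      refine this.congr (.of_forall fun r => ?_)
      simp only [intervalIntegral.integral_of_le hab, uIoc_of_le hab]
      rfl
  have hc : Continuous fun s => A.B (A.S (s - s₀) u₀) :=
    A.B.continuous.comp ((A.continuous_S_apply u₀).comp (continuous_sub_right s₀))
  have hdc := A.continuous_duhamel s₀ u₀ hF
  have hc2 : Continuous fun s => A.B (∫ r in Iic s, A.S (s - r) (F r)) := by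
    have : (fun s => ∫ r in Iic s, A.S (s - r) (F r)) =
        fun s => A.duhamel s₀ u₀ F s - A.S (s - s₀) u₀ := by ext s; simp [duhamel]
    exact A.B.continuous.comp (this ▸ hdc.sub
      ((A.continuous_S_apply u₀).comp (continuous_sub_right s₀)))
  have hJF : IntervalIntegrable (fun s => A.J (F s)) volume a b :=
    (A.J.integrable_comp hF).intervalIntegrable
  have e1 : ∫ s in a..b, (A.J (F s) - A.B (A.duhamel s₀ u₀ F s)) =
      (∫ s in a..b, A.J (F s)) - ∫ s in a..b, A.B (A.duhamel s₀ u₀ F s) :=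
    intervalIntegral.integral_sub hJF ((A.B.continuous.comp hdc).intervalIntegrable _ _)
  have e2 : ∫ s in a..b, A.B (A.duhamel s₀ u₀ F s) = (∫ s in a..b, A.B (A.S (s - s₀) u₀)) +
      ∫ s in a..b, A.B (∫ r in Iic s, A.S (s - r) (F r)) := by
    rw [← intervalIntegral.integral_add (hc.intervalIntegrable _ _) (hc2.intervalIntegrable _ _)]
    simp only [duhamel, map_add]
  rw [e1, e2, duhamel, duhamel, map_add, map_add]
  linear_combination (norm := module) hV + hW

end ResolventPair

/-! ### Mild solutions: energy identity, gradient and weak form. -/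

theorem norm_sq_Lp_eq_integral {α K : Type*} [MeasurableSpace α] {ν : Measure α}
    [NormedAddCommGroup K] [InnerProductSpace ℝ K] (g : Lp K 2 ν) :
    ‖g‖ ^ 2 = ∫ s, ‖g s‖ ^ 2 ∂ν := by
  rw [← real_inner_self_eq_norm_sq, L2.inner_def]
  simp only [real_inner_self_eq_norm_sq]

theorem tendsto_one_div_add_one_nhdsGT :
    Tendsto (fun k : ℕ => 1 / ((k : ℝ) + 1)) atTop (𝓝[>] 0) :=
  tendsto_nhdsWithin_iff.mpr ⟨tendsto_one_div_add_atTop_nhds_zero_nat,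
    .of_forall fun k => by simp only [mem_Ioi]; positivity⟩

namespace ResolventPair

variable {H K : Type*} [NormedAddCommGroup H] [InnerProductSpace ℝ H] [CompleteSpace H]
  [NormedAddCommGroup K] [InnerProductSpace ℝ K]

/-- A bounded continuous `u` that solves `∂ₛ u + D* D u = F` on `I` in the sense that
`∂ₛ J u = J F - B u`, with limits `x₁` and `x₂` at the end points of `I`, which is exhausted by the
intervals `(a n, b n]`. -/
structure MildSolution (A : ResolventPair H K) (I : Set ℝ) (F u : ℝ → H) (x₁ x₂ : H)
    (a b : ℕ → ℝ) : Prop where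
  integrable : Integrable F
  cont : Continuous u
  bound : ∃ C, ∀ s, ‖u s‖ ≤ C
  J_sub : ∀ s ∈ I, ∀ t ∈ I, s ≤ t →
    A.J (u t) - A.J (u s) = ∫ r in s..t, (A.J (F r) - A.B (u r))
  ordConnected : I.OrdConnected
  left_mem : ∀ n, a n ∈ I
  right_mem : ∀ n, b n ∈ I
  le : ∀ n, a n ≤ b n
  cover : AECover (volume.restrict I) atTop fun n => Ioc (a n) (b n)
  tendsto_left : Tendsto (fun n => u (a n)) atTop (𝓝 x₁)
  tendsto_right : Tendsto (fun n => u (b n)) atTop (𝓝 x₂)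

namespace MildSolution

variable {A : ResolventPair H K} {I : Set ℝ} {F u : ℝ → H} {x₁ x₂ : H} {a b : ℕ → ℝ}
  (h : A.MildSolution I F u x₁ x₂ a b)

include h

theorem Ioc_subset (n : ℕ) : Ioc (a n) (b n) ⊆ I :=
  Ioc_subset_Icc_self.trans (h.ordConnected.out (h.left_mem n) (h.right_mem n))

theorem restrict_Ioc (n : ℕ) :
    (volume.restrict I).restrict (Ioc (a n) (b n)) = volume.restrict (Ioc (a n) (b n)) := by
  rw [Measure.restrict_restrict measurableSet_Ioc, inter_eq_left.mpr (h.Ioc_subset n)]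

theorem tendsto_intervalIntegral {E : Type*} [NormedAddCommGroup E] [NormedSpace ℝ E] {g : ℝ → E}
    (hg : IntegrableOn g I) :
    Tendsto (fun n => ∫ s in a n..b n, g s) atTop (𝓝 (∫ s in I, g s)) := by
  refine (h.cover.integral_tendsto_of_countably_generated hg).congr fun n => ?_
  rw [h.restrict_Ioc, intervalIntegral.integral_of_le (h.le n)]

/-- For regularization N is `R ε` and T is `P ε`, which gives an equation for P ε u itself rather
than for Ju. -/
theorem apply_sub {T N : H →L[ℝ] H} (hT : ∀ x, N (A.J x) = T x) {s t : ℝ} (hs : s ∈ I)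
    (ht : t ∈ I) (hst : s ≤ t) :
    T (u t) - T (u s) = ∫ r in s..t, (T (F r) - N (A.B (u r))) := by
  have hi : IntervalIntegrable (fun r => A.J (F r) - A.B (u r)) volume s t :=
    (A.J.integrable_comp h.integrable).intervalIntegrable.sub
      ((A.B.continuous.comp h.cont).intervalIntegrable _ _)
  have h1 := congrArg N (h.J_sub s hs t ht hst)
  rw [map_sub, hT, hT, ← N.intervalIntegral_comp_comm hi] at h1
  simpa only [map_sub, hT] using h1

theorem intervalIntegrable_apply (T N : H →L[ℝ] H) (s t : ℝ) :
    IntervalIntegrable (fun r => T (F r) - N (A.B (u r))) volume s t :=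
  (T.integrable_comp h.integrable).intervalIntegrable.sub
    ((N.continuous.comp (A.B.continuous.comp h.cont)).intervalIntegrable _ _)

theorem integrable_inner (T₁ T₂ : H →L[ℝ] H) : Integrable fun s => ⟪T₁ (F s), T₂ (u s)⟫ := by
  obtain ⟨C, hC⟩ := h.bound
  refine ((T₁.integrable_comp h.integrable).norm.mul_const (‖T₂‖ * C)).mono' ?_
    (.of_forall fun s => ?_)
  · exact (T₁.integrable_comp h.integrable).aestronglyMeasurable.inner
      (T₂.continuous.comp h.cont).aestronglyMeasurable
  · refine (norm_inner_le_norm (𝕜 := ℝ) _ _).trans (mul_le_mul_of_nonneg_left ?_ (norm_nonneg _))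
    exact (T₂.le_opNorm _).trans (mul_le_mul_of_nonneg_left (hC s) (norm_nonneg _))

theorem continuous_E_norm_sq (N : H →L[ℝ] H) : Continuous fun s => ‖A.E (N (u s))‖ ^ 2 :=
  (A.E.continuous.comp (N.continuous.comp h.cont)).norm.pow 2

/-- The product rule for JNu with itself; the dissipation arises from ⟪BNu, JNu⟫ = ‖ENu‖². A general
N commuting with J is kept so that differences of regularizations are covered too. -/
theorem energy_Ioc {N : H →L[ℝ] H}
    (hN : ∀ x, N (A.J x) = A.J (N x)) (n : ℕ) :
    ‖A.J (N (u (b n)))‖ ^ 2 - ‖A.J (N (u (a n)))‖ ^ 2 =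
      2 * (∫ s in a n..b n, ⟪A.J (N (F s)), A.J (N (u s))⟫) -
        2 * ∫ s in a n..b n, ‖A.E (N (u s))‖ ^ 2 := by
  set T : H →L[ℝ] H := A.J ∘L N with hTdef
  have hp : ∀ s ∈ Icc (a n) (b n), T (u s) - T (u (a n)) =
      ∫ r in a n..s, (T (F r) - N (A.B (u r))) := fun s hs =>
    h.apply_sub (fun x => hN x) (h.left_mem n)
      (h.ordConnected.out (h.left_mem n) (h.right_mem n) hs) hs.1
  have hi := h.intervalIntegrable_apply T N (a n) (b n)
  have hmain := inner_sub_inner_eq_integral (h.le n) hi hi hp hp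
  simp only [real_inner_self_eq_norm_sq] at hmain
  change ‖T (u (b n))‖ ^ 2 - ‖T (u (a n))‖ ^ 2 = _
  rw [hmain, ← mul_sub]
  change _ = 2 * ((∫ s in a n..b n, ⟪T (F s), T (u s)⟫) - _)
  rw [← intervalIntegral.integral_sub (h.integrable_inner T T).intervalIntegrable
    ((h.continuous_E_norm_sq N).intervalIntegrable _ _), ← intervalIntegral.integral_const_mul]
  refine intervalIntegral.integral_congr fun s _ => ?_
  have hNB : N (A.B (u s)) = A.B (N (u s)) := by simp only [B_apply, map_sub, hN]
  have e : ⟪N (A.B (u s)), T (u s)⟫ = ‖A.E (N (u s))‖ ^ 2 := by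
    rw [hNB]; exact A.inner_B_J (N (u s))
  simp only [inner_sub_left, real_inner_comm (T (F s) - N (A.B (u s)))]
  rw [e]
  ring

/-- All terms except the dissipation converge along the exhaustion, hence so does the dissipation;
being nonnegative, it is then integrable over all of I. -/
theorem energy_apply {N : H →L[ℝ] H}
    (hN : ∀ x, N (A.J x) = A.J (N x)) :
    IntegrableOn (fun s => ‖A.E (N (u s))‖ ^ 2) I ∧
      ‖A.J (N x₂)‖ ^ 2 - ‖A.J (N x₁)‖ ^ 2 =
        2 * (∫ s in I, ⟪A.J (N (F s)), A.J (N (u s))⟫) -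
          2 * ∫ s in I, ‖A.E (N (u s))‖ ^ 2 := by
  set T : H →L[ℝ] H := A.J ∘L N with hTdef
  have lim : ∀ {x : H} {c : ℕ → ℝ}, Tendsto (fun n => u (c n)) atTop (𝓝 x) →
      Tendsto (fun n => ‖A.J (N (u (c n)))‖ ^ 2) atTop (𝓝 (‖A.J (N x)‖ ^ 2)) := fun hc =>
    (((T.continuous.tendsto _).comp hc).norm.pow 2)
  have l1 := lim h.tendsto_left
  have l2 := lim h.tendsto_right
  have l3 := h.tendsto_intervalIntegral (h.integrable_inner T T).integrableOn
  have e : ∀ n, ∫ s in a n..b n, ‖A.E (N (u s))‖ ^ 2 =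
      (∫ s in a n..b n, ⟪T (F s), T (u s)⟫) -
        (‖A.J (N (u (b n)))‖ ^ 2 - ‖A.J (N (u (a n)))‖ ^ 2) / 2 := fun n => by
    rw [h.energy_Ioc hN n]
    simp only [hTdef, ContinuousLinearMap.comp_apply]
    ring
  have l4 := (l3.sub ((l2.sub l1).div_const 2)).congr fun n => (e n).symm
  have hint : IntegrableOn (fun s => ‖A.E (N (u s))‖ ^ 2) I := by
    refine h.cover.integrable_of_integral_tendsto_of_nonneg_ae _ (fun n => ?_)
      (.of_forall fun s => sq_nonneg _) (l4.congr fun n => ?_)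
    · rw [IntegrableOn, h.restrict_Ioc]
      exact (h.continuous_E_norm_sq N).integrableOn_Ioc
    · rw [h.restrict_Ioc, intervalIntegral.integral_of_le (h.le n)]
  refine ⟨hint, ?_⟩
  have := tendsto_nhds_unique l4 (h.tendsto_intervalIntegral hint)
  rw [← this]
  simp only [hTdef, ContinuousLinearMap.comp_apply]
  ring

theorem memLp_E {N : H →L[ℝ] H}
    (hN : ∀ x, N (A.J x) = A.J (N x)) :
    MemLp (fun s => A.E (N (u s))) 2 (volume.restrict I) := by
  rw [memLp_two_iff_integrable_sq_norm]
  · exact (h.energy_apply hN).1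
  · exact (A.E.continuous.comp (N.continuous.comp h.cont)).aestronglyMeasurable

theorem memLp_E_R {ε : ℝ} (hε : 0 < ε) :
    MemLp (fun s => A.E (A.R ε (u s))) 2 (volume.restrict I) :=
  h.memLp_E (fun x => (A.J_R hε x).symm)

theorem tendsto_integral_norm_P_sub :
    Tendsto (fun p : ℝ × ℝ => ∫ s, ‖A.P p.1 (F s) - A.P p.2 (F s)‖) (𝓝[>] 0 ×ˢ 𝓝[>] 0) (𝓝 0) := by
  have hpos : ∀ᶠ p : ℝ × ℝ in 𝓝[>] 0 ×ˢ 𝓝[>] 0, 0 < p.1 ∧ 0 < p.2 :=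
    prod_mem_prod self_mem_nhdsWithin self_mem_nhdsWithin
  suffices h0 : Tendsto (fun p : ℝ × ℝ => ∫ s, ‖A.P p.1 (F s) - A.P p.2 (F s)‖)
      (𝓝[>] 0 ×ˢ 𝓝[>] 0) (𝓝 (∫ _ : ℝ, (0 : ℝ))) by simpa using h0
  refine tendsto_integral_filter_of_dominated_convergence (fun s => 2 * ‖F s‖) ?_ ?_
    (h.integrable.norm.const_mul 2) ?_
  · exact .of_forall fun p => (((A.P p.1).integrable_comp h.integrable).sub
      ((A.P p.2).integrable_comp h.integrable)).norm.aestronglyMeasurable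
  · filter_upwards [hpos] with p hp
    refine .of_forall fun s => ?_
    rw [norm_norm, two_mul]
    exact (norm_sub_le _ _).trans (add_le_add (A.norm_P_le hp.1 _) (A.norm_P_le hp.2 _))
  · refine .of_forall fun s => ?_
    simpa using ((((A.tendsto_P (F s)).comp tendsto_fst).sub
      ((A.tendsto_P (F s)).comp tendsto_snd)).norm)

/-- The energy identity with N = R ε - R δ: the final term has a favourable sign, and the source is
paired with a function of norm at most 2C. The right-hand side tends to 0 because P ε → 1 strongly.
-/
theorem integral_E_R_sub_le {C : ℝ} (hC : ∀ s, ‖u s‖ ≤ C) {ε δ : ℝ} (hε : 0 < ε) (hδ : 0 < δ) :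
    ∫ s in I, ‖A.E (A.R ε (u s)) - A.E (A.R δ (u s))‖ ^ 2 ≤
      ‖A.P ε x₁ - A.P δ x₁‖ ^ 2 + 2 * C * ∫ s, ‖A.P ε (F s) - A.P δ (F s)‖ := by
  have hC0 : 0 ≤ C := (norm_nonneg _).trans (hC 0)
  have henergy := (h.energy_apply (N := A.R ε - A.R δ)
    (fun x => by simp only [sub_apply, map_sub, A.J_R hε, A.J_R hδ])).2
  simp only [sub_apply, map_sub, ← P_apply] at henergy
  have hle : ∫ s in I, ⟪A.P ε (F s) - A.P δ (F s), A.P ε (u s) - A.P δ (u s)⟫ ≤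
      2 * C * ∫ s, ‖A.P ε (F s) - A.P δ (F s)‖ := by
    have hi : Integrable fun s => 2 * C * ‖A.P ε (F s) - A.P δ (F s)‖ :=
      ((((A.P ε).integrable_comp h.integrable).sub
        ((A.P δ).integrable_comp h.integrable)).norm).const_mul _
    rw [← integral_const_mul]
    refine (Real.le_norm_self _).trans ((norm_integral_le_of_norm_le hi.integrableOn ?_).trans
      (setIntegral_le_integral hi (.of_forall fun s => by positivity)))
    refine .of_forall fun s => (norm_inner_le_norm (𝕜 := ℝ) _ _).trans ?_
    rw [mul_comm]
    refine mul_le_mul_of_nonneg_right ?_ (norm_nonneg _)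
    rw [two_mul]
    exact (norm_sub_le _ _).trans (add_le_add ((A.norm_P_le hε _).trans (hC s))
      ((A.norm_P_le hδ _).trans (hC s)))
  nlinarith [sq_nonneg ‖A.P ε x₂ - A.P δ x₂‖]

/-- The gradients `E R ε u` of the regularizations `P ε u` for `ε = 1 / (k + 1)`. -/
def gradientApprox (k : ℕ) : Lp K 2 (volume.restrict I) :=
  (h.memLp_E_R (Nat.one_div_pos_of_nat (n := k))).toLp

theorem coeFn_gradientApprox (k : ℕ) : ∀ᵐ s ∂(volume.restrict I),
    h.gradientApprox k s = A.E (A.R (1 / ((k : ℝ) + 1)) (u s)) :=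
  (h.memLp_E_R (Nat.one_div_pos_of_nat (n := k))).coeFn_toLp

/-- The gradients of the regularizations `P ε u` converge in `L²(I; K)`. -/
theorem exists_tendsto_E_R [CompleteSpace K] : ∃ G : Lp K 2 (volume.restrict I),
    Tendsto h.gradientApprox atTop (𝓝 G) := by
  obtain ⟨C, hC⟩ := h.bound
  apply cauchySeq_tendsto_of_complete
  set g := h.gradientApprox
  rw [cauchySeq_iff_tendsto_dist_atTop_0]
  have hlim : Tendsto (fun p : ℝ × ℝ => ‖A.P p.1 x₁ - A.P p.2 x₁‖ ^ 2 +
      2 * C * ∫ s, ‖A.P p.1 (F s) - A.P p.2 (F s)‖) (𝓝[>] 0 ×ˢ 𝓝[>] 0) (𝓝 0) := by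
    have h1 := ((((A.tendsto_P x₁).comp (tendsto_fst (g := 𝓝[>] (0 : ℝ)))).sub
      ((A.tendsto_P x₁).comp (tendsto_snd (f := 𝓝[>] (0 : ℝ))))).norm.pow 2)
    simpa using h1.add (h.tendsto_integral_norm_P_sub.const_mul (2 * C))
  have hseq := hlim.comp
    (tendsto_one_div_add_one_nhdsGT.prodMap tendsto_one_div_add_one_nhdsGT)
  rw [prod_atTop_atTop_eq] at hseq
  have hsq : Tendsto (fun p : ℕ × ℕ => dist (g p.1) (g p.2) ^ 2) atTop (𝓝 0) := by
    refine squeeze_zero (fun _ => sq_nonneg _) (fun p => ?_) hseq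
    rw [dist_eq_norm, norm_sq_Lp_eq_integral]
    refine le_trans (le_of_eq ?_) (h.integral_E_R_sub_le hC
      (Nat.one_div_pos_of_nat (n := p.1)) (Nat.one_div_pos_of_nat (n := p.2)))
    refine integral_congr_ae ?_
    filter_upwards [Lp.coeFn_sub (g p.1) (g p.2),
      h.coeFn_gradientApprox p.1,
      h.coeFn_gradientApprox p.2] with s h1 h2 h3
    rw [h1, Pi.sub_apply, h2, h3]
    rfl
  simpa [Real.sqrt_sq] using hsq.sqrt

/-- The gradient of `u`, its energy identity and the weak formulation, where `Γ` is the graph of the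
gradient. -/
theorem exists_gradient [CompleteSpace K] {Γ : Set (H × K)} (hclosed : IsClosed Γ)
    (hmem : ∀ x, (A.J x, A.E x) ∈ Γ) (hE : ∀ x, ∀ p ∈ Γ, ⟪A.E x, p.2⟫ = ⟪A.B x, p.1⟫) :
    ∃ G : ℝ → K, MemLp G 2 (volume.restrict I) ∧
      (∀ᵐ s ∂(volume.restrict I), (u s, G s) ∈ Γ) ∧
      1 / 2 * ‖x₂‖ ^ 2 + ∫ s in I, ‖G s‖ ^ 2 = 1 / 2 * ‖x₁‖ ^ 2 + ∫ s in I, ⟪F s, u s⟫ ∧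
      ∀ (φ φ' : ℝ → H) (ψ : ℝ → K), (∀ s, HasDerivAt φ (φ' s) s) → Continuous φ' → Continuous ψ →
        (∀ s, (φ s, ψ s) ∈ Γ) → ∀ n,
        ⟪u (b n), φ (b n)⟫ - ⟪u (a n), φ (a n)⟫ =
          (∫ s in a n..b n, ⟪F s, φ s⟫) - (∫ s in a n..b n, ⟪G s, ψ s⟫) +
            ∫ s in a n..b n, ⟪u s, φ' s⟫ := by
  obtain ⟨G, hG⟩ := h.exists_tendsto_E_R
  obtain ⟨C, hC⟩ := h.bound
  have hpos : ∀ k : ℕ, 0 < 1 / ((k : ℝ) + 1) := fun k => Nat.one_div_pos_of_nat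
  have hPlim : ∀ x, Tendsto (fun k : ℕ => A.P (1 / ((k : ℝ) + 1)) x) atTop (𝓝 x) := fun x =>
    (A.tendsto_P x).comp tendsto_one_div_add_one_nhdsGT
  have hcoe : ∀ᵐ s ∂(volume.restrict I), ∀ k : ℕ,
      h.gradientApprox k s = A.E (A.R (1 / ((k : ℝ) + 1)) (u s)) :=
    ae_all_iff.mpr fun k => h.coeFn_gradientApprox k
  refine ⟨G, Lp.memLp G, ?_, ?_, ?_⟩
  -- Along a subsequence the pairs (P ε u(s), E R ε u(s)) converge for almost every s, and each is a
  -- pair (Jx, Ex) with x = R ε u(s), hence in the closed set Γ.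
  · obtain ⟨ns, hns, hlim⟩ := (tendstoInMeasure_of_tendsto_Lp hG).exists_seq_tendsto_ae
    filter_upwards [hlim, hcoe] with s hs hc
    refine hclosed.mem_of_tendsto (((hPlim (u s)).comp hns.tendsto_atTop).prodMk_nhds hs)
      (.of_forall fun k => ?_)
    rw [hc]
    exact hmem _
  · have henergy : ∀ k : ℕ, ‖A.P (1 / ((k : ℝ) + 1)) x₂‖ ^ 2 - ‖A.P (1 / ((k : ℝ) + 1)) x₁‖ ^ 2 =
        2 * (∫ s in I, ⟪A.P (1 / ((k : ℝ) + 1)) (F s), A.P (1 / ((k : ℝ) + 1)) (u s)⟫) -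
          2 * ‖h.gradientApprox k‖ ^ 2 := fun k => by
      rw [norm_sq_Lp_eq_integral]
      refine (h.energy_apply (N := A.R (1 / ((k : ℝ) + 1)))
        (fun x => (A.J_R (hpos k) x).symm)).2.trans ?_
      congr 2
      refine integral_congr_ae ?_
      filter_upwards [hcoe] with s hs
      rw [hs]
    have l1 : Tendsto (fun k : ℕ => ∫ s in I, ⟪A.P (1 / ((k : ℝ) + 1)) (F s),
        A.P (1 / ((k : ℝ) + 1)) (u s)⟫) atTop (𝓝 (∫ s in I, ⟪F s, u s⟫)) := by
      refine tendsto_integral_of_dominated_convergence (fun s => ‖F s‖ * C)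
        (fun k => (h.integrable_inner _ _).aestronglyMeasurable.restrict)
        (h.integrable.norm.mul_const C).integrableOn (fun k => .of_forall fun s => ?_)
        (.of_forall fun s => (hPlim _).inner (hPlim _))
      exact (norm_inner_le_norm (𝕜 := ℝ) _ _).trans (mul_le_mul (A.norm_P_le (hpos k) _)
        ((A.norm_P_le (hpos k) _).trans (hC s)) (norm_nonneg _) (norm_nonneg _))
    have l2 := (((hPlim x₂).norm.pow 2).sub ((hPlim x₁).norm.pow 2))
    have l3 := (l1.const_mul 2).sub ((hG.norm.pow 2).const_mul 2)
    have e := tendsto_nhds_unique l2 (l3.congr fun k => (henergy k).symm)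
    rw [norm_sq_Lp_eq_integral] at e
    linarith
  · intro φ φ' ψ hφ hφ' hψ hΓ n
    have hφc : Continuous φ := continuous_iff_continuousAt.mpr fun s => (hφ s).continuousAt
    have hmain : ∀ k : ℕ, ⟪A.P (1 / ((k : ℝ) + 1)) (u (b n)), φ (b n)⟫ -
        ⟪A.P (1 / ((k : ℝ) + 1)) (u (a n)), φ (a n)⟫ =
        (∫ s in a n..b n, ⟪A.P (1 / ((k : ℝ) + 1)) (F s), φ s⟫) -
          (∫ s in a n..b n, ⟪A.E (A.R (1 / ((k : ℝ) + 1)) (u s)), ψ s⟫) +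
            ∫ s in a n..b n, ⟪A.P (1 / ((k : ℝ) + 1)) (u s), φ' s⟫ := by
      intro k
      set ε := 1 / ((k : ℝ) + 1)
      have hε : 0 < ε := hpos k
      have hp : ∀ s ∈ Icc (a n) (b n), A.P ε (u s) - A.P ε (u (a n)) =
          ∫ r in a n..s, (A.P ε (F r) - A.R ε (A.B (u r))) := fun s hs =>
        h.apply_sub (fun x => (A.J_R hε x).symm) (h.left_mem n)
          (h.ordConnected.out (h.left_mem n) (h.right_mem n) hs) hs.1
      have hq : ∀ s ∈ Icc (a n) (b n), φ s - φ (a n) = ∫ r in a n..s, φ' r := fun s _ =>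
        (intervalIntegral.integral_eq_sub_of_hasDerivAt (fun r _ => hφ r)
          (hφ'.intervalIntegrable _ _)).symm
      rw [inner_sub_inner_eq_integral (h.le n) (h.intervalIntegrable_apply _ _ _ _)
        (hφ'.intervalIntegrable _ _) hp hq]
      have c1 : Continuous fun s => A.P ε (u s) := (A.P ε).continuous.comp h.cont
      have c2 : Continuous fun s => A.E (A.R ε (u s)) :=
        A.E.continuous.comp ((A.R ε).continuous.comp h.cont)
      have i1 : IntervalIntegrable (fun s => ⟪A.P ε (F s), φ s⟫) volume (a n) (b n) := by
        obtain ⟨D, hD⟩ := isCompact_Icc.exists_bound_of_continuousOn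
          (hφc.continuousOn (s := Icc (a n) (b n)))
        rw [intervalIntegrable_iff_integrableOn_Ioc_of_le (h.le n)]
        have hPF := ((A.P ε).integrable_comp h.integrable).integrableOn (s := Ioc (a n) (b n))
        refine (hPF.norm.mul_const D).mono'
          (hPF.aestronglyMeasurable.inner hφc.aestronglyMeasurable) ?_
        filter_upwards [ae_restrict_mem measurableSet_Ioc] with s hs
        exact (norm_inner_le_norm (𝕜 := ℝ) _ _).trans
          (mul_le_mul_of_nonneg_left (hD s (Ioc_subset_Icc_self hs)) (norm_nonneg _))
      have i2 : IntervalIntegrable (fun s => ⟪A.E (A.R ε (u s)), ψ s⟫) volume (a n) (b n) :=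
        (c2.inner hψ).intervalIntegrable _ _
      have i3 : IntervalIntegrable (fun s => ⟪A.P ε (u s), φ' s⟫) volume (a n) (b n) :=
        (c1.inner hφ').intervalIntegrable _ _
      rw [← intervalIntegral.integral_sub i1 i2, ← intervalIntegral.integral_add (i1.sub i2) i3]
      refine intervalIntegral.integral_congr fun s _ => ?_
      -- The only use of (φ, ψ) ∈ Γ: it moves D* from the solution onto the test function.
      have e : ⟪A.R ε (A.B (u s)), φ s⟫ = ⟪A.E (A.R ε (u s)), ψ s⟫ := by
        rw [hE _ _ (hΓ s), A.B_R hε]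
      simp only [inner_sub_left, e]
    have l1 : Tendsto (fun k : ℕ => ∫ s in a n..b n, ⟪A.P (1 / ((k : ℝ) + 1)) (F s), φ s⟫) atTop
        (𝓝 (∫ s in a n..b n, ⟪F s, φ s⟫)) := by
      obtain ⟨D, hD⟩ := isCompact_Icc.exists_bound_of_continuousOn
        (hφc.continuousOn (s := Icc (a n) (b n)))
      refine intervalIntegral.tendsto_integral_filter_of_dominated_convergence
        (fun s => ‖F s‖ * D) (.of_forall fun k => ?_) (.of_forall fun k => .of_forall fun s hs => ?_)
        (h.integrable.norm.mul_const D).intervalIntegrable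
        (.of_forall fun s _ => (hPlim _).inner tendsto_const_nhds)
      · exact (((A.P _).integrable_comp h.integrable).aestronglyMeasurable.inner
          hφc.aestronglyMeasurable).restrict
      · rw [uIoc_of_le (h.le n)] at hs
        exact (norm_inner_le_norm (𝕜 := ℝ) _ _).trans (mul_le_mul (A.norm_P_le (hpos k) _)
          (hD s (Ioc_subset_Icc_self hs)) (norm_nonneg _) (norm_nonneg _))
    have l3 : Tendsto (fun k : ℕ => ∫ s in a n..b n, ⟪A.P (1 / ((k : ℝ) + 1)) (u s), φ' s⟫) atTop
        (𝓝 (∫ s in a n..b n, ⟪u s, φ' s⟫)) := by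
      refine intervalIntegral.tendsto_integral_filter_of_dominated_convergence
        (fun s => C * ‖φ' s‖) (.of_forall fun k => ?_) (.of_forall fun k => .of_forall fun s hs => ?_)
        ((continuous_const.mul hφ'.norm).intervalIntegrable _ _)
        (.of_forall fun s _ => (hPlim _).inner tendsto_const_nhds)
      · exact (((A.P _).continuous.comp h.cont).inner hφ').aestronglyMeasurable
      · exact (norm_inner_le_norm (𝕜 := ℝ) _ _).trans (mul_le_mul_of_nonneg_right
          ((A.norm_P_le (hpos k) _).trans (hC s)) (norm_nonneg _))
    have l2 : Tendsto (fun k : ℕ => ∫ s in a n..b n, ⟪A.E (A.R (1 / ((k : ℝ) + 1)) (u s)), ψ s⟫)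
        atTop (𝓝 (∫ s in a n..b n, ⟪G s, ψ s⟫)) := by
      -- Truncating ψ turns the integral over (a n, b n] into an inner product in L²(I; K), to which
      -- convergence of the gradients applies.
      have hΨ : MemLp ((Ioc (a n) (b n)).indicator ψ) 2 (volume.restrict I) := by
        rw [memLp_indicator_iff_restrict measurableSet_Ioc, h.restrict_Ioc,
          memLp_two_iff_integrable_sq_norm hψ.aestronglyMeasurable]
        exact (hψ.norm.pow 2).integrableOn_Ioc
      have e : ∀ g : Lp K 2 (volume.restrict I), ⟪g, hΨ.toLp⟫ = ∫ s in a n..b n, ⟪g s, ψ s⟫ := by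
        intro g
        rw [L2.inner_def, intervalIntegral.integral_of_le (h.le n), ← h.restrict_Ioc,
          ← integral_indicator measurableSet_Ioc]
        refine integral_congr_ae ?_
        filter_upwards [hΨ.coeFn_toLp] with s hs
        rw [hs]
        by_cases hm : s ∈ Ioc (a n) (b n) <;> simp [hm]
      rw [← e G]
      refine (hG.inner (tendsto_const_nhds (x := hΨ.toLp))).congr fun k => ?_
      rw [e, intervalIntegral.integral_of_le (h.le n), intervalIntegral.integral_of_le (h.le n),
        ← h.restrict_Ioc]
      refine integral_congr_ae (ae_restrict_of_ae ?_)
      filter_upwards [hcoe] with s hs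
      rw [hs]
    have l0 := (((hPlim (u (b n))).inner (𝕜 := ℝ) (tendsto_const_nhds (x := φ (b n)))).sub
      ((hPlim (u (a n))).inner (𝕜 := ℝ) (tendsto_const_nhds (x := φ (a n)))))
    exact tendsto_nhds_unique l0 (((l1.sub l2).add l3).congr fun k => (hmain k).symm)

end MildSolution
end ResolventPair

/-! ### Uniqueness for the homogeneous equation on a left half line. -/

namespace ResolventPair

variable {H K : Type*} [NormedAddCommGroup H] [InnerProductSpace ℝ H] [CompleteSpace H]
  [NormedAddCommGroup K] [InnerProductSpace ℝ K] [CompleteSpace K] (A : ResolventPair H K)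

/-- A function with `∂ₛ J W = -B W` on a left half line whose gradient tends to zero at `-∞`
vanishes. -/
theorem eq_zero_of_hasDerivAt {W W' : ℝ → H} {η : ℝ} (hW : ∀ s < η, HasDerivAt W (W' s) s)
    (hJ : ∀ s < η, A.J (W' s) = -A.B (W s))
    (hlim : Tendsto (fun s => ‖A.E (W s)‖) atBot (𝓝 0)) {s : ℝ} (hs : s < η) : W s = 0 := by
  have hd : ∀ s < η, HasDerivAt (fun s => ‖A.E (W s)‖ ^ 2) (-(2 * ‖A.B (W s)‖ ^ 2)) s := by
    intro s hs
    -- From ⟪EW, EW'⟫ = ⟪BW, JW'⟫ and JW' = -BW.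
    have e : 2 * ⟪A.E (W s), A.E (W' s)⟫ = -(2 * ‖A.B (W s)‖ ^ 2) := by
      rw [A.inner_E, hJ s hs, inner_neg_right, ← B_apply, real_inner_self_eq_norm_sq]
      ring
    rw [← e]
    exact (A.E.hasFDerivAt.comp_hasDerivAt s (hW s hs)).norm_sq
  have hanti : AntitoneOn (fun s => ‖A.E (W s)‖ ^ 2) (Iio η) := by
    refine antitoneOn_of_deriv_nonpos (convex_Iio η)
      (fun s hs => (hd s hs).continuousAt.continuousWithinAt) ?_ ?_
    · intro s hs
      rw [interior_Iio] at hs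
      exact (hd s hs).differentiableAt.differentiableWithinAt
    · intro s hs
      rw [interior_Iio] at hs
      rw [(hd s hs).deriv]
      nlinarith [sq_nonneg ‖A.B (W s)‖]
  have h0 : ‖A.E (W s)‖ ^ 2 ≤ 0 := by
    refine ge_of_tendsto (by simpa using hlim.pow 2) ?_
    filter_upwards [eventually_le_atBot s] with r hr
    exact hanti (hr.trans_lt hs : r ∈ Iio η) hs hr
  apply A.inj
  simpa using le_antisymm h0 (sq_nonneg _)

theorem tendsto_setIntegral_Iic_atBot {f : ℝ → ℝ} (hf : Integrable f) :
    Tendsto (fun s => ∫ r in Iic s, f r) atBot (𝓝 0) := by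
  simp_rw [← integral_indicator measurableSet_Iic]
  suffices h0 : Tendsto (fun s => ∫ r, (Iic s).indicator f r) atBot (𝓝 (∫ _ : ℝ, (0 : ℝ))) by
    simpa using h0
  refine tendsto_integral_filter_of_dominated_convergence (fun r => ‖f r‖)
    (.of_forall fun s => hf.aestronglyMeasurable.indicator measurableSet_Iic)
    (.of_forall fun s => .of_forall fun r => norm_indicator_le_norm_self _ _) hf.norm
    (.of_forall fun r => tendsto_const_nhds.congr' ?_)
  filter_upwards [eventually_lt_atBot r] with s hs
  rw [indicator_of_notMem (by simpa using hs)]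

/-- The integral is the value at s = 0 of W(s) = ∫ θ(r - s) w(r) dr. Shifting θ to the left keeps it
admissible, and so does a shift to the right by less than c₁ - c₀; hence W solves the equation
classically for s < c₁ - c₀, an interval containing 0, and `eq_zero_of_hasDerivAt` applies. -/
theorem integral_smul_eq_zero_of_weak {U : Set ℝ} {w : ℝ → H} {g : ℝ → K}
    (hw : LocallyIntegrableOn w U) (hg : MemLp g 2) (hwg : ∀ᵐ s, s ∈ U → ‖A.E (w s)‖ ≤ ‖g s‖)
    (hweak : ∀ θ : ℝ → ℝ, ContDiff ℝ ∞ θ → HasCompactSupport θ → tsupport θ ⊆ U →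
      A.J (∫ s, deriv θ s • w s) = A.B (∫ s, θ s • w s))
    {θ : ℝ → ℝ} (hθ : ContDiff ℝ ∞ θ) (hθc : HasCompactSupport θ) {c₀ c₁ : ℝ} (hc : c₀ < c₁)
    (hθs : tsupport θ ⊆ Iic c₀) (hU : Iic c₁ ⊆ U) : ∫ s, θ s • w s = 0 := by
  -- Cutting at c₁ makes the integrand locally integrable on all of ℝ, as differentiation of the
  -- convolution requires. The cut is invisible for s < c₁ - c₀, where θ(· - s) vanishes beyond c₁.
  set v : ℝ → H := (Iic c₁).indicator w with hv
  have hvloc : LocallyIntegrable v := by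
    rw [locallyIntegrable_iff]
    intro k hk
    rw [hv, integrableOn_indicator_iff measurableSet_Iic]
    exact hw.integrableOn_compact_subset (inter_subset_left.trans hU)
      (hk.inter_left isClosed_Iic)
  have hθ0 : ∀ r s, s < c₁ - c₀ → c₁ < r → θ (r - s) = 0 := fun r s hs hr =>
    image_eq_zero_of_notMem_tsupport fun h => by
      have := hθs h
      simp only [mem_Iic] at this
      linarith
  have hdθ0 : ∀ r s, s < c₁ - c₀ → c₁ < r → deriv θ (r - s) = 0 := fun r s hs hr =>
    image_eq_zero_of_notMem_tsupport fun h => by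
      have := hθs (closure_minimal (support_deriv_subset) (isClosed_tsupport θ) h)
      simp only [mem_Iic] at this
      linarith
  have hvw : ∀ κ : ℝ → ℝ, (∀ r, c₁ < r → κ r = 0) → ∀ r, κ r • v r = κ r • w r := by
    intro κ hκ r
    by_cases hr : r ≤ c₁
    · rw [hv, indicator_of_mem (mem_Iic.mpr hr)]
    · rw [hκ r (not_le.mp hr), zero_smul, zero_smul]
  set f : ℝ → ℝ := fun x => θ (-x) with hf
  have hfc : HasCompactSupport f := hθc.comp_homeomorph (Homeomorph.neg ℝ)
  have hfd : ContDiff ℝ 1 f := (hθ.of_le (by exact_mod_cast le_top)).comp contDiff_neg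
  set W : ℝ → H := fun s => ∫ r, θ (r - s) • v r with hWdef
  set W' : ℝ → H := fun s => -∫ r, deriv θ (r - s) • v r with hWdef'
  have hW : ∀ s, HasDerivAt W (W' s) s := by
    intro s
    have h := hfc.hasDerivAt_convolution_left (ContinuousLinearMap.lsmul ℝ ℝ) hfd hvloc s
    have e1 : convolution f v (ContinuousLinearMap.lsmul ℝ ℝ) volume = W := by
      ext s
      rw [convolution_eq_swap]
      simp [hf, hWdef]
    have e2 : convolution (deriv f) v (ContinuousLinearMap.lsmul ℝ ℝ) volume s = W' s := by
      rw [convolution_eq_swap]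
      change _ = -∫ r, deriv θ (r - s) • v r
      rw [← integral_neg]
      refine integral_congr_ae (.of_forall fun r => ?_)
      simp only [hf, ContinuousLinearMap.lsmul_apply, deriv_comp_neg, neg_sub, neg_smul]
    rwa [e1, e2] at h
  have hshift : ∀ s < c₁ - c₀, ContDiff ℝ ∞ (fun r => θ (r - s)) ∧
      HasCompactSupport (fun r => θ (r - s)) ∧ tsupport (fun r => θ (r - s)) ⊆ U := by
    intro s hs
    refine ⟨hθ.comp (contDiff_id.sub contDiff_const),
      hθc.comp_homeomorph (Homeomorph.subRight s), ?_⟩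
    refine (closure_minimal (fun r hr => ?_) isClosed_Iic).trans hU
    by_contra h
    exact hr (hθ0 r s hs (not_le.mp h))
  have hJ : ∀ s < c₁ - c₀, A.J (W' s) = -A.B (W s) := by
    intro s hs
    obtain ⟨h1, h2, h3⟩ := hshift s hs
    have h := hweak _ h1 h2 h3
    simp only [deriv_comp_sub_const] at h
    simp only [hWdef, hWdef']
    rw [map_neg, integral_congr_ae (.of_forall (hvw _ fun r hr => hdθ0 r s hs hr)),
      integral_congr_ae (.of_forall (hvw _ fun r hr => hθ0 r s hs hr)), h]
  have hlim : Tendsto (fun s => ‖A.E (W s)‖) atBot (𝓝 0) := by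
    have hsq : Integrable fun r => ‖g r‖ ^ 2 := hg.integrable_norm_pow (by norm_num)
    -- Cauchy–Schwarz: θ(· - s) lives on r ≤ c₀ + s, so only the tail of g enters, and this tail
    -- vanishes as s → -∞.
    have hbound : ∀ s < c₁ - c₀, ‖A.E (W s)‖ ≤
        (∫ r, ‖θ r‖ ^ (2 : ℝ)) ^ (1 / (2 : ℝ)) * (∫ r in Iic (c₀ + s), ‖g r‖ ^ 2) ^ (1 / (2 : ℝ)) := by
      intro s hs
      obtain ⟨h1, h2, h3⟩ := hshift s hs
      have hint := hvloc.integrable_smul_left_of_hasCompactSupport h1.continuous h2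
      have hθL : MemLp (fun r => θ (r - s)) (ENNReal.ofReal 2) := by
        exact h1.continuous.memLp_of_hasCompactSupport h2
      have hgL : MemLp ((Iic (c₀ + s)).indicator g) (ENNReal.ofReal 2) := by
        rw [show ENNReal.ofReal 2 = 2 by simp]
        exact hg.indicator measurableSet_Iic
      have hmain := integral_mul_norm_le_Lp_mul_Lq Real.HolderConjugate.two_two hθL hgL.norm
      simp only [norm_norm] at hmain
      have e1 : ∫ r, ‖θ (r - s)‖ ^ (2 : ℝ) = ∫ r, ‖θ r‖ ^ (2 : ℝ) :=
        integral_sub_right_eq_self (fun r => ‖θ r‖ ^ (2 : ℝ)) s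
      have e2 : ∫ r, ‖(Iic (c₀ + s)).indicator g r‖ ^ (2 : ℝ) = ∫ r in Iic (c₀ + s), ‖g r‖ ^ 2 := by
        rw [← integral_indicator measurableSet_Iic]
        refine integral_congr_ae (.of_forall fun r => ?_)
        by_cases hr : r ∈ Iic (c₀ + s) <;> simp [hr]
      rw [e1, e2] at hmain
      refine le_trans ?_ hmain
      rw [hWdef, ← A.E.integral_comp_comm hint]
      refine norm_integral_le_of_norm_le ?_ ?_
      · rw [show ENNReal.ofReal 2 = 2 by simp] at hθL hgL
        exact MemLp.integrable_mul hθL.norm hgL.norm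
      · filter_upwards [hwg] with r hr
        by_cases hr' : r ≤ c₀ + s
        · have hrc : r ≤ c₁ := by linarith
          rw [map_smul, norm_smul, hv, indicator_of_mem (mem_Iic.mpr hrc),
            indicator_of_mem (mem_Iic.mpr hr')]
          exact mul_le_mul_of_nonneg_left (hr (hU hrc)) (norm_nonneg _)
        · have : θ (r - s) = 0 := image_eq_zero_of_notMem_tsupport fun h => by
            have := hθs h
            simp only [mem_Iic] at this
            linarith
          simp [this]
    have htail : Tendsto (fun s => ∫ r in Iic (c₀ + s), ‖g r‖ ^ 2) atBot (𝓝 0) :=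
      (tendsto_setIntegral_Iic_atBot hsq).comp (tendsto_atBot_add_const_left _ _ tendsto_id)
    have hroot : Tendsto (fun s => (∫ r, ‖θ r‖ ^ (2 : ℝ)) ^ (1 / (2 : ℝ)) *
        (∫ r in Iic (c₀ + s), ‖g r‖ ^ 2) ^ (1 / (2 : ℝ))) atBot (𝓝 0) := by
      have := (htail.rpow_const (p := 1 / (2 : ℝ)) (by right; norm_num)).const_mul
        ((∫ r, ‖θ r‖ ^ (2 : ℝ)) ^ (1 / (2 : ℝ)))
      rwa [Real.zero_rpow (by norm_num), mul_zero] at this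
    refine squeeze_zero' (.of_forall fun _ => norm_nonneg _) ?_ hroot
    filter_upwards [eventually_lt_atBot (c₁ - c₀)] with s hs using hbound s hs
  have h0 := A.eq_zero_of_hasDerivAt (fun s _ => hW s) hJ hlim (sub_pos.mpr hc)
  rw [← h0, hWdef]
  refine integral_congr_ae (.of_forall fun r => ?_)
  simp only [sub_zero]
  refine (hvw θ (fun r hr => ?_) r).symm
  simpa using hθ0 r 0 (sub_pos.mpr hc) hr

/-- Uniqueness on `(-∞, s₂)`: a locally integrable weak solution of `∂ₛ w + D* D w = 0` whose
gradient is square integrable vanishes. -/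
theorem ae_eq_zero_of_weak {s₂ : EReal} {w : ℝ → H} {g : ℝ → K}
    (hw : LocallyIntegrableOn w {s : ℝ | (s : EReal) < s₂}) (hg : MemLp g 2)
    (hwg : ∀ᵐ s : ℝ, (s : EReal) < s₂ → ‖A.E (w s)‖ ≤ ‖g s‖)
    (hweak : ∀ θ : ℝ → ℝ, ContDiff ℝ ∞ θ → HasCompactSupport θ →
      tsupport θ ⊆ {s : ℝ | (s : EReal) < s₂} →
      A.J (∫ s, deriv θ s • w s) = A.B (∫ s, θ s • w s)) :
    ∀ᵐ s : ℝ, (s : EReal) < s₂ → w s = 0 := by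
  have hopen : IsOpen {s : ℝ | (s : EReal) < s₂} :=
    isOpen_lt continuous_coe_real_ereal continuous_const
  refine hopen.ae_eq_zero_of_integral_contDiff_smul_eq_zero hw fun θ hθ hθc hθs => ?_
  rcases (tsupport θ).eq_empty_or_nonempty with h | h
  · have : θ = 0 := by rwa [tsupport_eq_empty_iff] at h
    simp [this]
  -- c₀ is the maximum of the support, and c₁ is chosen strictly between c₀ and s₂ to leave room for
  -- the shifts.
  · obtain ⟨c₀, hc₀, hmax⟩ := hθc.isCompact.exists_isGreatest h
    obtain ⟨c₁, h01, h12⟩ := EReal.lt_iff_exists_real_btwn.mp (hθs hc₀)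
    exact A.integral_smul_eq_zero_of_weak hw hg hwg hweak hθ hθc (EReal.coe_lt_coe_iff.mp h01)
      (fun r hr => hmax hr) (fun r hr => lt_of_le_of_lt (EReal.coe_le_coe_iff.mpr hr) h12)

end ResolventPair

/-! ### The resolvent pair of a closed operator, from its graph. -/

section GraphResolvent

variable {H K : Type*} [NormedAddCommGroup H] [InnerProductSpace ℝ H] [CompleteSpace H]
  [NormedAddCommGroup K] [InnerProductSpace ℝ K] [CompleteSpace K]
  {Γ : Submodule ℝ (WithLp 2 (H × K))}

/-- The projection of the graph `Γ` to its first component. -/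
def graphFst (Γ : Submodule ℝ (WithLp 2 (H × K))) : Γ →L[ℝ] H :=
  WithLp.fstL 2 ℝ H K ∘L Γ.subtypeL

/-- The projection of the graph `Γ` to its second component. -/
def graphSnd (Γ : Submodule ℝ (WithLp 2 (H × K))) : Γ →L[ℝ] K :=
  WithLp.sndL 2 ℝ H K ∘L Γ.subtypeL

theorem graphFst_apply (p : Γ) : graphFst Γ p = (p : WithLp 2 (H × K)).fst := rfl

theorem graphSnd_apply (p : Γ) : graphSnd Γ p = (p : WithLp 2 (H × K)).snd := rfl

/-- The adjoint is taken for the graph inner product, so it sends x to the pair (Jx, DJx): the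
identity is the weak form of Jx + D*DJx = x, solved by Riesz representation. -/
theorem inner_adjoint_graphFst [CompleteSpace Γ] (x : H) (p : Γ) :
    ⟪graphFst Γ ((graphFst Γ).adjoint x), graphFst Γ p⟫ +
      ⟪graphSnd Γ ((graphFst Γ).adjoint x), graphSnd Γ p⟫ = ⟪x, graphFst Γ p⟫ := by
  have h := ContinuousLinearMap.adjoint_inner_left (graphFst Γ) p x
  rw [Submodule.coe_inner, WithLp.prod_inner_apply] at h
  exact h

/-- The resolvent of `D* D` for the closed operator `D` with graph `Γ`. -/
def graphResolvent (Γ : Submodule ℝ (WithLp 2 (H × K))) [CompleteSpace Γ]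
    (hker : ∀ p ∈ Γ, p.snd = 0 → p.fst = 0)
    (hdense : ∀ x, (∀ p ∈ Γ, ⟪x, p.fst⟫ = 0) → x = 0) : ResolventPair H K where
  J := graphFst Γ ∘L (graphFst Γ).adjoint
  E := graphSnd Γ ∘L (graphFst Γ).adjoint
  symm x y := by
    have h1 := ContinuousLinearMap.adjoint_inner_right (graphFst Γ) ((graphFst Γ).adjoint x) y
    have h2 := ContinuousLinearMap.adjoint_inner_left (graphFst Γ) ((graphFst Γ).adjoint y) x
    exact h1.symm.trans h2
  inner_E x y := by
    have h := inner_adjoint_graphFst x ((graphFst Γ).adjoint y)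
    simp only [ContinuousLinearMap.comp_apply, inner_sub_left]
    linarith
  inj x hx := by
    -- If DJx = 0, injectivity of D gives Jx = 0, so the whole pair vanishes; then x is orthogonal
    -- to the domain, which is dense.
    have h0 : (graphFst Γ).adjoint x = 0 := by
      have hfst := hker _ ((graphFst Γ).adjoint x).2 hx
      apply Subtype.ext
      exact WithLp.ofLp_injective 2 (Prod.ext hfst hx)
    refine hdense x fun p hp => ?_
    have h := inner_adjoint_graphFst x ⟨p, hp⟩
    rw [h0] at h
    simpa [graphFst_apply] using h.symm

variable [CompleteSpace Γ] {hker : ∀ p ∈ Γ, p.snd = 0 → p.fst = 0}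
  {hdense : ∀ x, (∀ p ∈ Γ, ⟪x, p.fst⟫ = 0) → x = 0}

theorem graphResolvent_mem (x : H) :
    WithLp.toLp 2 ((graphResolvent Γ hker hdense).J x, (graphResolvent Γ hker hdense).E x) ∈ Γ :=
  ((graphFst Γ).adjoint x).2

theorem inner_graphResolvent_E (x : H) {p : WithLp 2 (H × K)} (hp : p ∈ Γ) :
    ⟪(graphResolvent Γ hker hdense).E x, p.snd⟫ = ⟪(graphResolvent Γ hker hdense).B x, p.fst⟫ := by
  have h := inner_adjoint_graphFst x ⟨p, hp⟩
  rw [ResolventPair.B_apply, inner_sub_left]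
  simp only [graphFst_apply, graphSnd_apply] at h
  rw [← h]
  exact (add_sub_cancel_left _ _).symm

/-- For v in the domain, ‖Ev‖² ≤ ⟪Bv, v⟫ = ⟪Ev, Dv⟫. In the uniqueness proof it bounds Ew by the
square integrable gradient of w. -/
theorem norm_graphResolvent_E_le {p : WithLp 2 (H × K)} (hp : p ∈ Γ) :
    ‖(graphResolvent Γ hker hdense).E p.fst‖ ≤ ‖p.snd‖ := by
  set A := graphResolvent Γ hker hdense
  have h1 : ‖A.E p.fst‖ ^ 2 ≤ ‖A.E p.fst‖ * ‖p.snd‖ := by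
    refine (A.norm_E_sq_le p.fst).trans ?_
    rw [← inner_graphResolvent_E p.fst hp]
    exact real_inner_le_norm _ _
  rcases (norm_nonneg (A.E p.fst)).eq_or_lt with h | h
  · rw [← h]; exact norm_nonneg _
  · nlinarith

end GraphResolvent

/-! ### Time intervals with infinite end points and the abstract solution. -/

open HalfSpace

/-- The extension of a function on `ℝ` to the extended real line by zero. -/
def erealExtend {H : Type*} [Zero H] (W : ℝ → H) (s : EReal) : H :=
  if s = ⊥ ∨ s = ⊤ then 0 else W s.toReal

theorem erealExtend_coe {H : Type*} [Zero H] (W : ℝ → H) (s : ℝ) :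
    erealExtend W (s : EReal) = W s := by simp [erealExtend]

theorem erealExtend_top {H : Type*} [Zero H] (W : ℝ → H) : erealExtend W ⊤ = 0 := by
  simp [erealExtend]

theorem erealExtend_bot {H : Type*} [Zero H] (W : ℝ → H) : erealExtend W ⊥ = 0 := by
  simp [erealExtend]

theorem continuousOn_erealExtend {H : Type*} [Zero H] [TopologicalSpace H] {W : ℝ → H}
    (hW : Continuous W) {s₁ s₂ : EReal} (hbot : s₁ = ⊥ → Tendsto W atBot (𝓝 0))
    (htop : Tendsto W atTop (𝓝 0)) : ContinuousOn (erealExtend W) (Icc s₁ s₂) := by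
  intro s hs
  refine ContinuousAt.continuousWithinAt ?_
  induction s with
  | bot =>
    rw [ContinuousAt, erealExtend_bot, EReal.nhds_bot_basis.tendsto_left_iff]
    intro O hO
    obtain ⟨c, hc⟩ := mem_atBot_sets.mp (hbot (le_bot_iff.mp hs.1) hO)
    refine ⟨c, trivial, fun t ht => ?_⟩
    induction t with
    | bot => rw [erealExtend_bot]; exact mem_of_mem_nhds hO
    | coe t => rw [erealExtend_coe]; exact hc t (EReal.coe_lt_coe_iff.mp ht).le
    | top => exact absurd ht (by simp)
  | coe s =>
    rw [ContinuousAt, erealExtend_coe, EReal.nhds_coe, tendsto_map'_iff]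
    exact (hW.tendsto s).congr fun t => (erealExtend_coe W t).symm
  | top =>
    rw [ContinuousAt, erealExtend_top, EReal.nhds_top_basis.tendsto_left_iff]
    intro O hO
    obtain ⟨c, hc⟩ := mem_atTop_sets.mp (htop hO)
    refine ⟨c, trivial, fun t ht => ?_⟩
    induction t with
    | bot => exact absurd ht (by simp)
    | coe t => rw [erealExtend_coe]; exact hc t (EReal.coe_lt_coe_iff.mp ht).le
    | top => rw [erealExtend_top]; exact mem_of_mem_nhds hO

theorem isOpen_timeI (s₁ s₂ : EReal) : IsOpen (timeI s₁ s₂) :=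
  (isOpen_lt continuous_const continuous_coe_real_ereal).inter
    (isOpen_lt continuous_coe_real_ereal continuous_const)

theorem ordConnected_timeI (s₁ s₂ : EReal) : (timeI s₁ s₂).OrdConnected :=
  ⟨fun _ hx _ hy _ hz => ⟨hx.1.trans_le (EReal.coe_le_coe_iff.mpr hz.1),
    (EReal.coe_le_coe_iff.mpr hz.2).trans_lt hy.2⟩⟩

theorem exists_timeI_exhaustion {s₁ s₂ : EReal} (hs : s₁ < s₂) : ∃ a b : ℕ → ℝ,
    (∀ n, a n ∈ timeI s₁ s₂) ∧ (∀ n, b n ∈ timeI s₁ s₂) ∧ (∀ n, a n ≤ b n) ∧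
      Tendsto (fun n => (a n : EReal)) atTop (𝓝 s₁) ∧
      Tendsto (fun n => (b n : EReal)) atTop (𝓝 s₂) := by
  obtain ⟨c, hc1, hc2⟩ := exists_between hs
  obtain ⟨a, -, ha, halim⟩ := exists_seq_strictAnti_tendsto' hc1
  obtain ⟨b, -, hb, hblim⟩ := exists_seq_strictMono_tendsto' hc2
  have ea : ∀ n, ((a n).toReal : EReal) = a n := fun n =>
    EReal.coe_toReal ((ha n).2.trans_le le_top).ne (bot_le.trans_lt (ha n).1).ne'
  have eb : ∀ n, ((b n).toReal : EReal) = b n := fun n =>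
    EReal.coe_toReal ((hb n).2.trans_le le_top).ne (bot_le.trans_lt (hb n).1).ne'
  refine ⟨fun n => (a n).toReal, fun n => (b n).toReal, fun n => ?_, fun n => ?_, fun n => ?_, ?_, ?_⟩
  · simp only [timeI, mem_ofPred_eq, ea]
    exact ⟨(ha n).1, (ha n).2.trans hc2⟩
  · simp only [timeI, mem_ofPred_eq, eb]
    exact ⟨hc1.trans (hb n).1, (hb n).2⟩
  · rw [← EReal.coe_le_coe_iff, ea, eb]
    exact ((ha n).2.trans (hb n).1).le
  · simpa only [ea] using halim
  · simpa only [eb] using hblim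

namespace ResolventPair

variable {H K : Type*} [NormedAddCommGroup H] [InnerProductSpace ℝ H] [CompleteSpace H]
  [NormedAddCommGroup K] [InnerProductSpace ℝ K] [CompleteSpace K] (A : ResolventPair H K)

theorem exists_mildSolution {s₁ s₂ : EReal} (hs : s₁ < s₂) {F : ℝ → H} (hF : Integrable F)
    (hF0 : ∀ r ∉ timeI s₁ s₂, F r = 0) {u₀ : H} (hu₀ : s₁ = ⊥ → u₀ = 0) :
    ∃ (u : EReal → H) (a b : ℕ → ℝ), ContinuousOn u (Icc s₁ s₂) ∧ (∃ C, ∀ s, ‖u s‖ ≤ C) ∧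
      u s₁ = u₀ ∧ A.MildSolution (timeI s₁ s₂) F (fun s : ℝ => u s) u₀ (u s₂) a b ∧
      Continuous (fun s : ℝ => u s) ∧
      Tendsto (fun n => (a n : EReal)) atTop (𝓝 s₁) ∧
      Tendsto (fun n => (b n : EReal)) atTop (𝓝 s₂) := by
  set W := A.duhamel s₁.toReal u₀ F with hW
  have hWc : Continuous W := A.continuous_duhamel _ _ hF
  have hcont : ContinuousOn (erealExtend W) (Icc s₁ s₂) :=
    continuousOn_erealExtend hWc (fun h => by
      rw [hW, hu₀ h]; exact A.tendsto_duhamel_atBot _ hF) (A.tendsto_duhamel_atTop _ _ hF)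
  obtain ⟨a, b, ha, hb, hab, halim, hblim⟩ := exists_timeI_exhaustion hs
  have hb0 : ∀ s, ‖W s‖ ≤ ‖u₀‖ + ∫ r, ‖F r‖ := A.norm_duhamel_le _ _ hF
  have hleft : erealExtend W s₁ = u₀ := by
    rcases eq_or_ne s₁ ⊥ with h | h
    · rw [h, erealExtend_bot, hu₀ h]
    · have e := EReal.coe_toReal (hs.trans_le le_top).ne h
      rw [← e, erealExtend_coe, hW, A.duhamel_self]
      intro r hr
      refine hF0 r fun hmem => ?_
      have := hmem.1
      rw [← e, EReal.coe_lt_coe_iff] at this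
      linarith
  have mem_Icc : ∀ {s : ℝ}, s ∈ timeI s₁ s₂ → (s : EReal) ∈ Icc s₁ s₂ := fun h => ⟨h.1.le, h.2.le⟩
  refine ⟨erealExtend W, a, b, hcont, ⟨‖u₀‖ + ∫ r, ‖F r‖, fun s => ?_⟩, hleft, ?_, ?_, halim, hblim⟩
  · rw [erealExtend]
    split_ifs
    · rw [norm_zero]
      exact (norm_nonneg _).trans (hb0 0)
    · exact hb0 _
  · simp only [erealExtend_coe]
    -- Inside I, either s₁ = -∞ and u₀ = 0, or all times lie after s₁; these are the two
    -- alternatives in `J_duhamel_sub`.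
    refine ⟨hF, hWc, ⟨_, hb0⟩, fun s hs t _ hst => ?_, ordConnected_timeI _ _, ha, hb, hab, ?_, ?_, ?_⟩
    · refine A.J_duhamel_sub _ _ hF hst ?_
      rcases eq_or_ne s₁ ⊥ with h | h
      · exact .inl (hu₀ h)
      · right
        rw [← EReal.coe_le_coe_iff, EReal.coe_toReal (hs.1.trans_le le_top).ne h]
        exact hs.1.le
    · refine ⟨?_, fun n => measurableSet_Ioc⟩
      filter_upwards [ae_restrict_mem (isOpen_timeI s₁ s₂).measurableSet] with s hs
      filter_upwards [halim.eventually (gt_mem_nhds hs.1), hblim.eventually (lt_mem_nhds hs.2)]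
        with n h1 h2
      exact ⟨EReal.coe_lt_coe_iff.mp h1, (EReal.coe_lt_coe_iff.mp h2).le⟩
    · have h := (hcont s₁ (left_mem_Icc.mpr hs.le)).tendsto.comp
        (tendsto_nhdsWithin_iff.mpr ⟨halim, .of_forall fun n => mem_Icc (ha n)⟩)
      rw [hleft] at h
      exact h.congr fun n => erealExtend_coe W (a n)
    · have h := (hcont s₂ (right_mem_Icc.mpr hs.le)).tendsto.comp
        (tendsto_nhdsWithin_iff.mpr ⟨hblim, .of_forall fun n => mem_Icc (hb n)⟩)
      exact h.congr fun n => erealExtend_coe W (b n)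
  · simpa only [erealExtend_coe] using hWc

end ResolventPair

end

/-! ### Weighted measures on the half space. -/

section

open scoped RealInnerProductSpace ENNReal

namespace HalfSpace

variable {d : ℕ} {τ σ : ℝ}

/-- The unit vector in direction of the distinguished coordinate. -/
def vert (d : ℕ) : Space d := EuclideanSpace.single (Fin.last d) 1

theorem continuous_last : Continuous fun y : Space d => y (Fin.last d) := by fun_prop

theorem measurable_last : Measurable fun y : Space d => y (Fin.last d) :=
  continuous_last.measurable

theorem isOpen_upper : IsOpen (upper d) := isOpen_lt continuous_const continuous_last

theorem measurableSet_upper : MeasurableSet (upper d) := isOpen_upper.measurableSet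

theorem measurable_weight : Measurable fun y : Space d => ENNReal.ofReal (y (Fin.last d) ^ τ) :=
  (measurable_last.pow_const τ).ennreal_ofReal

theorem weight_ne_zero {y : Space d} (hy : y ∈ upper d) :
    ENNReal.ofReal (y (Fin.last d) ^ τ) ≠ 0 := by
  have : 0 < y (Fin.last d) ^ τ := Real.rpow_pos_of_pos hy _
  simpa using this

theorem ae_weighted_iff {p : Space d → Prop} :
    (∀ᵐ y ∂(weighted d τ), p y) ↔ ∀ᵐ y ∂(volume.restrict (upper d)), p y := by
  rw [weighted, ae_withDensity_iff measurable_weight]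
  constructor <;> intro h
  · filter_upwards [h, ae_restrict_mem measurableSet_upper] with y hy hmem
    exact hy (weight_ne_zero hmem)
  · filter_upwards [h] with y hy _ using hy

theorem ae_weighted_of_ae_weighted {p : Space d → Prop} (h : ∀ᵐ y ∂(weighted d τ), p y) :
    ∀ᵐ y ∂(weighted d σ), p y := ae_weighted_iff.mpr (ae_weighted_iff.mp h)

theorem ae_mem_upper : ∀ᵐ y ∂(weighted d τ), y ∈ upper d :=
  ae_weighted_iff.mpr (ae_restrict_mem measurableSet_upper)

theorem volume_restrict_ac_weighted : volume.restrict (upper d) ≪ weighted d τ :=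
  Measure.AbsolutelyContinuous.mk fun s _ h => by
    have h1 : ∀ᵐ y ∂(weighted d τ), y ∉ s := measure_eq_zero_iff_ae_notMem.mp h
    exact measure_eq_zero_iff_ae_notMem.mpr (ae_weighted_iff.mp h1)

theorem weighted_ac_weighted : weighted d τ ≪ weighted d σ :=
  (withDensity_absolutelyContinuous _ _).trans volume_restrict_ac_weighted

theorem lintegral_weighted (f : Space d → ℝ≥0∞) :
    ∫⁻ y, f y ∂(weighted d τ) =
      ∫⁻ y in upper d, ENNReal.ofReal (y (Fin.last d) ^ τ) * f y := by
  rw [weighted, lintegral_withDensity_eq_lintegral_mul_non_measurable _ measurable_weight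
    (.of_forall fun _ => ENNReal.ofReal_lt_top)]
  rfl

theorem integral_weighted {E : Type*} [NormedAddCommGroup E] [NormedSpace ℝ E] (f : Space d → E) :
    ∫ y, f y ∂(weighted d τ) = ∫ y in upper d, (y (Fin.last d) ^ τ) • f y := by
  rw [weighted, integral_withDensity_eq_integral_toReal_smul measurable_weight
    (.of_forall fun _ => ENNReal.ofReal_lt_top)]
  refine setIntegral_congr_fun measurableSet_upper fun y hy => ?_
  simp only
  rw [ENNReal.toReal_ofReal (Real.rpow_nonneg (le_of_lt hy) _)]

theorem weighted_add (κ : ℝ) (f : Space d → ℝ≥0∞) : ∫⁻ y, f y ∂(weighted d (κ + τ)) =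
    ∫⁻ y, ENNReal.ofReal (y (Fin.last d) ^ κ) * f y ∂(weighted d τ) := by
  rw [lintegral_weighted, lintegral_weighted]
  refine setLIntegral_congr_fun measurableSet_upper fun y hy => ?_
  simp only
  rw [Real.rpow_add hy, ENNReal.ofReal_mul (Real.rpow_nonneg (le_of_lt hy) _)]
  ring

/-- The point with horizontal coordinates `z` on the boundary of the half space. -/
def base (z : Fin d → ℝ) : Space d := WithLp.toLp 2 ((Fin.last d).insertNth (0 : ℝ) z)

theorem base_add_last (z : Fin d → ℝ) (t : ℝ) : (base z + t • vert d) (Fin.last d) = t := by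
  simp [base, vert]

theorem base_add_castSucc (z : Fin d → ℝ) (t : ℝ) (i : Fin d) :
    (base z + t • vert d) i.castSucc = z i := by
  have h := (Fin.castSucc_lt_last i).ne
  have h2 : (base z) i.castSucc = z i := by
    rw [← Fin.succAbove_last_apply]
    exact Fin.insertNth_apply_succAbove (α := fun _ => ℝ) (Fin.last d) 0 z i
  simp [h2, vert, h]

theorem lintegral_eq_lintegral_vert {f : Space d → ℝ≥0∞} (hf : Measurable f) :
    ∫⁻ y, f y = ∫⁻ z : Fin d → ℝ, ∫⁻ t : ℝ, f (base z + t • vert d) := by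
  have h1 := (PiLp.volume_preserving_toLp (Fin (d + 1))).lintegral_comp hf
  have h2 := (volume_preserving_piFinSuccAbove (fun _ : Fin (d + 1) => ℝ) (Fin.last d)).symm
  have h3 := h2.lintegral_comp (f := fun x : Fin (d + 1) → ℝ => f (WithLp.toLp 2 x))
    (hf.comp (WithLp.measurable_toLp 2 _))
  rw [← h1, ← h3]
  rw [Measure.volume_eq_prod, lintegral_prod_symm']
  · refine lintegral_congr fun z => lintegral_congr fun t => ?_
    congr 1
    ext i
    refine Fin.lastCases ?_ (fun i => ?_) i
    · rw [base_add_last]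
      simp [MeasurableEquiv.piFinSuccAbove]
    · rw [base_add_castSucc]
      simp [MeasurableEquiv.piFinSuccAbove]
  · exact (hf.comp (WithLp.measurable_toLp 2 _)).comp (MeasurableEquiv.measurable _)

theorem lintegral_weighted_vert {f : Space d → ℝ≥0∞} (hf : Measurable f) :
    ∫⁻ y, f y ∂(weighted d τ) =
      ∫⁻ z : Fin d → ℝ, ∫⁻ t in Ioi (0 : ℝ), ENNReal.ofReal (t ^ τ) * f (base z + t • vert d) := by
  have hm : Measurable ((upper d).indicator
      fun y : Space d => ENNReal.ofReal (y (Fin.last d) ^ τ) * f y) :=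
    (measurable_weight.mul hf).indicator measurableSet_upper
  rw [lintegral_weighted, ← lintegral_indicator measurableSet_upper, lintegral_eq_lintegral_vert hm]
  refine lintegral_congr fun z => ?_
  rw [← lintegral_indicator measurableSet_Ioi]
  refine lintegral_congr fun t => ?_
  simp only [indicator_apply, upper, mem_ofPred_eq, base_add_last, mem_Ioi]

/-- The ball lies in a cube times a vertical interval, and t^τ is integrable at 0 exactly because τ
> -1. Local finiteness is what puts test functions that do not vanish on the boundary into L²_τ. -/
theorem weighted_ball_lt_top (hτ : -1 < τ) (R : ℝ) : weighted d τ (Metric.ball 0 R) < ⊤ := by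
  have hm : MeasurableSet (Metric.ball (0 : Space d) R) := Metric.isOpen_ball.measurableSet
  rw [← lintegral_indicator_one hm, lintegral_weighted_vert (measurable_one.indicator hm)]
  have hle : ∀ (z : Fin d → ℝ), ∫⁻ t in Ioi (0 : ℝ), ENNReal.ofReal (t ^ τ) *
      (Metric.ball (0 : Space d) R).indicator 1 (base z + t • vert d) ≤
      (Metric.closedBall (0 : Fin d → ℝ) |R|).indicator
        (fun _ => ∫⁻ t in Ioc 0 |R|, ENNReal.ofReal (t ^ τ)) z := by
    intro z
    have hcoord : ∀ t : ℝ, base z + t • vert d ∈ Metric.ball (0 : Space d) R → ∀ i,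
        |(base z + t • vert d) i| ≤ |R| := fun t ht i => by
      rw [mem_ball_zero_iff] at ht
      exact ((PiLp.norm_apply_le _ i).trans ht.le).trans (le_abs_self R)
    by_cases hz : z ∈ Metric.closedBall (0 : Fin d → ℝ) |R|
    · rw [indicator_of_mem hz, ← lintegral_indicator measurableSet_Ioi,
        ← lintegral_indicator measurableSet_Ioc]
      refine lintegral_mono fun t => ?_
      by_cases ht : t ∈ Ioi (0 : ℝ)
      · by_cases hb : base z + t • vert d ∈ Metric.ball (0 : Space d) R
        · have h := hcoord t hb (Fin.last d)
          rw [base_add_last] at h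
          have : t ∈ Ioc 0 |R| := ⟨ht, (le_abs_self t).trans h⟩
          simp [ht, hb, this]
        · rw [indicator_of_mem ht, indicator_of_notMem hb, mul_zero]
          exact zero_le
      · simp [ht]
    · rw [indicator_of_notMem hz, nonpos_iff_eq_zero]
      refine (lintegral_congr fun t => ?_).trans lintegral_zero
      have hb : base z + t • vert d ∉ Metric.ball (0 : Space d) R := fun hb => hz <| by
        rw [mem_closedBall_zero_iff, pi_norm_le_iff_of_nonneg (abs_nonneg R)]
        intro i
        have h := hcoord t hb i.castSucc
        rwa [base_add_castSucc] at h
      simp [hb]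
  refine (lintegral_mono hle).trans_lt ?_
  rw [lintegral_indicator_const Metric.isClosed_closedBall.measurableSet]
  refine ENNReal.mul_lt_top ?_ measure_closedBall_lt_top
  have hi := (intervalIntegrable_iff_integrableOn_Ioc_of_le (abs_nonneg R)).mp
    (intervalIntegral.intervalIntegrable_rpow' (a := 0) (b := |R|) hτ)
  exact hi.lintegral_lt_top

instance [h : Fact (-1 < σ)] : Fact (-1 < 1 + σ) := ⟨by linarith [h.out]⟩

instance [h : Fact (-1 < τ)] : IsLocallyFiniteMeasure (weighted d τ) :=
  ⟨fun x => ⟨Metric.ball 0 (‖x‖ + 1), Metric.isOpen_ball.mem_nhds (by simp),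
    weighted_ball_lt_top h.out _⟩⟩

theorem eLpNorm_two_sq {α E : Type*} [MeasurableSpace α] [NormedAddCommGroup E] (f : α → E)
    (μ : Measure α) : eLpNorm f 2 μ ^ 2 = ∫⁻ x, ‖f x‖ₑ ^ 2 ∂μ := by
  rw [eLpNorm_eq_lintegral_rpow_enorm_toReal (by norm_num) (by norm_num)]
  simp only [ENNReal.toReal_ofNat, ENNReal.rpow_ofNat]
  rw [← ENNReal.rpow_natCast, ← ENNReal.rpow_mul]
  norm_num

/-- A square integrable function is locally square integrable on the open half space. -/
theorem memLp_restrict_of_isCompact {E : Type*} [NormedAddCommGroup E] {v : Space d → E}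
    (hv : MemLp v 2 (weighted d τ)) {k : Set (Space d)} (hk : IsCompact k) (hku : k ⊆ upper d) :
    MemLp v 2 (volume.restrict k) := by
  obtain ⟨c, hc, hle⟩ : ∃ c : ℝ, 0 < c ∧ ∀ y ∈ k, c ≤ y (Fin.last d) ^ τ := by
    rcases k.eq_empty_or_nonempty with rfl | hne
    · exact ⟨1, one_pos, by simp⟩
    · have hcont : ContinuousOn (fun y : Space d => y (Fin.last d) ^ τ) k :=
        continuous_last.continuousOn.rpow_const fun y hy => .inl (ne_of_gt (hku hy))
      obtain ⟨y, hy, hmin⟩ := hk.exists_isMinOn hne hcont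
      exact ⟨_, Real.rpow_pos_of_pos (hku hy) τ, fun z hz => hmin hz⟩
  have hc0 : ENNReal.ofReal c ≠ 0 := by simpa using hc
  have hmeas : volume.restrict k ≤ (ENNReal.ofReal c)⁻¹ • weighted d τ := by
    refine Measure.le_iff.mpr fun s hs => ?_
    rw [Measure.smul_apply, smul_eq_mul, ← ENNReal.div_eq_inv_mul,
      ENNReal.le_div_iff_mul_le (.inl hc0) (.inl ENNReal.ofReal_ne_top), Measure.restrict_apply hs,
      mul_comm, weighted, withDensity_apply _ hs, Measure.restrict_restrict hs]
    calc ENNReal.ofReal c * volume (s ∩ k) = ∫⁻ _ in s ∩ k, ENNReal.ofReal c := by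
          rw [setLIntegral_const]
      _ ≤ ∫⁻ y in s ∩ k, ENNReal.ofReal (y (Fin.last d) ^ τ) :=
          setLIntegral_mono' (hs.inter hk.measurableSet) fun y hy =>
            ENNReal.ofReal_le_ofReal (hle y hy.2)
      _ ≤ ∫⁻ y in s ∩ upper d, ENNReal.ofReal (y (Fin.last d) ^ τ) :=
          lintegral_mono_set (inter_subset_inter_right s hku)
  exact (hv.smul_measure (ENNReal.inv_ne_top.mpr hc0)).mono_measure hmeas

theorem integrableOn_of_isCompact {E : Type*} [NormedAddCommGroup E] {v : Space d → E}
    (hv : MemLp v 2 (weighted d τ)) {k : Set (Space d)} (hk : IsCompact k) (hku : k ⊆ upper d) :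
    IntegrableOn v k := by
  have : IsFiniteMeasure (volume.restrict k) := ⟨by simpa using hk.measure_lt_top⟩
  exact (memLp_restrict_of_isCompact hv hk hku).integrable (by norm_num)

end HalfSpace

/-! ### The graph of the weak gradient. -/

namespace HalfSpace

variable {d : ℕ} {τ σ : ℝ} {E : Type*} [NormedAddCommGroup E] [InnerProductSpace ℝ E]

theorem real_inner_eq_mul (a b : ℝ) : ⟪a, b⟫ = a * b := by
  simp [mul_comm]

theorem inner_smul_single (x : Space d) (c : ℝ) (i : Fin (d + 1)) :
    ⟪x, c • (EuclideanSpace.single i (1 : ℝ) : Space d)⟫ = x i * c := by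
  rw [inner_smul_right, EuclideanSpace.inner_single_right]; simp [mul_comm]

theorem inner_gradient (φ : Space d → ℝ) (y x : Space d) : ⟪gradient φ y, x⟫ = fderiv ℝ φ y x := by
  rw [gradient, InnerProductSpace.toDual_symm_apply]

theorem gradient_apply (φ : Space d → ℝ) (y : Space d) (i : Fin (d + 1)) :
    gradient φ y i = fderiv ℝ φ y (EuclideanSpace.single i 1) := by
  rw [← inner_gradient, EuclideanSpace.inner_single_right]
  simp

theorem continuous_gradient {φ : Space d → ℝ} (hφ : ContDiff ℝ ∞ φ) : Continuous (gradient φ) :=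
  (InnerProductSpace.toDual ℝ (Space d)).symm.continuous.comp
    (hφ.continuous_fderiv (by simp))

theorem hasCompactSupport_gradient {φ : Space d → ℝ} (hφ : HasCompactSupport φ) :
    HasCompactSupport (gradient φ) :=
  (hφ.fderiv ℝ).comp_left (g := (InnerProductSpace.toDual ℝ (Space d)).symm) (map_zero _)

theorem tsupport_gradient_subset (φ : Space d → ℝ) : tsupport (gradient φ) ⊆ tsupport φ := by
  refine closure_minimal (fun y hy => ?_) (isClosed_tsupport φ)
  refine (support_fderiv_subset ℝ : Function.support (fderiv ℝ φ) ⊆ tsupport φ) ?_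
  intro h
  exact hy (by rw [gradient, h, map_zero])

section Dual

variable {X : Space d → E} (hX : Continuous X) (hc : HasCompactSupport X) (hs : tsupport X ⊆ upper d)

-- The factor y_n^{-τ} cancels the weight, so an unweighted pairing becomes an inner product in
-- L²_τ. It is harmless because the support of X stays away from the boundary.
include hX hs in
theorem continuous_rpow_smul (τ : ℝ) : Continuous fun y => (y (Fin.last d) ^ (-τ)) • X y := by
  refine ContinuousOn.continuous_of_tsupport_subset (s := upper d) ?_ isOpen_upper
    ((closure_mono (Function.support_smul_subset_right _ _)).trans hs)
  exact (continuous_last.continuousOn.rpow_const fun y hy => .inl (ne_of_gt hy)).smul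
    hX.continuousOn

include hX hc hs in
theorem memLp_rpow_smul [Fact (-1 < τ)] :
    MemLp (fun y => (y (Fin.last d) ^ (-τ)) • X y) 2 (weighted d τ) :=
  (continuous_rpow_smul hX hs τ).memLp_of_hasCompactSupport hc.smul_left

/-- The unweighted pairing with a compactly supported field is a bounded functional. -/
theorem inner_toLp_rpow_smul [Fact (-1 < τ)] (v : Lp E 2 (weighted d τ)) :
    ⟪v, (memLp_rpow_smul (τ := τ) hX hc hs).toLp⟫ = ∫ y in upper d, ⟪v y, X y⟫ := by
  have h : ∫ y, ⟪v y, (y (Fin.last d) ^ (-τ)) • X y⟫ ∂(weighted d τ) =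
      ∫ y in upper d, ⟪v y, X y⟫ := by
    rw [integral_weighted]
    refine setIntegral_congr_fun measurableSet_upper fun y hy => ?_
    simp only
    rw [inner_smul_right, smul_eq_mul, ← mul_assoc, ← Real.rpow_add hy]
    simp
  rw [L2.inner_def, ← h]
  refine integral_congr_ae ?_
  filter_upwards [(memLp_rpow_smul (τ := τ) hX hc hs).coeFn_toLp] with y hy
  rw [hy]

end Dual

section WeakGradient

variable {ψ : Space d → ℝ} (hψ : ContDiff ℝ ∞ ψ) (hc : HasCompactSupport ψ)
  (hs : tsupport ψ ⊆ upper d) (i : Fin (d + 1))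

include hψ in
theorem continuous_gradient_apply : Continuous fun y => gradient ψ y i := by
  have := continuous_gradient hψ
  fun_prop

include hc in
theorem hasCompactSupport_gradient_apply : HasCompactSupport fun y => gradient ψ y i :=
  (hasCompactSupport_gradient hc).comp_left (g := fun x : Space d => x i) rfl

include hs in
theorem tsupport_gradient_apply_subset : tsupport (fun y => gradient ψ y i) ⊆ upper d :=
  (closure_mono (Function.support_comp_subset (g := fun x : Space d => x i) rfl _)).trans
    ((tsupport_gradient_subset ψ).trans hs)

include hψ in
theorem continuous_smul_single :
    Continuous fun y => ψ y • (EuclideanSpace.single i (1 : ℝ) : Space d) :=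
  hψ.continuous.smul continuous_const

include hc in
theorem hasCompactSupport_smul_single :
    HasCompactSupport fun y => ψ y • (EuclideanSpace.single i (1 : ℝ) : Space d) :=
  hc.smul_right

include hs in
theorem tsupport_smul_single_subset :
    tsupport (fun y => ψ y • (EuclideanSpace.single i (1 : ℝ) : Space d)) ⊆ upper d :=
  (closure_mono (Function.support_smul_subset_left _ _)).trans hs

end WeakGradient

variable [Fact (-1 < σ)]

/-- Each condition in the definition becomes a continuous linear equation in (v, g); the graph is
then visibly a closed subspace. -/
theorem isWeakGradient_iff (v : L2 d σ) (g : L2Vec d (1 + σ)) : IsWeakGradient v g ↔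
    ∀ (ψ : Space d → ℝ) (hψ : ContDiff ℝ ∞ ψ) (hc : HasCompactSupport ψ)
      (hs : tsupport ψ ⊆ upper d) (i : Fin (d + 1)),
      ⟪v, (memLp_rpow_smul (τ := σ) (continuous_gradient_apply hψ i)
        (hasCompactSupport_gradient_apply hc i) (tsupport_gradient_apply_subset hs i)).toLp⟫ +
      ⟪g, (memLp_rpow_smul (τ := 1 + σ) (continuous_smul_single hψ i)
        (hasCompactSupport_smul_single hc i) (tsupport_smul_single_subset hs i)).toLp⟫ = 0 := by
  refine forall_congr' fun ψ => forall_congr' fun hψ => forall_congr' fun hc =>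
    forall_congr' fun hs => forall_congr' fun i => ?_
  rw [inner_toLp_rpow_smul (continuous_gradient_apply hψ i) (hasCompactSupport_gradient_apply hc i)
      (tsupport_gradient_apply_subset hs i), inner_toLp_rpow_smul (continuous_smul_single hψ i)
      (hasCompactSupport_smul_single hc i) (tsupport_smul_single_subset hs i),
    ← eq_neg_iff_add_eq_zero]
  simp only [inner_smul_single, real_inner_eq_mul]

variable (d σ) in
/-- The graph of the weak gradient, from `L²_σ(H)` to `L²_{1+σ}(H)`. -/
def gradientGraph : Submodule ℝ (WithLp 2 (L2 d σ × L2Vec d (1 + σ))) where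
  carrier := {p | IsWeakGradient p.fst p.snd}
  add_mem' {p q} hp hq := by
    simp only [mem_ofPred_eq, isWeakGradient_iff] at *
    intro ψ hψ hc hs i
    have h1 := hp ψ hψ hc hs i
    have h2 := hq ψ hψ hc hs i
    rw [WithLp.add_fst, WithLp.add_snd, inner_add_left, inner_add_left]
    linarith
  zero_mem' := by
    simp only [mem_ofPred_eq, isWeakGradient_iff]
    intro ψ hψ hc hs i
    simp
  smul_mem' c p hp := by
    simp only [mem_ofPred_eq, isWeakGradient_iff] at *
    intro ψ hψ hc hs i
    rw [WithLp.smul_fst, WithLp.smul_snd, inner_smul_left, inner_smul_left, ← mul_add,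
      hp ψ hψ hc hs i, mul_zero]

theorem isClosed_gradientGraph :
    IsClosed (gradientGraph d σ : Set (WithLp 2 (L2 d σ × L2Vec d (1 + σ)))) := by
  have h : (gradientGraph d σ : Set (WithLp 2 (L2 d σ × L2Vec d (1 + σ)))) =
      {p | IsWeakGradient p.fst p.snd} := rfl
  rw [h]
  simp only [isWeakGradient_iff, Set.ofPred_forall]
  have c1 : Continuous fun p : WithLp 2 (L2 d σ × L2Vec d (1 + σ)) => p.fst :=
    (WithLp.fstL 2 ℝ _ _).continuous
  have c2 : Continuous fun p : WithLp 2 (L2 d σ × L2Vec d (1 + σ)) => p.snd :=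
    (WithLp.sndL 2 ℝ _ _).continuous
  refine isClosed_iInter fun ψ => isClosed_iInter fun hψ => isClosed_iInter fun hc =>
    isClosed_iInter fun hs => isClosed_iInter fun i => isClosed_eq ?_ continuous_const
  exact (c1.inner continuous_const).add (c2.inner continuous_const)

instance : CompleteSpace (gradientGraph d σ) :=
  isClosed_gradientGraph.completeSpace_coe

/-- The weak gradient is unique. -/
theorem weakGradient_unique {v : L2 d σ} {g g' : L2Vec d (1 + σ)} (hg : IsWeakGradient v g)
    (hg' : IsWeakGradient v g') : g = g' := by
  have hloc : ∀ i, LocallyIntegrableOn (fun y => (g - g') y i) (upper d) := fun i => by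
    rw [locallyIntegrableOn_iff isOpen_upper.isLocallyClosed]
    intro k hku hk
    have h := integrableOn_of_isCompact (Lp.memLp (g - g')) hk hku
    exact (EuclideanSpace.proj (𝕜 := ℝ) i).integrable_comp h
  have hzero : ∀ i, ∀ᵐ y : Space d, y ∈ upper d → (g - g') y i = 0 := fun i => by
    refine isOpen_upper.ae_eq_zero_of_integral_contDiff_smul_eq_zero (hloc i)
      fun ψ hψ hc hs => ?_
    have h1 := (isWeakGradient_iff v g).mp hg ψ hψ hc hs i
    have h2 := (isWeakGradient_iff v g').mp hg' ψ hψ hc hs i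
    have h3 : ⟪g - g', (memLp_rpow_smul (τ := 1 + σ) (continuous_smul_single hψ i)
        (hasCompactSupport_smul_single hc i) (tsupport_smul_single_subset hs i)).toLp⟫ = 0 := by
      rw [inner_sub_left]; linarith
    rw [inner_toLp_rpow_smul (continuous_smul_single hψ i) (hasCompactSupport_smul_single hc i)
      (tsupport_smul_single_subset hs i)] at h3
    rw [← setIntegral_eq_integral_of_forall_compl_eq_zero (s := upper d), ← h3]
    · refine integral_congr_ae (.of_forall fun y => ?_)
      simp only [inner_smul_right, EuclideanSpace.inner_single_right]
      simp
    · intro y hy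
      rw [image_eq_zero_of_notMem_tsupport fun h => hy (hs h), zero_smul]
  rw [← sub_eq_zero]
  refine Lp.ext ?_
  have hall : ∀ᵐ y ∂(weighted d (1 + σ)), ∀ i, (g - g') y i = 0 := by
    rw [ae_all_iff]
    intro i
    rw [ae_weighted_iff, ae_restrict_iff' measurableSet_upper]
    exact hzero i
  filter_upwards [hall, Lp.coeFn_zero (Space d) 2 (weighted d (1 + σ))] with y hy h0
  rw [h0]
  ext i
  exact hy i

section Test

variable {φ : Space d → ℝ} (hφ : ContDiff ℝ ∞ φ) (hc : HasCompactSupport φ)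

include hφ hc in
theorem memLp_test [Fact (-1 < τ)] : MemLp φ 2 (weighted d τ) :=
  hφ.continuous.memLp_of_hasCompactSupport hc

include hφ hc in
theorem memLp_gradient_test [Fact (-1 < τ)] : MemLp (gradient φ) 2 (weighted d τ) :=
  (continuous_gradient hφ).memLp_of_hasCompactSupport (hasCompactSupport_gradient hc)

variable (σ) in
/-- A test function on the closed half space with its gradient. -/
def testPair : WithLp 2 (L2 d σ × L2Vec d (1 + σ)) :=
  WithLp.toLp 2 ((memLp_test hφ hc).toLp, (memLp_gradient_test hφ hc).toLp)

/-- No boundary term appears although φ may be nonzero on the boundary, since ψ vanishes near it: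
integration by parts takes place on the whole space. -/
theorem testPair_mem : testPair σ hφ hc ∈ gradientGraph d σ := by
  intro ψ hψ hψc hs i
  have e1 : ∫ y in upper d, (testPair σ hφ hc).fst y * gradient ψ y i =
      ∫ y, φ y * fderiv ℝ ψ y (EuclideanSpace.single i 1) := by
    refine Eq.trans ?_ (setIntegral_eq_integral_of_forall_compl_eq_zero (s := upper d) ?_)
    · refine integral_congr_ae ?_
      filter_upwards [ae_weighted_iff.mp (memLp_test (τ := σ) hφ hc).coeFn_toLp] with y hy
      rw [← gradient_apply]
      exact congrArg (· * _) hy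
    · intro y hy
      rw [← gradient_apply, image_eq_zero_of_notMem_tsupport (f := fun y => gradient ψ y i)
        fun h => hy (tsupport_gradient_apply_subset hs i h), mul_zero]
  have e2 : ∫ y in upper d, (testPair σ hφ hc).snd y i * ψ y =
      ∫ y, fderiv ℝ φ y (EuclideanSpace.single i 1) * ψ y := by
    refine Eq.trans ?_ (setIntegral_eq_integral_of_forall_compl_eq_zero (s := upper d) ?_)
    · refine integral_congr_ae ?_
      filter_upwards [ae_weighted_iff.mp (memLp_gradient_test (τ := 1 + σ) hφ hc).coeFn_toLp]
        with y hy
      rw [← gradient_apply]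
      exact congrArg (fun x : Space d => x i * _) hy
    · intro y hy
      rw [image_eq_zero_of_notMem_tsupport fun h => hy (hs h), mul_zero]
  rw [e1, e2]
  have cφ : Continuous fun y => fderiv ℝ φ y (EuclideanSpace.single i (1 : ℝ)) := by
    simp only [← gradient_apply]; exact continuous_gradient_apply hφ i
  have cψ : Continuous fun y => fderiv ℝ ψ y (EuclideanSpace.single i (1 : ℝ)) := by
    simp only [← gradient_apply]; exact continuous_gradient_apply hψ i
  refine integral_mul_fderiv_eq_neg_fderiv_mul_of_integrable ?_ ?_ ?_
    (fun y _ => (hφ.differentiable (by simp)) y) (fun y _ => (hψ.differentiable (by simp)) y)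
  · exact (cφ.mul hψ.continuous).integrable_of_hasCompactSupport hψc.mul_left
  · exact (hφ.continuous.mul cψ).integrable_of_hasCompactSupport hc.mul_right
  · exact (hφ.continuous.mul hψ.continuous).integrable_of_hasCompactSupport hc.mul_right

end Test

theorem eq_zero_of_inner_gradientGraph (x : L2 d σ)
    (h : ∀ p ∈ gradientGraph d σ, ⟪x, p.fst⟫ = 0) : x = 0 := by
  refine Lp.ext ?_
  have hx : ∀ᵐ y ∂(weighted d σ), x y = 0 := by
    refine ae_eq_zero_of_integral_contDiff_smul_eq_zero
      ((Lp.memLp x).locallyIntegrable (by norm_num)) fun φ hφ hc => ?_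
    have h1 := h _ (testPair_mem hφ hc)
    rw [L2.inner_def] at h1
    rw [← h1]
    refine integral_congr_ae ?_
    filter_upwards [(memLp_test (τ := σ) hφ hc).coeFn_toLp] with y hy
    have hy' : (testPair σ hφ hc).fst y = φ y := hy
    rw [hy', real_inner_eq_mul, smul_eq_mul, mul_comm]
  filter_upwards [hx, Lp.coeFn_zero ℝ 2 (weighted d σ)] with y hy h0
  rw [h0, hy]
  rfl

end HalfSpace

/-! ### Hardy inequality on vertical lines and the Poincaré inequality. -/

/-- A weighted Hardy inequality on a bounded interval. -/
theorem intervalIntegral_rpow_mul_sq_le {σ : ℝ} (hσ : -1 < σ) {R : ℝ} (hR : 0 < R) {h h' : ℝ → ℝ}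
    (hd : ∀ t, HasDerivAt h (h' t) t) (hc : Continuous h') (h0 : h R = 0) :
    ∫ t in 0..R, t ^ σ * h t ^ 2 ≤ 4 * R / (σ + 1) ^ 2 * ∫ t in 0..R, t ^ (1 + σ) * h' t ^ 2 := by
  have hpos : 0 < σ + 1 := by linarith
  have hch : Continuous h := continuous_iff_continuousAt.mpr fun t => (hd t).continuousAt
  have hcr : Continuous fun t : ℝ => t ^ (1 + σ) := Real.continuous_rpow_const (by linarith)
  have i1 : IntervalIntegrable (fun t : ℝ => t ^ σ * h t ^ 2) volume 0 R :=
    (intervalIntegral.intervalIntegrable_rpow' hσ).mul_continuousOn (hch.pow 2).continuousOn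
  have i2 : IntervalIntegrable (fun t : ℝ => t ^ (1 + σ) * h' t ^ 2) volume 0 R :=
    (hcr.mul (hc.pow 2)).intervalIntegrable _ _
  have i3 : IntervalIntegrable (fun t : ℝ => t ^ (1 + σ) * (2 * h t * h' t)) volume 0 R :=
    (hcr.mul ((continuous_const.mul hch).mul hc)).intervalIntegrable _ _
  -- The derivative of t^{1+σ}h² integrates to zero: the boundary term vanishes at R since h(R) = 0,
  -- and at 0 since 1 + σ > 0.
  have hftc : ∫ t in 0..R, ((σ + 1) * (t ^ σ * h t ^ 2) + t ^ (1 + σ) * (2 * h t * h' t)) = 0 := by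
    rw [intervalIntegral.integral_eq_sub_of_hasDerivAt_of_le hR.le
      (f := fun t => t ^ (1 + σ) * h t ^ 2) (hcr.mul (hch.pow 2)).continuousOn ?_
      ((i1.const_mul _).add i3)]
    · rw [h0, Real.zero_rpow (by linarith)]; simp
    · intro t ht
      have e1 := Real.hasDerivAt_rpow_const (x := t) (p := 1 + σ) (.inl ht.1.ne')
      refine (e1.mul ((hd t).pow 2)).congr_deriv ?_
      rw [show 1 + σ - 1 = σ by ring]
      simp only [Pi.pow_apply]
      push_cast
      ring
  rw [intervalIntegral.integral_add (i1.const_mul _) i3, intervalIntegral.integral_const_mul]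
    at hftc
  have hyoung : -∫ t in 0..R, t ^ (1 + σ) * (2 * h t * h' t) ≤
      ∫ t in 0..R, ((σ + 1) / 2 * (t ^ σ * h t ^ 2) +
        2 * R / (σ + 1) * (t ^ (1 + σ) * h' t ^ 2)) := by
    rw [← intervalIntegral.integral_neg]
    refine intervalIntegral.integral_mono_on_of_le_Ioo hR.le i3.neg
      ((i1.const_mul _).add (i2.const_mul _)) fun t ht => ?_
    have hp : 0 ≤ t ^ σ := Real.rpow_nonneg ht.1.le _
    have hr : t ^ (1 + σ) = t * t ^ σ := by rw [Real.rpow_add ht.1, Real.rpow_one]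
    -- Young's inequality, weighted so that half of the term (σ+1)t^σ h² is absorbed; t² ≤ Rt then
    -- lowers the power of t in front of h'² to the weight 1 + σ.
    have hy : -(t * (2 * h t * h' t)) ≤
        (σ + 1) / 2 * h t ^ 2 + 2 * R / (σ + 1) * (t * h' t ^ 2) := by
      have h1 : 0 ≤ (σ + 1) / 2 * (h t + 2 / (σ + 1) * (t * h' t)) ^ 2 := by positivity
      have h2 : (σ + 1) / 2 * (h t + 2 / (σ + 1) * (t * h' t)) ^ 2 =
          (σ + 1) / 2 * h t ^ 2 + t * (2 * h t * h' t) + 2 / (σ + 1) * (t * (t * h' t ^ 2)) := by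
        field_simp; ring
      have h3 : 2 / (σ + 1) * (t * (t * h' t ^ 2)) ≤ 2 / (σ + 1) * (R * (t * h' t ^ 2)) := by
        have := ht.1.le
        gcongr
        exact ht.2.le
      have h4 : 2 / (σ + 1) * (R * (t * h' t ^ 2)) = 2 * R / (σ + 1) * (t * h' t ^ 2) := by ring
      linarith
    have := mul_le_mul_of_nonneg_left hy hp
    rw [hr]
    linarith
  rw [intervalIntegral.integral_add (i1.const_mul _) (i2.const_mul _),
    intervalIntegral.integral_const_mul, intervalIntegral.integral_const_mul] at hyoung
  have h5 : 4 * R / (σ + 1) ^ 2 * ∫ t in 0..R, t ^ (1 + σ) * h' t ^ 2 =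
      2 / (σ + 1) * (2 * R / (σ + 1) * ∫ t in 0..R, t ^ (1 + σ) * h' t ^ 2) := by
    field_simp; ring
  rw [h5, div_mul_eq_mul_div, le_div_iff₀ hpos]
  linarith

theorem lintegral_rpow_mul_sq_le {σ : ℝ} (hσ : -1 < σ) {R : ℝ} (hR : 0 < R) {h h' : ℝ → ℝ}
    (hd : ∀ t, HasDerivAt h (h' t) t) (hc : Continuous h') (h0 : ∀ t, R ≤ t → h t = 0) :
    ∫⁻ t in Ioi 0, ENNReal.ofReal (t ^ σ) * ‖h t‖ₑ ^ 2 ≤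
      ENNReal.ofReal (4 * R / (σ + 1) ^ 2) *
        ∫⁻ t in Ioi 0, ENNReal.ofReal (t ^ (1 + σ)) * ‖h' t‖ₑ ^ 2 := by
  have hch : Continuous h := continuous_iff_continuousAt.mpr fun t => (hd t).continuousAt
  have key : ∀ (τ : ℝ), -1 < τ → ∀ k : ℝ → ℝ, Continuous k →
      ∫⁻ t in Ioc 0 R, ENNReal.ofReal (t ^ τ) * ‖k t‖ₑ ^ 2 =
        ENNReal.ofReal (∫ t in 0..R, t ^ τ * k t ^ 2) := fun τ hτ k hk => by
    rw [intervalIntegral.integral_of_le hR.le, ofReal_integral_eq_lintegral_ofReal]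
    · refine setLIntegral_congr_fun measurableSet_Ioc fun t ht => ?_
      rw [ENNReal.ofReal_mul (Real.rpow_nonneg ht.1.le _), Real.enorm_eq_ofReal_abs,
        ← ENNReal.ofReal_pow (abs_nonneg _), sq_abs]
    · exact (intervalIntegrable_iff_integrableOn_Ioc_of_le hR.le).mp
        ((intervalIntegral.intervalIntegrable_rpow' hτ).mul_continuousOn (hk.pow 2).continuousOn)
    · filter_upwards [ae_restrict_mem measurableSet_Ioc] with t ht
      exact mul_nonneg (Real.rpow_nonneg ht.1.le _) (sq_nonneg _)
  calc ∫⁻ t in Ioi 0, ENNReal.ofReal (t ^ σ) * ‖h t‖ₑ ^ 2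
      = ∫⁻ t in Ioc 0 R, ENNReal.ofReal (t ^ σ) * ‖h t‖ₑ ^ 2 := by
        rw [← lintegral_indicator measurableSet_Ioi, ← lintegral_indicator measurableSet_Ioc]
        refine lintegral_congr fun t => ?_
        by_cases ht : t ∈ Ioi (0 : ℝ)
        · by_cases htR : t ≤ R
          · rw [indicator_of_mem ht, indicator_of_mem (show t ∈ Ioc 0 R from ⟨ht, htR⟩)]
          · rw [indicator_of_mem ht, indicator_of_notMem fun h => htR h.2, h0 t (le_of_not_ge htR)]
            simp
        · rw [indicator_of_notMem ht, indicator_of_notMem fun h => ht h.1]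
    _ ≤ ENNReal.ofReal (4 * R / (σ + 1) ^ 2) *
        ∫⁻ t in Ioc 0 R, ENNReal.ofReal (t ^ (1 + σ)) * ‖h' t‖ₑ ^ 2 := by
        rw [key σ hσ h hch, key (1 + σ) (by linarith) h' hc, ← ENNReal.ofReal_mul (by positivity)]
        exact ENNReal.ofReal_le_ofReal
          (intervalIntegral_rpow_mul_sq_le hσ hR hd hc (h0 R le_rfl))
    _ ≤ _ := by gcongr; exact Ioc_subset_Ioi_self

namespace HalfSpace

variable {d : ℕ} {τ σ : ℝ} [hσ : Fact (-1 < σ)]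

/-- The Poincaré inequality for functions supported in a ball. -/
theorem eLpNorm_test_sq_le {φ : Space d → ℝ} (hφ : ContDiff ℝ ∞ φ) {R : ℝ} (hR : 0 < R)
    (h0 : ∀ y, R ≤ ‖y‖ → φ y = 0) :
    eLpNorm φ 2 (weighted d σ) ^ 2 ≤
      ENNReal.ofReal (4 * R / (σ + 1) ^ 2) * eLpNorm (gradient φ) 2 (weighted d (1 + σ)) ^ 2 := by
  rw [eLpNorm_two_sq, eLpNorm_two_sq, 
    lintegral_weighted_vert (hφ.continuous.enorm.measurable.pow_const 2),
    lintegral_weighted_vert ((continuous_gradient hφ).enorm.measurable.pow_const 2),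
    ← lintegral_const_mul' _ _ ENNReal.ofReal_ne_top]
  refine lintegral_mono fun z => ?_
  have hd : ∀ t, HasDerivAt (fun t : ℝ => φ (base z + t • vert d))
      (⟪gradient φ (base z + t • vert d), vert d⟫) t := fun t => by
    rw [inner_gradient]
    have h1 : HasDerivAt (fun t : ℝ => base z + t • vert d) ((1 : ℝ) • vert d) t :=
      ((hasDerivAt_id t).smul_const _).const_add _
    rw [one_smul] at h1
    exact ((hφ.differentiable (by simp)) _).hasFDerivAt.comp_hasDerivAt t h1
  have hcd : Continuous fun t : ℝ => ⟪gradient φ (base z + t • vert d), vert d⟫ :=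
    ((continuous_gradient hφ).comp (by fun_prop)).inner continuous_const
  refine (lintegral_rpow_mul_sq_le hσ.out hR hd hcd fun t ht => h0 _ ?_).trans ?_
  · have := PiLp.norm_apply_le (base z + t • vert d) (Fin.last d)
    rw [base_add_last] at this
    exact ht.trans ((le_abs_self t).trans this)
  · gcongr with t
    rw [enorm_le_iff_norm_le]
    refine (norm_inner_le_norm _ _).trans ?_
    rw [vert, PiLp.norm_single]
    simp

end HalfSpace

/-! ### Mollification shifted away from the boundary. -/

namespace HalfSpace

open scoped Convolution

variable {d : ℕ} {τ σ : ℝ} {E : Type*} [NormedAddCommGroup E] [NormedSpace ℝ E]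

section Kernel

variable {δ : ℝ} (hδ : 0 < δ)

variable (d) in
/-- A mollification kernel supported below the boundary. -/
def kernel : Space d → ℝ :=
  (⟨δ / 2, δ, half_pos hδ, half_lt_self hδ⟩ : ContDiffBump (-(2 * δ) • vert d)).normed volume

theorem kernel_nonneg (z : Space d) : 0 ≤ kernel d hδ z := ContDiffBump.nonneg_normed _ z

theorem contDiff_kernel : ContDiff ℝ ∞ (kernel d hδ) := ContDiffBump.contDiff_normed _

theorem hasCompactSupport_kernel : HasCompactSupport (kernel d hδ) :=
  ContDiffBump.hasCompactSupport_normed _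

theorem integral_kernel : ∫ z, kernel d hδ z = 1 := ContDiffBump.integral_normed _

theorem integrable_kernel : Integrable (kernel d hδ) := ContDiffBump.integrable_normed _

theorem of_mem_tsupport_kernel {z : Space d} (hz : z ∈ tsupport (kernel d hδ)) :
    ‖z‖ ≤ 3 * δ ∧ z (Fin.last d) ≤ -δ := by
  rw [kernel, ContDiffBump.tsupport_normed_eq, mem_closedBall_iff_norm] at hz
  simp only at hz
  constructor
  · have h1 : ‖-(2 * δ) • vert d‖ = 2 * δ := by
      rw [norm_smul, vert, PiLp.norm_single]
      simp [abs_of_pos hδ]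
    have h2 := norm_le_norm_sub_add z (-(2 * δ) • vert d)
    linarith
  · have h := ((Real.le_norm_self _).trans
      (PiLp.norm_apply_le (z - -(2 * δ) • vert d) (Fin.last d))).trans hz
    simp [vert] at h
    linarith

theorem of_kernel_ne_zero {z : Space d} (hz : kernel d hδ z ≠ 0) :
    ‖z‖ ≤ 3 * δ ∧ z (Fin.last d) ≤ -δ :=
  of_mem_tsupport_kernel hδ (subset_tsupport _ hz)

theorem lintegral_kernel_sub_right (t : Space d) :
    ∫⁻ y, ENNReal.ofReal (kernel d hδ (y - t)) = 1 := by
  rw [lintegral_sub_right_eq_self (fun z => ENNReal.ofReal (kernel d hδ z)),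
    ← ofReal_integral_eq_lintegral_ofReal (integrable_kernel hδ) (.of_forall (kernel_nonneg hδ)),
    integral_kernel, ENNReal.ofReal_one]

theorem lintegral_kernel_sub_left (y : Space d) :
    ∫⁻ t, ENNReal.ofReal (kernel d hδ (y - t)) = 1 := by
  rw [lintegral_sub_left_eq_self (fun z => ENNReal.ofReal (kernel d hδ z)),
    ← ofReal_integral_eq_lintegral_ofReal (integrable_kernel hδ) (.of_forall (kernel_nonneg hδ)),
    integral_kernel, ENNReal.ofReal_one]

end Kernel

section Truncate

/-- Restriction of a function to points of height larger than `δ`. -/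
def truncate (δ : ℝ) (v : Space d → E) : Space d → E := {t | δ < t (Fin.last d)}.indicator v

variable {δ : ℝ} {v : Space d → E}

theorem truncate_of_lt {t : Space d} (h : δ < t (Fin.last d)) : truncate δ v t = v t :=
  indicator_of_mem (s := {t : Space d | δ < t (Fin.last d)}) h v

theorem truncate_of_le {t : Space d} (h : t (Fin.last d) ≤ δ) : truncate δ v t = 0 :=
  indicator_of_notMem (s := {t : Space d | δ < t (Fin.last d)}) (not_lt.mpr h) v

theorem measurableSet_lt_last : MeasurableSet {t : Space d | δ < t (Fin.last d)} :=
  measurableSet_lt measurable_const measurable_last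

theorem aestronglyMeasurable_truncate (hδ : 0 < δ)
    (hv : AEStronglyMeasurable v (weighted d τ)) : AEStronglyMeasurable (truncate δ v) := by
  rw [truncate, aestronglyMeasurable_indicator_iff measurableSet_lt_last]
  refine (hv.mono_ac volume_restrict_ac_weighted).mono_measure
    (Measure.restrict_mono (fun t ht => ?_) le_rfl)
  exact hδ.trans ht

theorem locallyIntegrable_truncate (hδ : 0 < δ) (hv : MemLp v 2 (weighted d τ)) :
    LocallyIntegrable (truncate δ v) := by
  rw [locallyIntegrable_iff]
  intro k hk
  have hc : IsClosed {t : Space d | δ ≤ t (Fin.last d)} :=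
    isClosed_le continuous_const continuous_last
  have h := integrableOn_of_isCompact hv (hk.inter_right hc)
    fun t ht => show 0 < t (Fin.last d) from hδ.trans_le ht.2
  have h2 : IntegrableOn v ({t | δ < t (Fin.last d)} ∩ k) :=
    h.mono_set fun t ht => ⟨ht.2, show δ ≤ t (Fin.last d) from le_of_lt ht.1⟩
  rw [IntegrableOn, truncate, integrable_indicator_iff measurableSet_lt_last, IntegrableOn,
    Measure.restrict_restrict measurableSet_lt_last]
  exact h2

end Truncate

section Mollify

variable {δ : ℝ} (hδ : 0 < δ)

/-- Mollification, shifted into the half space. -/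
def mollify (v : Space d → E) : Space d → E :=
  kernel d hδ ⋆[ContinuousLinearMap.lsmul ℝ ℝ, volume] truncate δ v

theorem mollify_eq (v : Space d → E) (y : Space d) :
    mollify hδ v y = ∫ t, kernel d hδ (y - t) • truncate δ v t := convolution_lsmul_swap

variable [CompleteSpace E] {v : Space d → E}

theorem contDiff_mollify (hv : MemLp v 2 (weighted d τ)) : ContDiff ℝ ∞ (mollify hδ v) :=
  (hasCompactSupport_kernel hδ).contDiff_convolution_left _ (contDiff_kernel hδ)
    (locallyIntegrable_truncate hδ hv)

theorem integrable_kernel_smul_truncate (hv : MemLp v 2 (weighted d τ)) (y : Space d) :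
    Integrable fun t => kernel d hδ (y - t) • truncate δ v t :=
  ((hasCompactSupport_kernel hδ).convolutionExists_left (ContinuousLinearMap.lsmul ℝ ℝ)
    (contDiff_kernel hδ).continuous (locallyIntegrable_truncate hδ hv) y).integrable_swap

theorem mollify_eq_zero {R : ℝ} (h0 : ∀ y, R ≤ ‖y‖ → v y = 0) {y : Space d}
    (hy : R + 3 * δ ≤ ‖y‖) : mollify hδ v y = 0 := by
  rw [mollify_eq]
  refine (integral_congr_ae (.of_forall fun t => ?_)).trans (integral_zero _ _)
  by_cases hk : kernel d hδ (y - t) = 0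
  · simp [hk]
  · have h1 := (of_kernel_ne_zero hδ hk).1
    have h2 := norm_sub_norm_le y t
    have h3 : truncate δ v t = 0 := by
      rw [truncate, indicator_apply, h0 t (by linarith), ite_self]
    simp [h3]

theorem mollify_sub {w : Space d → E} (hv : MemLp v 2 (weighted d τ))
    (hw : MemLp w 2 (weighted d τ)) (y : Space d) :
    mollify hδ (v - w) y = mollify hδ v y - mollify hδ w y := by
  rw [mollify_eq, mollify_eq, mollify_eq, ← integral_sub (integrable_kernel_smul_truncate hδ hv y)
    (integrable_kernel_smul_truncate hδ hw y)]
  refine integral_congr_ae (.of_forall fun t => ?_)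
  simp only [truncate, indicator_sub', Pi.sub_apply, smul_sub]

/-- Jensen's inequality for the probability measure with density `kernel d hδ (y - t)`. -/
theorem enorm_mollify_sq_le (hv : AEStronglyMeasurable v (weighted d τ)) (y : Space d) :
    ‖mollify hδ v y‖ₑ ^ 2 ≤
      ∫⁻ t, ENNReal.ofReal (kernel d hδ (y - t)) * ‖truncate δ v t‖ₑ ^ 2 := by
  have hm : Measurable fun t => ENNReal.ofReal (kernel d hδ (y - t)) :=
    ((contDiff_kernel hδ).continuous.comp (by fun_prop)).measurable.ennreal_ofReal
  set P : Measure (Space d) := volume.withDensity fun t => ENNReal.ofReal (kernel d hδ (y - t))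
    with hP
  have hP1 : IsProbabilityMeasure P := ⟨by
    rw [hP, withDensity_apply _ .univ, Measure.restrict_univ, lintegral_kernel_sub_left]⟩
  have hlin : ∀ F : Space d → ℝ≥0∞, ∫⁻ t, F t ∂P =
      ∫⁻ t, ENNReal.ofReal (kernel d hδ (y - t)) * F t := fun F => by
    rw [hP, lintegral_withDensity_eq_lintegral_mul_non_measurable _ hm
      (.of_forall fun _ => ENNReal.ofReal_lt_top)]
    rfl
  have h1 : ‖mollify hδ v y‖ₑ ≤ eLpNorm (truncate δ v) 1 P := by
    rw [eLpNorm_one_eq_lintegral_enorm, hlin, mollify_eq]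
    refine (enorm_integral_le_lintegral_enorm _).trans_eq (lintegral_congr fun t => ?_)
    rw [enorm_smul, Real.enorm_of_nonneg (kernel_nonneg hδ _)]
  have h2 : eLpNorm (truncate δ v) 1 P ≤ eLpNorm (truncate δ v) 2 P :=
    eLpNorm_le_eLpNorm_of_exponent_le (by norm_num)
      ((aestronglyMeasurable_truncate hδ hv).mono_ac (withDensity_absolutelyContinuous _ _))
  calc ‖mollify hδ v y‖ₑ ^ 2 ≤ eLpNorm (truncate δ v) 2 P ^ 2 := by gcongr; exact h1.trans h2
    _ = _ := by rw [eLpNorm_two_sq, hlin]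

/-- The points t sampled at y satisfy t_n ≥ y_n + δ, so for τ ≥ 0 the weight at y is at most the
weight at t; Tonelli then reduces the bound to the unit mass of the kernel. -/
theorem eLpNorm_mollify_le (hτ : 0 ≤ τ) (hv : AEStronglyMeasurable v (weighted d τ)) :
    eLpNorm (mollify hδ v) 2 (weighted d τ) ≤ eLpNorm v 2 (weighted d τ) := by
  rw [← ENNReal.pow_le_pow_left_iff two_ne_zero, eLpNorm_two_sq, eLpNorm_two_sq, lintegral_weighted]
  set F : Space d → ℝ≥0∞ := fun t =>
    ENNReal.ofReal (t (Fin.last d) ^ τ) * ‖truncate δ v t‖ₑ ^ 2 with hF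
  have hFm : AEMeasurable F :=
    measurable_weight.aemeasurable.mul ((aestronglyMeasurable_truncate hδ hv).enorm.pow_const 2)
  calc ∫⁻ y in upper d, ENNReal.ofReal (y (Fin.last d) ^ τ) * ‖mollify hδ v y‖ₑ ^ 2
      ≤ ∫⁻ y in upper d, ∫⁻ t, ENNReal.ofReal (kernel d hδ (y - t)) * F t := by
        refine setLIntegral_mono' measurableSet_upper fun y hy => ?_
        refine (mul_le_mul_right (enorm_mollify_sq_le hδ hv y) _).trans ?_
        rw [← lintegral_const_mul' _ _ ENNReal.ofReal_ne_top]
        refine lintegral_mono fun t => ?_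
        by_cases hk : kernel d hδ (y - t) = 0
        · simp [hk]
        · have h1 := (of_kernel_ne_zero hδ hk).2
          rw [PiLp.sub_apply] at h1
          have h2 : ENNReal.ofReal (y (Fin.last d) ^ τ) ≤ ENNReal.ofReal (t (Fin.last d) ^ τ) :=
            ENNReal.ofReal_le_ofReal (Real.rpow_le_rpow (le_of_lt hy) (by linarith) hτ)
          rw [mul_left_comm]
          exact mul_le_mul_right (mul_le_mul_left h2 _) _
    _ ≤ ∫⁻ y, ∫⁻ t, ENNReal.ofReal (kernel d hδ (y - t)) * F t := setLIntegral_le_lintegral _ _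
    _ = ∫⁻ t, ∫⁻ y, ENNReal.ofReal (kernel d hδ (y - t)) * F t := by
        refine lintegral_lintegral_swap (AEMeasurable.mul ?_ hFm.comp_snd)
        exact ((contDiff_kernel hδ).continuous.comp
          (continuous_fst.sub continuous_snd)).measurable.ennreal_ofReal.aemeasurable
    _ = ∫⁻ t, F t := by
        refine lintegral_congr fun t => ?_
        rw [lintegral_mul_const, lintegral_kernel_sub_right, one_mul]
        exact ((contDiff_kernel hδ).continuous.comp (by fun_prop)).measurable.ennreal_ofReal
    _ ≤ ∫⁻ t, (upper d).indicator
          (fun t => ENNReal.ofReal (t (Fin.last d) ^ τ) * ‖v t‖ₑ ^ 2) t := by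
        refine lintegral_mono fun t => ?_
        by_cases ht : δ < t (Fin.last d)
        · rw [indicator_of_mem (show t ∈ upper d from hδ.trans ht), hF]
          simp only
          rw [truncate_of_lt ht]
        · rw [hF]
          simp only
          rw [truncate_of_le (not_lt.mp ht)]
          simp
    _ = ∫⁻ t, ‖v t‖ₑ ^ 2 ∂(weighted d τ) := by
        rw [lintegral_indicator measurableSet_upper, lintegral_weighted]

theorem memLp_mollify (hτ : 0 ≤ τ) (hv : MemLp v 2 (weighted d τ)) :
    MemLp (mollify hδ v) 2 (weighted d τ) :=
  ⟨(contDiff_mollify hδ hv).continuous.aestronglyMeasurable,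
    (eLpNorm_mollify_le hδ hτ hv.1).trans_lt hv.2⟩

theorem norm_mollify_sub_le (hv : MemLp v 2 (weighted d τ)) {y : Space d} (hy : y ∈ upper d)
    {ε : ℝ} (hε : ∀ t, ‖y - t‖ ≤ 3 * δ → ‖v t - v y‖ ≤ ε) : ‖mollify hδ v y - v y‖ ≤ ε := by
  have hi : Integrable fun t => kernel d hδ (y - t) := (integrable_kernel hδ).comp_sub_left y
  have h1 : ∫ t, kernel d hδ (y - t) = 1 := by
    rw [integral_sub_left_eq_self (kernel d hδ), integral_kernel]
  have h2 : v y = ∫ t, kernel d hδ (y - t) • v y := by rw [integral_smul_const, h1, one_smul]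
  have h3 : mollify hδ v y - v y =
      ∫ t, (kernel d hδ (y - t) • truncate δ v t - kernel d hδ (y - t) • v y) := by
    rw [integral_sub (integrable_kernel_smul_truncate hδ hv y) (hi.smul_const _), ← h2, mollify_eq]
  rw [h3]
  refine (norm_integral_le_of_norm_le (hi.mul_const ε) (.of_forall fun t => ?_)).trans_eq
    (by rw [integral_mul_const, h1, one_mul])
  by_cases hk : kernel d hδ (y - t) = 0
  · simp [hk]
  · obtain ⟨h4, h5⟩ := of_kernel_ne_zero hδ hk
    rw [PiLp.sub_apply] at h5
    have hy0 : 0 < y (Fin.last d) := hy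
    rw [truncate_of_lt (by linarith), ← smul_sub, norm_smul,
      Real.norm_of_nonneg (kernel_nonneg hδ _)]
    exact mul_le_mul_of_nonneg_left (hε t h4) (kernel_nonneg hδ _)

end Mollify

/-- Mollification converges to the identity. -/
theorem exists_eLpNorm_mollify_sub_le [CompleteSpace E] [h : Fact (-1 < τ)] (hτ : 0 ≤ τ)
    {v : Space d → E} (hv : MemLp v 2 (weighted d τ)) {ε : ℝ≥0∞} (hε : ε ≠ 0) :
    ∃ δ₀ > 0, ∀ (δ : ℝ) (hδ : 0 < δ), δ ≤ δ₀ →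
      eLpNorm (mollify hδ v - v) 2 (weighted d τ) ≤ ε := by
  obtain ⟨w, hwc, hvw, hw, hwm⟩ := hv.exists_hasCompactSupport_eLpNorm_sub_le (by norm_num)
    (ε := ε / 3) (by simpa using hε)
  obtain ⟨R, hR⟩ : ∃ R : ℝ, ∀ y, R ≤ ‖y‖ → w y = 0 := by
    obtain ⟨R, hR⟩ := hwc.isCompact.isBounded.subset_ball (0 : Space d)
    refine ⟨R, fun y hy => image_eq_zero_of_notMem_tsupport fun h => ?_⟩
    exact absurd (mem_ball_zero_iff.mp (hR h)) (not_lt.mpr hy)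
  have hM : (weighted d τ (Metric.ball 0 (R + 1))) ^ (1 / (2 : ℝ≥0∞).toReal) ≠ ⊤ :=
    ENNReal.rpow_ne_top_of_nonneg (by simp) (weighted_ball_lt_top h.out _).ne
  obtain ⟨η, hη0, hη⟩ := ENNReal.exists_nnreal_pos_mul_lt hM
    (b := ε / 3) (by simpa using hε)
  obtain ⟨δ₁, hδ₁, hunif⟩ := Metric.uniformContinuous_iff.mp
    (hwc.uniformContinuous_of_continuous hw) η (by exact_mod_cast hη0)
  -- The kernel has range 3δ: δ₁/4 keeps this below the modulus of continuity δ₁ of w, and 1/3 lets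
  -- the support grow by at most 1.
  refine ⟨min (δ₁ / 4) (1 / 3), by positivity, fun δ hδ hle => ?_⟩
  have hle1 := hle.trans (min_le_left _ _)
  have hle2 := hle.trans (min_le_right _ _)
  have hmid : eLpNorm (mollify hδ w - w) 2 (weighted d τ) ≤ ε / 3 := by
    refine le_trans (eLpNorm_mono_ae (g := (Metric.ball 0 (R + 1)).indicator fun _ => (η : ℝ)) ?_)
      ((eLpNorm_indicator_const_le _ _).trans ?_)
    · filter_upwards [ae_mem_upper] with y hy
      by_cases hyR : y ∈ Metric.ball (0 : Space d) (R + 1)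
      · rw [indicator_of_mem hyR]
        refine (norm_mollify_sub_le hδ hwm hy fun t ht => ?_).trans (le_abs_self _)
        rw [← dist_eq_norm]
        refine (hunif ?_).le
        rw [dist_comm, dist_eq_norm]
        linarith
      · rw [mem_ball_zero_iff, not_lt] at hyR
        rw [Pi.sub_apply, mollify_eq_zero hδ hR (by linarith), hR y (by linarith)]
        simp
    · have hη' : ‖(η : ℝ)‖ₑ = η := by
        rw [Real.enorm_of_nonneg η.coe_nonneg, ENNReal.ofReal_coe_nnreal]
      rw [hη']
      exact hη.le
  have hsplit : mollify hδ v - v = mollify hδ (v - w) + (mollify hδ w - w) + (w - v) := by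
    funext y
    simp only [Pi.sub_apply, Pi.add_apply, mollify_sub hδ hv hwm]
    abel
  have hmm := memLp_mollify hδ hτ (hv.sub hwm)
  have hmw := (memLp_mollify hδ hτ hwm).sub hwm
  rw [hsplit]
  calc eLpNorm (mollify hδ (v - w) + (mollify hδ w - w) + (w - v)) 2 (weighted d τ)
      ≤ eLpNorm (mollify hδ (v - w)) 2 (weighted d τ) +
          eLpNorm (mollify hδ w - w) 2 (weighted d τ) + eLpNorm (w - v) 2 (weighted d τ) :=
        (eLpNorm_add_le (hmm.add hmw).1 (hwm.sub hv).1 (by norm_num)).trans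
          (add_le_add_left (eLpNorm_add_le hmm.1 hmw.1 (by norm_num)) _)
    _ ≤ ε / 3 + ε / 3 + ε / 3 := by
        gcongr
        · exact (eLpNorm_mollify_le hδ hτ (hv.sub hwm).1).trans hvw
        · rw [eLpNorm_sub_comm]; exact hvw
    _ = ε := ENNReal.add_thirds ε

/-- Mollification commutes with the weak gradient. -/
theorem gradient_mollify {δ : ℝ} (hδ : 0 < δ) {v : Space d → ℝ} {g : Space d → Space d}
    (hv : MemLp v 2 (weighted d σ)) (hg : MemLp g 2 (weighted d τ)) (hvg : IsWeakGradient v g)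
    {y : Space d} (hy : y ∈ upper d) : gradient (mollify hδ v) y = mollify hδ g y := by
  have hy0 : 0 < y (Fin.last d) := hy
  ext i
  set e : Space d := EuclideanSpace.single i 1
  have hk1 : ContDiff ℝ 1 (kernel d hδ) := (contDiff_kernel hδ).of_le (by norm_num)
  have hloc := locallyIntegrable_truncate hδ hv
  have hfd := (hasCompactSupport_kernel hδ).hasFDerivAt_convolution_left
    (ContinuousLinearMap.lsmul ℝ ℝ) hk1 hloc y
  have hex : Integrable fun t => ((ContinuousLinearMap.lsmul ℝ ℝ).precompL (Space d))
      (fderiv ℝ (kernel d hδ) (y - t)) (truncate δ v t) :=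
    (((hasCompactSupport_kernel hδ).fderiv ℝ).convolutionExists_left _
      (hk1.continuous_fderiv (by norm_num)) hloc y).integrable_swap
  have e1 : gradient (mollify hδ v) y i =
      ∫ t, fderiv ℝ (kernel d hδ) (y - t) e * truncate δ v t := by
    rw [gradient_apply, mollify, hfd.fderiv, convolution_eq_swap,
      ContinuousLinearMap.integral_apply hex]
    rfl
  have e2 : mollify hδ g y i = ∫ t, kernel d hδ (y - t) * truncate δ g t i := by
    rw [mollify_eq]
    have := (EuclideanSpace.proj (𝕜 := ℝ) i).integral_comp_comm
      (integrable_kernel_smul_truncate hδ hg y)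
    exact this.symm
  rw [e1, e2]
  have hts : tsupport (fun t => kernel d hδ (y - t)) ⊆ {t | δ ≤ t (Fin.last d)} := by
    refine closure_minimal (fun t ht => ?_) (isClosed_le continuous_const continuous_last)
    have h := (of_kernel_ne_zero hδ ht).2
    rw [PiLp.sub_apply] at h
    show δ ≤ t (Fin.last d)
    linarith
  have hψ : ContDiff ℝ ∞ fun t => kernel d hδ (y - t) :=
    (contDiff_kernel hδ).comp (contDiff_const.sub contDiff_id)
  -- For y in H the support of t ↦ kernel(y - t) lies at height at least δ, so it is an admissible
  -- test function in the definition of the weak gradient.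
  have hψc : HasCompactSupport fun t => kernel d hδ (y - t) :=
    (hasCompactSupport_kernel hδ).comp_homeomorph (Homeomorph.subLeft y)
  have hw := hvg _ hψ hψc (hts.trans fun t ht => hδ.trans_le ht) i
  have hgr : ∀ t, gradient (fun t => kernel d hδ (y - t)) t i =
      -fderiv ℝ (kernel d hδ) (y - t) e := fun t => by
    have h1 := ((hk1.differentiable one_ne_zero) (y - t)).hasFDerivAt.comp t
      ((hasFDerivAt_id t).const_sub y)
    rw [gradient_apply, (show HasFDerivAt (fun t => kernel d hδ (y - t)) _ t from h1).fderiv]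
    simp [e]
  simp only [hgr, mul_neg, integral_neg, neg_inj] at hw
  rw [← integral_indicator measurableSet_upper, ← integral_indicator measurableSet_upper] at hw
  refine Eq.trans (integral_congr_ae (.of_forall fun t => ?_))
    (hw.trans (integral_congr_ae (.of_forall fun t => ?_)))
  · by_cases hk : fderiv ℝ (kernel d hδ) (y - t) = 0
    · by_cases ht : t ∈ upper d <;> simp [ht, hk]
    · have h := (of_mem_tsupport_kernel hδ (support_fderiv_subset ℝ hk)).2
      rw [PiLp.sub_apply] at h
      simp only
      rw [truncate_of_lt (by linarith : δ < t (Fin.last d)),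
        indicator_of_mem (show t ∈ upper d from show 0 < t (Fin.last d) by linarith), mul_comm]
  · by_cases hk : kernel d hδ (y - t) = 0
    · by_cases ht : t ∈ upper d <;> simp [ht, hk]
    · have h := (of_kernel_ne_zero hδ hk).2
      rw [PiLp.sub_apply] at h
      simp only
      rw [truncate_of_lt (by linarith : δ < t (Fin.last d)),
        indicator_of_mem (show t ∈ upper d from show 0 < t (Fin.last d) by linarith), mul_comm]

end HalfSpace

/-! ### Injectivity of the weak gradient and density of test functions. -/

namespace HalfSpace

variable {d : ℕ} {τ σ : ℝ} [hσ : Fact (-1 < σ)]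

theorem eLpNorm_one_add_le {E F : Type*} [NormedAddCommGroup E] [NormedAddCommGroup F]
    {f : Space d → E} {g : Space d → F} {c : ℝ} (hc : 0 ≤ c)
    (h : ∀ y ∈ upper d, y (Fin.last d) * ‖f y‖ ^ 2 ≤ c ^ 2 * ‖g y‖ ^ 2) :
    eLpNorm f 2 (weighted d (1 + σ)) ≤ ENNReal.ofReal c * eLpNorm g 2 (weighted d σ) := by
  rw [← ENNReal.pow_le_pow_left_iff two_ne_zero, mul_pow, eLpNorm_two_sq, eLpNorm_two_sq,
    weighted_add, ← ENNReal.ofReal_pow hc, ← lintegral_const_mul' _ _ ENNReal.ofReal_ne_top]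
  refine lintegral_mono_ae ?_
  filter_upwards [ae_mem_upper] with y hy
  rw [Real.rpow_one, ← ofReal_norm, ← ofReal_norm, ← ENNReal.ofReal_pow (norm_nonneg _),
    ← ENNReal.ofReal_pow (norm_nonneg _), ← ENNReal.ofReal_mul (le_of_lt hy),
    ← ENNReal.ofReal_mul (by positivity)]
  exact ENNReal.ofReal_le_ofReal (h y hy)

/-- On a bounded support y_n ≤ R, so the weight 1 + σ is dominated by the weight σ. Mollification
can then be used on v itself, with a nonnegative exponent. -/
theorem memLp_one_add {v : Space d → ℝ} (hv : MemLp v 2 (weighted d σ)) {R : ℝ} (hR : 0 ≤ R)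
    (h0 : ∀ y, R ≤ ‖y‖ → v y = 0) : MemLp v 2 (weighted d (1 + σ)) := by
  refine ⟨hv.1.mono_ac weighted_ac_weighted, (eLpNorm_one_add_le (g := v) (Real.sqrt_nonneg R)
    fun y hy => ?_).trans_lt (ENNReal.mul_lt_top ENNReal.ofReal_lt_top hv.2)⟩
  rw [Real.sq_sqrt hR]
  rcases le_total R ‖y‖ with h | h
  · simp [h0 y h]
  · exact mul_le_mul_of_nonneg_right
      (((Real.le_norm_self _).trans (PiLp.norm_apply_le y _)).trans h) (sq_nonneg _)

variable (σ) in
/-- The Poincaré constant of a ball. -/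
def poincareConst (R : ℝ) : ℝ≥0∞ := ENNReal.ofReal √(4 * R / (σ + 1) ^ 2)

theorem eLpNorm_test_le {φ : Space d → ℝ} (hφ : ContDiff ℝ ∞ φ) {R : ℝ} (hR : 0 < R)
    (h0 : ∀ y, R ≤ ‖y‖ → φ y = 0) :
    eLpNorm φ 2 (weighted d σ) ≤
      poincareConst σ R * eLpNorm (gradient φ) 2 (weighted d (1 + σ)) := by
  rw [← ENNReal.pow_le_pow_left_iff two_ne_zero, mul_pow, poincareConst,
    ← ENNReal.ofReal_pow (Real.sqrt_nonneg _), Real.sq_sqrt (by positivity)]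
  exact eLpNorm_test_sq_le hφ hR h0

theorem hasCompactSupport_of_forall_norm {E : Type*} [Zero E] {φ : Space d → E} {R : ℝ}
    (h0 : ∀ y, R ≤ ‖y‖ → φ y = 0) : HasCompactSupport φ :=
  HasCompactSupport.intro (isCompact_closedBall 0 R) fun y hy => h0 y <| by
    rw [mem_closedBall_zero_iff, not_le] at hy
    exact hy.le

theorem gradient_sub_test {φ ψ : Space d → ℝ} (hφ : ContDiff ℝ ∞ φ) (hψ : ContDiff ℝ ∞ ψ) :
    gradient (φ - ψ) = gradient φ - gradient ψ := by
  funext y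
  rw [gradient, fderiv_sub ((hφ.differentiable (by simp)) y) ((hψ.differentiable (by simp)) y),
    map_sub]
  rfl

section BoundedSupport

variable {v : Space d → ℝ} {g : Space d → Space d} (hv : MemLp v 2 (weighted d σ))
  (hg : MemLp g 2 (weighted d (1 + σ))) (hvg : IsWeakGradient v g) {R : ℝ} (hR : 0 < R)
  (h0 : ∀ y, R ≤ ‖y‖ → v y = 0)

theorem eLpNorm_gradient_mollify_sub {δ : ℝ} (hδ : 0 < δ) (hv : MemLp v 2 (weighted d σ))
    (hg : MemLp g 2 (weighted d (1 + σ))) (hvg : IsWeakGradient v g) :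
    eLpNorm (gradient (mollify hδ v) - g) 2 (weighted d (1 + σ)) =
      eLpNorm (mollify hδ g - g) 2 (weighted d (1 + σ)) := by
  refine eLpNorm_congr_ae ?_
  filter_upwards [ae_mem_upper] with y hy
  rw [Pi.sub_apply, Pi.sub_apply, gradient_mollify hδ hv hg hvg hy]

theorem tendsto_eLpNorm_mollify_sub {E : Type*} [NormedAddCommGroup E] [NormedSpace ℝ E]
    [CompleteSpace E] [Fact (-1 < τ)] (hτ : 0 ≤ τ) {w : Space d → E}
    (hw : MemLp w 2 (weighted d τ)) {δ : ℕ → ℝ} (hδ : ∀ n, 0 < δ n)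
    (hlim : Tendsto δ atTop (𝓝 0)) :
    Tendsto (fun n => eLpNorm (mollify (hδ n) w - w) 2 (weighted d τ)) atTop (𝓝 0) := by
  rw [ENNReal.tendsto_nhds_zero]
  intro ε hε
  obtain ⟨δ₀, hδ₀, h⟩ := exists_eLpNorm_mollify_sub_le hτ hw hε.ne'
  filter_upwards [hlim.eventually_le_const hδ₀] with n hn using h _ (hδ n) hn

include hv hg hvg hR h0 in
/-- The Poincaré inequality for the difference of a test function and a function with a weak
gradient. -/
theorem eLpNorm_test_sub_le {φ : Space d → ℝ} (hφ : ContDiff ℝ ∞ φ)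
    (hφ0 : ∀ y, R + 1 ≤ ‖y‖ → φ y = 0) :
    eLpNorm (φ - v) 2 (weighted d σ) ≤
      poincareConst σ (R + 1) * eLpNorm (gradient φ - g) 2 (weighted d (1 + σ)) := by
  have hτ : 0 ≤ 1 + σ := by linarith [hσ.out]
  -- The factor 1/3 keeps every mollification supported in radius R + 1, so that one Poincaré
  -- constant serves all n.
  set δ : ℕ → ℝ := fun n => 1 / 3 * (1 / ((n : ℝ) + 1)) with hδdef
  have hδ : ∀ n, 0 < δ n := fun n => by positivity
  have hδ1 : ∀ n, δ n ≤ 1 / 3 := fun n => by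
    have : 1 / ((n : ℝ) + 1) ≤ 1 := by
      rw [div_le_one (by positivity)]
      linarith [n.cast_nonneg (α := ℝ)]
    simp only [hδdef]
    linarith
  have hlim : Tendsto δ atTop (𝓝 0) := by
    have := (tendsto_one_div_add_atTop_nhds_zero_nat (𝕜 := ℝ)).const_mul (1 / 3 : ℝ)
    rwa [mul_zero] at this
  have hv1 := memLp_one_add hv hR.le h0
  have hvlim := tendsto_eLpNorm_mollify_sub hτ hv1 hδ hlim
  have hglim := tendsto_eLpNorm_mollify_sub hτ hg hδ hlim
  obtain ⟨ns, hns, hae⟩ := (tendstoInMeasure_of_tendsto_eLpNorm two_ne_zero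
    (fun n => (memLp_mollify (hδ n) hτ hv1).1) hv1.1 hvlim).exists_seq_tendsto_ae
  have hsm : ∀ n, ContDiff ℝ ∞ (mollify (hδ n) v) := fun n => contDiff_mollify (hδ n) hv
  -- Mollifications of v converge in L²_{1+σ}, hence almost everywhere along a subsequence. Fatou's
  -- lemma brings the Poincaré bound back to L²_σ, where convergence in norm is not yet known.
  refine (Lp.eLpNorm_lim_le_liminf_eLpNorm (f := fun n => φ - mollify (hδ (ns n)) v)
    (fun n => (hφ.continuous.sub (hsm _).continuous).aestronglyMeasurable) _ ?_).trans ?_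
  · filter_upwards [ae_weighted_of_ae_weighted hae] with y hy
    exact hy.const_sub (φ y)
  · have hbound : ∀ n, eLpNorm (φ - mollify (hδ (ns n)) v) 2 (weighted d σ) ≤
        poincareConst σ (R + 1) * (eLpNorm (gradient φ - g) 2 (weighted d (1 + σ)) +
          eLpNorm (mollify (hδ (ns n)) g - g) 2 (weighted d (1 + σ))) := fun n => by
      have hm : ∀ y, R + 1 ≤ ‖y‖ → mollify (hδ (ns n)) v y = 0 := fun y hy =>
        mollify_eq_zero _ h0 (by linarith [hδ1 (ns n)])
      refine (eLpNorm_test_le (φ := φ - mollify (hδ (ns n)) v) (hφ.sub (hsm _)) (by linarith)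
        fun y hy => ?_).trans
        (mul_le_mul_right ?_ _)
      · rw [Pi.sub_apply, hφ0 y hy, hm y hy, sub_zero]
      · rw [gradient_sub_test hφ (hsm _), ← eLpNorm_gradient_mollify_sub _ hv hg hvg,
          eLpNorm_sub_comm (gradient (mollify _ v))]
        have hm1 := (continuous_gradient hφ).aestronglyMeasurable (μ := weighted d (1 + σ))
        have hm2 := (continuous_gradient (hsm (ns n))).aestronglyMeasurable
          (μ := weighted d (1 + σ))
        refine le_trans (le_of_eq ?_) (eLpNorm_add_le (hm1.sub hg.1) (hg.1.sub hm2) (by norm_num))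
        rw [sub_add_sub_cancel]
    have hlim2 : Tendsto (fun n => poincareConst σ (R + 1) *
        (eLpNorm (gradient φ - g) 2 (weighted d (1 + σ)) +
          eLpNorm (mollify (hδ (ns n)) g - g) 2 (weighted d (1 + σ)))) atTop
        (𝓝 (poincareConst σ (R + 1) * (eLpNorm (gradient φ - g) 2 (weighted d (1 + σ)) + 0))) :=
      ENNReal.Tendsto.const_mul ((hglim.comp hns.tendsto_atTop).const_add _)
        (.inr ENNReal.ofReal_ne_top)
    rw [add_zero] at hlim2
    rw [← hlim2.liminf_eq]
    exact liminf_le_liminf (.of_forall hbound)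

include hv hg hvg hR h0 in
/-- The Poincaré inequality for functions with a weak gradient and bounded support. -/
theorem eLpNorm_le_of_bounded :
    eLpNorm v 2 (weighted d σ) ≤
      poincareConst σ (R + 1) * eLpNorm g 2 (weighted d (1 + σ)) := by
  have h := eLpNorm_test_sub_le hv hg hvg hR h0 (φ := 0) contDiff_const fun _ _ => rfl
  have hz : gradient (0 : Space d → ℝ) = 0 := by
    funext y
    simp [gradient]
  rwa [hz, zero_sub, zero_sub, eLpNorm_neg, eLpNorm_neg] at h

-- A single mollification suffices: its gradient is close to g by contraction in L²_{1+σ}, and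
-- `eLpNorm_test_sub_le` then makes the function close in L²_σ.
include hv hg hvg hR h0 in
theorem exists_test_of_bounded {ε : ℝ≥0∞} (hε : ε ≠ 0) :
    ∃ φ : Space d → ℝ, ContDiff ℝ ∞ φ ∧ HasCompactSupport φ ∧
      eLpNorm (φ - v) 2 (weighted d σ) ≤ ε ∧
      eLpNorm (gradient φ - g) 2 (weighted d (1 + σ)) ≤ ε := by
  have hτ : 0 ≤ 1 + σ := by linarith [hσ.out]
  obtain ⟨η, hη0, hη⟩ := ENNReal.exists_nnreal_pos_mul_lt
    (ENNReal.ofReal_ne_top (r := √(4 * (R + 1) / (σ + 1) ^ 2))) hε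
  have hne : min (η : ℝ≥0∞) ε ≠ 0 := by
    simp [hε, hη0.ne']
  obtain ⟨δ₀, hδ₀, h⟩ := exists_eLpNorm_mollify_sub_le hτ hg hne
  have hδ : 0 < min δ₀ (1 / 3) := by positivity
  have hgr := h _ hδ (min_le_left _ _)
  rw [← eLpNorm_gradient_mollify_sub hδ hv hg hvg] at hgr
  have hz : ∀ y, R + 1 ≤ ‖y‖ → mollify hδ v y = 0 := fun y hy =>
    mollify_eq_zero hδ h0 (by linarith [min_le_right δ₀ (1 / 3)])
  refine ⟨mollify hδ v, contDiff_mollify hδ hv, hasCompactSupport_of_forall_norm hz, ?_,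
    hgr.trans (min_le_right _ _)⟩
  refine (eLpNorm_test_sub_le hv hg hvg hR h0 (contDiff_mollify hδ hv) hz).trans
    (le_trans ?_ hη.le)
  rw [mul_comm (η : ℝ≥0∞)]
  exact mul_le_mul_right (hgr.trans (min_le_left _ _)) _

end BoundedSupport

section Cutoff

variable (d) in
/-- A smooth bump function, equal to one on the unit ball. -/
def bump : Space d → ℝ := (⟨1, 2, one_pos, one_lt_two⟩ : ContDiffBump (0 : Space d))

theorem contDiff_bump : ContDiff ℝ ∞ (bump d) := ContDiffBump.contDiff _

theorem hasCompactSupport_bump : HasCompactSupport (bump d) := ContDiffBump.hasCompactSupport _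

variable (d) in
/-- The bump function rescaled to radius `R`. -/
def cutoff (R : ℝ) : Space d → ℝ := fun y => bump d (R⁻¹ • y)

variable {R : ℝ}

theorem contDiff_cutoff : ContDiff ℝ ∞ (cutoff d R) :=
  contDiff_bump.comp (contDiff_const_smul _)

theorem cutoff_nonneg (y : Space d) : 0 ≤ cutoff d R y := ContDiffBump.nonneg _

theorem cutoff_le_one (y : Space d) : cutoff d R y ≤ 1 := ContDiffBump.le_one _

theorem cutoff_eq_one (hR : 0 < R) {y : Space d} (hy : ‖y‖ ≤ R) : cutoff d R y = 1 := by
  refine ContDiffBump.one_of_mem_closedBall _ ?_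
  rw [mem_closedBall_zero_iff, norm_smul, norm_inv, Real.norm_of_nonneg hR.le,
    inv_mul_le_iff₀ hR]
  simpa using hy

theorem cutoff_eq_zero (hR : 0 < R) {y : Space d} (hy : 2 * R ≤ ‖y‖) : cutoff d R y = 0 := by
  refine ContDiffBump.zero_of_le_dist _ ?_
  rw [dist_zero_right, norm_smul, norm_inv, Real.norm_of_nonneg hR.le, le_inv_mul_iff₀ hR]
  simpa [mul_comm] using hy

theorem gradient_cutoff (y : Space d) :
    gradient (cutoff d R) y = R⁻¹ • gradient (bump d) (R⁻¹ • y) := by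
  rw [gradient, gradient]
  have : fderiv ℝ (cutoff d R) y = R⁻¹ • fderiv ℝ (bump d) (R⁻¹ • y) := fderiv_comp_smul _
  rw [this, map_smul]

theorem gradient_cutoff_eq_zero_of_lt (hR : 0 < R) {y : Space d} (hy : ‖y‖ < R) :
    gradient (cutoff d R) y = 0 := by
  have h : cutoff d R =ᶠ[𝓝 y] fun _ => 1 := by
    filter_upwards [Metric.isOpen_ball.mem_nhds (mem_ball_zero_iff.mpr hy)] with z hz
    exact cutoff_eq_one hR (mem_ball_zero_iff.mp hz).le
  rw [gradient, h.fderiv_eq]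
  simp

theorem gradient_cutoff_eq_zero_of_gt (hR : 0 < R) {y : Space d} (hy : 2 * R < ‖y‖) :
    gradient (cutoff d R) y = 0 := by
  have h : cutoff d R =ᶠ[𝓝 y] fun _ => 0 := by
    filter_upwards [(isOpen_lt continuous_const continuous_norm).mem_nhds hy] with z hz
    exact cutoff_eq_zero hR (le_of_lt hz)
  rw [gradient, h.fderiv_eq]
  simp

variable (d) in
theorem exists_norm_gradient_bump_le : ∃ C : ℝ, 0 ≤ C ∧ ∀ y, ‖gradient (bump d) y‖ ≤ C := by
  obtain ⟨C, hC⟩ := (continuous_gradient (contDiff_bump (d := d))).bounded_above_of_compact_support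
    (hasCompactSupport_gradient hasCompactSupport_bump)
  exact ⟨C, (norm_nonneg _).trans (hC 0), hC⟩

/-- The product rule for weak gradients. -/
theorem IsWeakGradient.mul {v χ : Space d → ℝ} {g : Space d → Space d} {τ : ℝ}
    (hv : MemLp v 2 (weighted d σ)) (hg : MemLp g 2 (weighted d τ)) (hvg : IsWeakGradient v g)
    (hχ : ContDiff ℝ ∞ χ) :
    IsWeakGradient (fun y => χ y * v y) (fun y => χ y • g y + v y • gradient χ y) := by
  intro ψ hψ hψc hs i
  have hloc : ∀ {F : Space d → ℝ} {X : Space d → ℝ} {μ : ℝ}, MemLp F 2 (weighted d μ) →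
      Continuous X → HasCompactSupport X → tsupport X ⊆ upper d →
      Integrable (fun y => F y * X y) (volume.restrict (upper d)) := by
    intro F X μ hF hX hXc hXs
    have h1 : IntegrableOn (fun y => F y * X y) (tsupport X) :=
      (integrableOn_of_isCompact hF hXc hXs).mul_continuousOn hX.continuousOn hXc
    exact (h1.integrable_of_forall_notMem_eq_zero fun y hy => by
      rw [image_eq_zero_of_notMem_tsupport hy, mul_zero]).restrict
  have hprod := hvg (fun y => χ y * ψ y) (hχ.mul hψ) hψc.mul_left
    ((closure_mono (Function.support_mul_subset_right _ _)).trans hs) i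
  have hgrad : ∀ y, gradient (fun y => χ y * ψ y) y i =
      χ y * gradient ψ y i + gradient χ y i * ψ y := fun y => by
    simp only [gradient_apply]
    rw [fderiv_fun_mul ((hχ.differentiable (by simp)) y) ((hψ.differentiable (by simp)) y)]
    simp [mul_comm]
  have i1 : Integrable (fun y => v y * (χ y * gradient ψ y i)) (volume.restrict (upper d)) :=
    hloc hv (hχ.continuous.mul (continuous_gradient_apply hψ i))
      (hasCompactSupport_gradient_apply hψc i).mul_left
      ((closure_mono (Function.support_mul_subset_right _ _)).trans
        (tsupport_gradient_apply_subset hs i))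
  have i2 : Integrable (fun y => v y * (gradient χ y i * ψ y)) (volume.restrict (upper d)) :=
    hloc hv ((continuous_gradient_apply hχ i).mul hψ.continuous) hψc.mul_left
      ((closure_mono (Function.support_mul_subset_right _ _)).trans hs)
  have i3 : Integrable (fun y => g y i * (χ y * ψ y)) (volume.restrict (upper d)) :=
    hloc (hg.continuousLinearMap_comp (EuclideanSpace.proj (𝕜 := ℝ) i))
      (hχ.continuous.mul hψ.continuous) hψc.mul_left
      ((closure_mono (Function.support_mul_subset_right _ _)).trans hs)
  simp only [hgrad, mul_add] at hprod
  rw [integral_add i1 i2] at hprod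
  have e1 : ∫ y in upper d, χ y * v y * gradient ψ y i =
      ∫ y in upper d, v y * (χ y * gradient ψ y i) := by
    congr 1; funext y; ring
  have e2 : ∫ y in upper d, (χ y • g y + v y • gradient χ y) i * ψ y =
      (∫ y in upper d, g y i * (χ y * ψ y)) + ∫ y in upper d, v y * (gradient χ y i * ψ y) := by
    rw [← integral_add i3 i2]
    congr 1; funext y
    simp only [PiLp.add_apply, PiLp.smul_apply, smul_eq_mul]
    ring
  rw [e1, e2]
  linarith

variable {v : Space d → ℝ} {g : Space d → Space d}

theorem exists_eLpNorm_tail_le {E : Type*} [NormedAddCommGroup E] [NormedSpace ℝ E]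
    [Fact (-1 < τ)] {w : Space d → E} (hw : MemLp w 2 (weighted d τ)) {ε : ℝ≥0∞} (hε : ε ≠ 0) :
    ∃ R₀ : ℝ, ∀ R, R₀ ≤ R →
      eLpNorm ({y : Space d | R ≤ ‖y‖}.indicator w) 2 (weighted d τ) ≤ ε := by
  obtain ⟨k, hkc, hwk, hk, -⟩ := hw.exists_hasCompactSupport_eLpNorm_sub_le (by norm_num) hε
  obtain ⟨R₀, hR₀⟩ := hkc.isCompact.isBounded.subset_ball (0 : Space d)
  refine ⟨R₀, fun R hR => (eLpNorm_mono fun y => ?_).trans hwk⟩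
  by_cases hy : y ∈ {y : Space d | R ≤ ‖y‖}
  · have h0 : k y = 0 := image_eq_zero_of_notMem_tsupport fun h =>
      absurd (mem_ball_zero_iff.mp (hR₀ h)) (not_lt.mpr (hR.trans hy))
    rw [indicator_of_mem hy, Pi.sub_apply, h0, sub_zero]
  · rw [indicator_of_notMem hy, norm_zero]
    exact norm_nonneg _

theorem eLpNorm_cutoff_smul_sub_le {E : Type*} [NormedAddCommGroup E] [NormedSpace ℝ E]
    (hR : 0 < R) (w : Space d → E) (μ : Measure (Space d)) :
    eLpNorm ((fun y => cutoff d R y • w y) - w) 2 μ ≤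
      eLpNorm ({y : Space d | R ≤ ‖y‖}.indicator w) 2 μ := by
  refine eLpNorm_mono fun y => ?_
  have h1 : cutoff d R y • w y - w y = (cutoff d R y - 1) • w y := by rw [sub_smul, one_smul]
  rw [Pi.sub_apply, h1, norm_smul]
  by_cases hy : y ∈ {y : Space d | R ≤ ‖y‖}
  · rw [indicator_of_mem hy]
    refine mul_le_of_le_one_left (norm_nonneg _) ?_
    rw [Real.norm_eq_abs, abs_le]
    constructor <;> linarith [cutoff_nonneg (R := R) y, cutoff_le_one (R := R) y]
  · rw [cutoff_eq_one hR (le_of_lt (not_le.mp hy))]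
    simp

/-- The gradient of the cutoff is at most C/R and lives where R ≤ ‖y‖ ≤ 2R, so the extra weight y_n
is at most 2R; together, y_n |∇cutoff|² ≤ 2C²/R. -/
theorem eLpNorm_smul_gradient_cutoff_le (hR : 0 < R) {C : ℝ} (hC0 : 0 ≤ C)
    (hC : ∀ y, ‖gradient (bump d) y‖ ≤ C) (v : Space d → ℝ) :
    eLpNorm (fun y => v y • gradient (cutoff d R) y) 2 (weighted d (1 + σ)) ≤
      ENNReal.ofReal (√(2 / R) * C) *
        eLpNorm ({y : Space d | R ≤ ‖y‖}.indicator v) 2 (weighted d σ) := by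
  refine eLpNorm_one_add_le (by positivity) fun y hy => ?_
  have hy0 : 0 ≤ y (Fin.last d) := le_of_lt hy
  by_cases hy1 : y ∈ {y : Space d | R ≤ ‖y‖}
  · rw [indicator_of_mem hy1]
    rcases le_or_gt ‖y‖ (2 * R) with hy2 | hy2
    · have h1 : ‖gradient (cutoff d R) y‖ ≤ R⁻¹ * C := by
        rw [gradient_cutoff, norm_smul, norm_inv, Real.norm_of_nonneg hR.le]
        exact mul_le_mul_of_nonneg_left (hC _) (by positivity)
      have h2 : y (Fin.last d) ≤ 2 * R :=
        ((Real.le_norm_self _).trans (PiLp.norm_apply_le y _)).trans hy2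
      rw [norm_smul, mul_pow, mul_pow, Real.sq_sqrt (by positivity)]
      calc y (Fin.last d) * (‖v y‖ ^ 2 * ‖gradient (cutoff d R) y‖ ^ 2)
          ≤ 2 * R * (‖v y‖ ^ 2 * (R⁻¹ * C) ^ 2) := by gcongr
        _ = 2 / R * C ^ 2 * ‖v y‖ ^ 2 := by field_simp
    · rw [gradient_cutoff_eq_zero_of_gt hR hy2]
      simp
      positivity
  · rw [gradient_cutoff_eq_zero_of_lt hR (not_le.mp hy1)]
    simp
    positivity

theorem memLp_cutoff_smul {E : Type*} [NormedAddCommGroup E] [NormedSpace ℝ E]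
    {w : Space d → E} {μ : Measure (Space d)} (hw : MemLp w 2 μ) :
    MemLp (fun y => cutoff d R y • w y) 2 μ :=
  hw.of_le ((contDiff_cutoff (R := R)).continuous.aestronglyMeasurable.smul hw.1) <|
    .of_forall fun y => by
      rw [norm_smul, Real.norm_of_nonneg (cutoff_nonneg y)]
      exact mul_le_of_le_one_left (norm_nonneg _) (cutoff_le_one y)

theorem memLp_smul_gradient_cutoff (hv : MemLp v 2 (weighted d σ)) (hR : 0 < R) :
    MemLp (fun y => v y • gradient (cutoff d R) y) 2 (weighted d (1 + σ)) := by
  obtain ⟨C, hC0, hC⟩ := exists_norm_gradient_bump_le d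
  refine ⟨(hv.1.mono_ac weighted_ac_weighted).smul
    (continuous_gradient contDiff_cutoff).aestronglyMeasurable,
    (eLpNorm_smul_gradient_cutoff_le hR hC0 hC v).trans_lt
      (ENNReal.mul_lt_top ENNReal.ofReal_lt_top ?_)⟩
  exact (eLpNorm_indicator_le _).trans_lt hv.2

/-- A square integrable function with vanishing weak gradient is zero. -/
theorem eLpNorm_eq_zero_of_gradient_eq_zero (hv : MemLp v 2 (weighted d σ))
    (hvg : IsWeakGradient v (0 : Space d → Space d)) : eLpNorm v 2 (weighted d σ) = 0 := by
  obtain ⟨C, hC0, hC⟩ := exists_norm_gradient_bump_le d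
  -- Poincaré constant times cutoff factor: (4(2R + 1)/(σ+1)²)(2/R) = (16 + 8/R)/(σ+1)², at most
  -- 24/(σ+1)² for R ≥ 1. The product stays bounded while the tail norm tends to 0.
  set M : ℝ := √(24 / (σ + 1) ^ 2) * C with hM
  have key : ∀ R, 1 ≤ R → eLpNorm v 2 (weighted d σ) ≤
      (ENNReal.ofReal M + 1) * eLpNorm ({y : Space d | R ≤ ‖y‖}.indicator v) 2 (weighted d σ) := by
    intro R hR1
    have hR : 0 < R := by linarith
    have hgm := memLp_smul_gradient_cutoff hv hR
    have hcm : MemLp (fun y => cutoff d R y • v y) 2 (weighted d σ) := memLp_cutoff_smul hv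
    have hw := IsWeakGradient.mul (τ := 1 + σ) hv MemLp.zero hvg (contDiff_cutoff (R := R))
    have hw' : IsWeakGradient (fun y => cutoff d R y • v y)
        (fun y => v y • gradient (cutoff d R) y) := by
      simpa using hw
    have h1 := eLpNorm_le_of_bounded hcm hgm hw' (R := 2 * R) (by linarith)
      fun y hy => by rw [cutoff_eq_zero hR hy, zero_smul]
    have h2 := h1.trans (mul_le_mul_right (eLpNorm_smul_gradient_cutoff_le hR hC0 hC v) _)
    have h3 : poincareConst σ (2 * R + 1) * ENNReal.ofReal (√(2 / R) * C) ≤ ENNReal.ofReal M := by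
      rw [poincareConst, ← ENNReal.ofReal_mul (Real.sqrt_nonneg _), ← mul_assoc,
        ← Real.sqrt_mul (by positivity), hM]
      refine ENNReal.ofReal_le_ofReal (mul_le_mul_of_nonneg_right (Real.sqrt_le_sqrt ?_) hC0)
      have hs : σ + 1 ≠ 0 := by linarith [hσ.out]
      rw [div_mul_div_comm, div_le_div_iff₀ (by positivity) (by positivity)]
      nlinarith [sq_nonneg (σ + 1)]
    rw [← mul_assoc] at h2
    have h4 := h2.trans (mul_le_mul_left h3 _)
    have h5 := eLpNorm_cutoff_smul_sub_le hR v (weighted d σ)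
    have h6 : v = (fun y => cutoff d R y • v y) - ((fun y => cutoff d R y • v y) - v) :=
      (sub_sub_cancel _ _).symm
    calc eLpNorm v 2 (weighted d σ)
        = eLpNorm ((fun y => cutoff d R y • v y) - ((fun y => cutoff d R y • v y) - v)) 2
            (weighted d σ) := by rw [← h6]
      _ ≤ _ := eLpNorm_sub_le hcm.1 (hcm.sub hv).1 (by norm_num)
      _ ≤ _ := by rw [add_mul, one_mul]; exact add_le_add h4 h5
  refine le_antisymm (le_of_forall_gt_imp_ge_of_dense fun ε hε => ?_) zero_le
  obtain ⟨η, hη0, hη⟩ := ENNReal.exists_nnreal_pos_mul_lt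
    (a := ENNReal.ofReal M + 1) (by finiteness) hε.ne'
  obtain ⟨R₀, h⟩ := exists_eLpNorm_tail_le hv (ε := η) (by simpa using hη0.ne')
  refine (key (max R₀ 1) (le_max_right _ _)).trans (le_trans ?_ hη.le)
  rw [mul_comm (η : ℝ≥0∞)]
  exact mul_le_mul_right (h _ (le_max_left _ _)) _

/-- Test functions are dense in the graph of the weak gradient. -/
theorem exists_test_eLpNorm_sub_le (hv : MemLp v 2 (weighted d σ))
    (hg : MemLp g 2 (weighted d (1 + σ))) (hvg : IsWeakGradient v g) {ε : ℝ≥0∞} (hε : ε ≠ 0) :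
    ∃ φ : Space d → ℝ, ContDiff ℝ ∞ φ ∧ HasCompactSupport φ ∧
      eLpNorm (φ - v) 2 (weighted d σ) ≤ ε ∧
      eLpNorm (gradient φ - g) 2 (weighted d (1 + σ)) ≤ ε := by
  obtain ⟨C, hC0, hC⟩ := exists_norm_gradient_bump_le d
  have hε3 : ε / 3 ≠ 0 := by simpa using hε
  -- η controls the term v∇cutoff: for R ≥ 1 its factor √(2/R)·C is at most √2·C.
  obtain ⟨η, hη0, hη⟩ := ENNReal.exists_nnreal_pos_mul_lt
    (ENNReal.ofReal_ne_top (r := √2 * C)) hε3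
  have hne : min (η : ℝ≥0∞) (ε / 3) ≠ 0 := by simp [hε, hη0.ne']
  obtain ⟨R₁, h₁⟩ := exists_eLpNorm_tail_le hv hne
  obtain ⟨R₂, h₂⟩ := exists_eLpNorm_tail_le hg hε3
  set R := max (max R₁ R₂) 1
  have hR1 : 1 ≤ R := le_max_right _ _
  have hR : 0 < R := by linarith
  have t₁ := h₁ R ((le_max_left _ _).trans (le_max_left _ _))
  have t₂ := h₂ R ((le_max_right _ _).trans (le_max_left _ _))
  have hgm := memLp_smul_gradient_cutoff hv hR
  have hcv : MemLp (fun y => cutoff d R y • v y) 2 (weighted d σ) := memLp_cutoff_smul hv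
  have hcg : MemLp (fun y => cutoff d R y • g y) 2 (weighted d (1 + σ)) := memLp_cutoff_smul hg
  obtain ⟨φ, hφ, hφc, e₁, e₂⟩ := exists_test_of_bounded hcv (hcg.add hgm)
    (IsWeakGradient.mul hv hg hvg contDiff_cutoff) (R := 2 * R) (by linarith)
    (fun y hy => by rw [cutoff_eq_zero hR hy, zero_smul]) hε3
  have s₁ := (eLpNorm_cutoff_smul_sub_le hR v (weighted d σ)).trans t₁
  have s₂ := (eLpNorm_cutoff_smul_sub_le hR g (weighted d (1 + σ))).trans t₂
  have s₃ : eLpNorm (fun y => v y • gradient (cutoff d R) y) 2 (weighted d (1 + σ)) ≤ ε / 3 := by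
    refine (eLpNorm_smul_gradient_cutoff_le hR hC0 hC v).trans (le_trans ?_ hη.le)
    rw [mul_comm (η : ℝ≥0∞)]
    refine mul_le_mul' (ENNReal.ofReal_le_ofReal ?_) (t₁.trans (min_le_left _ _))
    refine mul_le_mul_of_nonneg_right (Real.sqrt_le_sqrt ?_) hC0
    exact div_le_self (by norm_num) hR1
  refine ⟨φ, hφ, hφc, ?_, ?_⟩
  · calc eLpNorm (φ - v) 2 (weighted d σ)
        = eLpNorm ((φ - fun y => cutoff d R y • v y) + ((fun y => cutoff d R y • v y) - v)) 2
            (weighted d σ) := by rw [sub_add_sub_cancel]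
      _ ≤ _ := eLpNorm_add_le ((memLp_test hφ hφc).sub hcv).1 (hcv.sub hv).1 (by norm_num)
      _ ≤ ε / 3 + ε / 3 := add_le_add e₁ (s₁.trans (min_le_right _ _))
      _ ≤ ε / 3 + ε / 3 + ε / 3 := le_self_add
      _ = ε := ENNReal.add_thirds ε
  · have hsplit : gradient φ - g =
        (gradient φ - ((fun y => cutoff d R y • g y) + fun y => v y • gradient (cutoff d R) y)) +
          ((fun y => cutoff d R y • g y) - g) + fun y => v y • gradient (cutoff d R) y := by
      abel
    have hm := (memLp_gradient_test (τ := 1 + σ) hφ hφc).sub (hcg.add hgm)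
    rw [hsplit]
    calc _ ≤ _ := eLpNorm_add_le (hm.add (hcg.sub hg)).1 hgm.1 (by norm_num)
      _ ≤ _ := add_le_add_left (eLpNorm_add_le hm.1 (hcg.sub hg).1 (by norm_num)) _
      _ ≤ ε / 3 + ε / 3 + ε / 3 := add_le_add (add_le_add e₂ s₂) s₃
      _ = ε := ENNReal.add_thirds ε

end Cutoff

theorem mem_closure_testPair {p : WithLp 2 (L2 d σ × L2Vec d (1 + σ))}
    (hp : p ∈ gradientGraph d σ) :
    p ∈ closure {q | ∃ (φ : Space d → ℝ) (hφ : ContDiff ℝ ∞ φ) (hc : HasCompactSupport φ),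
      q = testPair σ hφ hc} := by
  have hne : ∀ n : ℕ, ((n : ℝ≥0∞) + 1)⁻¹ ≠ 0 := fun n => by simp
  choose φ hφ hc h₁ h₂ using fun n : ℕ => exists_test_eLpNorm_sub_le (Lp.memLp p.fst)
    (Lp.memLp p.snd) hp (hne n)
  have hlim : Tendsto (fun n : ℕ => ((n : ℝ≥0∞) + 1)⁻¹) atTop (𝓝 0) := by
    have := (tendsto_add_atTop_iff_nat 1).mpr ENNReal.tendsto_inv_nat_nhds_zero
    simpa using this
  refine mem_closure_of_tendsto (f := fun n => testPair σ (hφ n) (hc n)) (b := atTop) ?_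
    (.of_forall fun n => ⟨φ n, hφ n, hc n, rfl⟩)
  have t₁ : Tendsto (fun n => (memLp_test (τ := σ) (hφ n) (hc n)).toLp) atTop (𝓝 p.fst) := by
    rw [← Lp.toLp_coeFn p.fst (Lp.memLp _), Lp.tendsto_Lp_iff_tendsto_eLpNorm'']
    exact tendsto_of_tendsto_of_tendsto_of_le_of_le tendsto_const_nhds hlim (fun _ => zero_le) h₁
  have t₂ : Tendsto (fun n => (memLp_gradient_test (τ := 1 + σ) (hφ n) (hc n)).toLp) atTop
      (𝓝 p.snd) := by
    rw [← Lp.toLp_coeFn p.snd (Lp.memLp _), Lp.tendsto_Lp_iff_tendsto_eLpNorm'']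
    exact tendsto_of_tendsto_of_tendsto_of_le_of_le tendsto_const_nhds hlim (fun _ => zero_le) h₂
  exact ((WithLp.prod_continuous_toLp 2 _ _).tendsto _).comp (t₁.prodMk_nhds t₂)

theorem fst_eq_zero_of_snd_eq_zero {p : WithLp 2 (L2 d σ × L2Vec d (1 + σ))}
    (hp : p ∈ gradientGraph d σ) (h : p.snd = 0) : p.fst = 0 := by
  have hw : IsWeakGradient p.fst (0 : Space d → Space d) := fun ψ hψ hc hs i => by
    have h1 := hp ψ hψ hc hs i
    rw [h1]
    refine congrArg Neg.neg (integral_congr_ae ?_)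
    have h2 : ∀ᵐ y ∂(weighted d (1 + σ)), p.snd y = 0 := by
      rw [h]
      exact Lp.coeFn_zero _ _ _
    filter_upwards [ae_weighted_iff.mp h2] with y hy
    rw [hy]
    rfl
  have h0 := eLpNorm_eq_zero_of_gradient_eq_zero (Lp.memLp p.fst) hw
  rw [← norm_eq_zero, Lp.norm_def, h0, ENNReal.toReal_zero]

end HalfSpace

/-! ### Space-time test functions as curves in L². -/

namespace HalfSpace

variable {d : ℕ} {τ σ : ℝ}

section Slice

variable {E : Type*} [NormedAddCommGroup E] [NormedSpace ℝ E] [hτ : Fact (-1 < τ)]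
  {X : ℝ × Space d → E} (hX : Continuous X) (hc : HasCompactSupport X)

theorem slice_eq_zero {s : ℝ} {y : Space d} (hy : y ∉ Prod.snd '' tsupport X) : X (s, y) = 0 :=
  image_eq_zero_of_notMem_tsupport fun h => hy ⟨_, h, rfl⟩

include hc in
theorem hasCompactSupport_slice (s : ℝ) : HasCompactSupport fun y => X (s, y) :=
  HasCompactSupport.intro (hc.isCompact.image continuous_snd) fun _ hy => slice_eq_zero hy

include hX hc in
theorem memLp_slice (s : ℝ) : MemLp (fun y => X (s, y)) 2 (weighted d τ) :=
  (hX.comp (by fun_prop)).memLp_of_hasCompactSupport (hasCompactSupport_slice hc s)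

variable (τ) in
/-- The time slices of a compactly supported continuous function. -/
def sliceLp (s : ℝ) : Lp E 2 (weighted d τ) := (memLp_slice hX hc s).toLp

variable (τ) in
/-- A bound of the `L²` norm by the supremum norm, for functions supported in a compact set. -/
theorem exists_norm_toLp_le {k : Set (Space d)} (hk : IsCompact k) : ∃ M : ℝ, 0 < M ∧
    ∀ (Y : Space d → E) (hY : MemLp Y 2 (weighted d τ)) (ε : ℝ), 0 ≤ ε → (∀ y, ‖Y y‖ ≤ ε) →
      (∀ y ∉ k, Y y = 0) → ‖hY.toLp‖ ≤ M * ε := by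
  have hfin : weighted d τ k ^ (1 / (2 : ℝ≥0∞).toReal) ≠ ⊤ :=
    ENNReal.rpow_ne_top_of_nonneg (by simp) hk.measure_lt_top.ne
  refine ⟨(weighted d τ k ^ (1 / (2 : ℝ≥0∞).toReal)).toReal + 1, by positivity,
    fun Y hY ε hε hle h0 => ?_⟩
  have h1 : eLpNorm Y 2 (weighted d τ) ≤
      ENNReal.ofReal ε * weighted d τ k ^ (1 / (2 : ℝ≥0∞).toReal) := by
    refine le_trans (eLpNorm_mono (g := k.indicator fun _ => ε) fun y => ?_)
      ((eLpNorm_indicator_const_le _ _).trans_eq (by rw [Real.enorm_of_nonneg hε]))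
    by_cases hy : y ∈ k
    · rw [indicator_of_mem hy]
      exact (hle y).trans (le_abs_self _)
    · rw [h0 y hy]
      simp
  rw [Lp.norm_toLp]
  refine (ENNReal.toReal_mono (ENNReal.mul_ne_top ENNReal.ofReal_ne_top hfin) h1).trans ?_
  rw [ENNReal.toReal_mul, ENNReal.toReal_ofReal hε]
  linarith

theorem continuous_sliceLp : Continuous (sliceLp τ hX hc) := by
  obtain ⟨M, hM, h⟩ := exists_norm_toLp_le (E := E) τ (hc.isCompact.image continuous_snd)
  rw [Metric.continuous_iff]
  intro s ε hε
  obtain ⟨δ, hδ, hu⟩ := Metric.uniformContinuous_iff.mp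
    (hc.uniformContinuous_of_continuous hX) (ε / (2 * M)) (by positivity)
  refine ⟨δ, hδ, fun r hr => ?_⟩
  have h1 := h _ ((memLp_slice (τ := τ) hX hc r).sub (memLp_slice hX hc s)) (ε / (2 * M))
    (by positivity) (fun y => ?_) fun y hy => ?_
  · rw [MemLp.toLp_sub] at h1
    rw [dist_eq_norm]
    refine h1.trans_lt ?_
    rw [mul_div_assoc', div_lt_iff₀ (by positivity)]
    nlinarith
  · rw [Pi.sub_apply, ← dist_eq_norm]
    refine (hu ?_).le
    rwa [Prod.dist_eq, dist_self, max_eq_left dist_nonneg]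
  · rw [Pi.sub_apply, slice_eq_zero hy, slice_eq_zero hy, sub_zero]

theorem hasCompactSupport_sliceLp : HasCompactSupport (sliceLp τ hX hc) := by
  refine HasCompactSupport.intro (hc.isCompact.image continuous_fst) fun s hs => ?_
  have h : (fun y => X (s, y)) = 0 := funext fun y =>
    image_eq_zero_of_notMem_tsupport fun h => hs ⟨_, h, rfl⟩
  rw [sliceLp, MemLp.toLp_eq_toLp_iff (memLp_slice hX hc s) (MemLp.zero) |>.mpr (by rw [h])]
  exact MemLp.toLp_zero _

/-- Uniform continuity of X' and the mean value inequality bound the difference quotient error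
uniformly in y; the common compact support turns this into an L² bound. -/
theorem hasDerivAt_sliceLp {X' : ℝ × Space d → E} (hX' : Continuous X') (hc' : HasCompactSupport X')
    (hd : ∀ s y, HasDerivAt (fun t => X (t, y)) (X' (s, y)) s) (s : ℝ) :
    HasDerivAt (sliceLp τ hX hc) (sliceLp τ hX' hc' s) s := by
  obtain ⟨M, hM, h⟩ := exists_norm_toLp_le (E := E) τ
    ((hc.isCompact.image continuous_snd).union (hc'.isCompact.image continuous_snd))
  rw [hasDerivAt_iff_isLittleO, Asymptotics.isLittleO_iff]
  intro ε hε
  obtain ⟨δ, hδ, hu⟩ := Metric.uniformContinuous_iff.mp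
    (hc'.uniformContinuous_of_continuous hX') (ε / M) (by positivity)
  filter_upwards [Metric.ball_mem_nhds s hδ] with r hr
  have m1 := memLp_slice (τ := τ) hX hc
  have m2 := (memLp_slice (τ := τ) hX' hc' s).const_smul (r - s)
  have h1 := h _ (((m1 r).sub (m1 s)).sub m2) (ε / M * ‖r - s‖)
    (by positivity) (fun y => ?_) fun y hy => ?_
  · rw [MemLp.toLp_sub ((m1 r).sub (m1 s)) m2, MemLp.toLp_sub (m1 r) (m1 s),
      MemLp.toLp_const_smul] at h1
    refine h1.trans_eq ?_
    field_simp
  · have hmv := (convex_ball s δ).norm_image_sub_le_of_norm_hasDerivWithin_le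
      (f := fun t => X (t, y) - t • X' (s, y)) (f' := fun t => X' (t, y) - X' (s, y))
      (C := ε / M) (fun t _ => ?_) (fun t ht => ?_) (Metric.mem_ball_self hδ) hr
    · refine le_trans (le_of_eq ?_) hmv
      congr 1
      simp only [Pi.sub_apply, Pi.smul_apply, sub_smul]
      abel
    · have h2 := ((hasDerivAt_id t).smul_const (X' (s, y)))
      rw [one_smul] at h2
      exact ((hd t y).sub h2).hasDerivWithinAt
    · rw [← dist_eq_norm]
      refine (hu ?_).le
      rwa [Prod.dist_eq, dist_self, max_eq_left dist_nonneg]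
  · rw [mem_union, not_or] at hy
    simp only [Pi.sub_apply, Pi.smul_apply]
    rw [slice_eq_zero hy.1, slice_eq_zero hy.1, slice_eq_zero hy.2]
    simp

end Slice

theorem inner_toLp_eq_integral {α E : Type*} [MeasurableSpace α] [NormedAddCommGroup E]
    [InnerProductSpace ℝ E] {μ : Measure α} (v : Lp E 2 μ) {X : α → E} (hX : MemLp X 2 μ) :
    ⟪v, hX.toLp⟫ = ∫ y, ⟪v y, X y⟫ ∂μ := by
  rw [L2.inner_def]
  refine integral_congr_ae ?_
  filter_upwards [hX.coeFn_toLp] with y hy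
  rw [hy]

section SpaceTime

variable {Φ : ℝ × Space d → ℝ} (hΦ : ContDiff ℝ ∞ Φ) (hc : HasCompactSupport Φ)

theorem contDiff_slice (hΦ : ContDiff ℝ ∞ Φ) (s : ℝ) : ContDiff ℝ ∞ fun y => Φ (s, y) :=
  hΦ.comp (contDiff_prodMk_right s)

/-- The time derivative of a function of time and space. -/
def timeDeriv (Φ : ℝ × Space d → ℝ) (p : ℝ × Space d) : ℝ := fderiv ℝ Φ p (1, 0)

/-- The spatial gradient of a function of time and space. -/
def spaceGradient (Φ : ℝ × Space d → ℝ) (p : ℝ × Space d) : Space d :=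
  gradient (fun z => Φ (p.1, z)) p.2

include hΦ in
theorem hasDerivAt_time (s : ℝ) (y : Space d) :
    HasDerivAt (fun t => Φ (t, y)) (timeDeriv Φ (s, y)) s :=
  ((hΦ.differentiable (by simp)) (s, y)).hasFDerivAt.comp_hasDerivAt s
    ((hasDerivAt_id s).prodMk (hasDerivAt_const s y))

include hΦ in
theorem continuous_timeDeriv : Continuous (timeDeriv Φ) :=
  (hΦ.continuous_fderiv (by simp)).clm_apply continuous_const

include hc in
theorem hasCompactSupport_timeDeriv : HasCompactSupport (timeDeriv Φ) :=
  (hc.fderiv ℝ).comp_left (g := fun L : ℝ × Space d →L[ℝ] ℝ => L (1, 0)) rfl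

include hΦ in
theorem spaceGradient_eq : spaceGradient Φ = fun p => (InnerProductSpace.toDual ℝ (Space d)).symm
    (fderiv ℝ Φ p ∘L ContinuousLinearMap.inr ℝ ℝ (Space d)) := by
  funext p
  have h := ((hΦ.differentiable (by simp)) (p.1, p.2)).hasFDerivAt.comp p.2
    (hasFDerivAt_prodMk_right (𝕜 := ℝ) p.1 p.2)
  rw [spaceGradient, gradient, (show HasFDerivAt (fun z => Φ (p.1, z)) _ p.2 from h).fderiv]

include hΦ in
theorem continuous_spaceGradient : Continuous (spaceGradient Φ) := by
  rw [spaceGradient_eq hΦ]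
  exact (InnerProductSpace.toDual ℝ (Space d)).symm.continuous.comp
    ((hΦ.continuous_fderiv (by simp)).clm_comp continuous_const)

include hΦ hc in
theorem hasCompactSupport_spaceGradient : HasCompactSupport (spaceGradient Φ) := by
  rw [spaceGradient_eq hΦ]
  exact (hc.fderiv ℝ).comp_left (g := fun L : ℝ × Space d →L[ℝ] ℝ =>
    (InnerProductSpace.toDual ℝ (Space d)).symm (L ∘L ContinuousLinearMap.inr ℝ ℝ (Space d)))
    (by simp)

theorem sliceLp_mem_gradientGraph [Fact (-1 < σ)] (s : ℝ) :
    WithLp.toLp 2 (sliceLp σ hΦ.continuous hc s, sliceLp (1 + σ) (continuous_spaceGradient hΦ)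
      (hasCompactSupport_spaceGradient hΦ hc) s) ∈ gradientGraph d σ :=
  testPair_mem (contDiff_slice hΦ s) (hasCompactSupport_slice hc s)

end SpaceTime

end HalfSpace

/-! ### Existence and uniqueness on the half space. -/

namespace HalfSpace

variable {d : ℕ} {σ : ℝ} [hσ : Fact (-1 < σ)] {s₁ s₂ : EReal}

variable (d σ) in
/-- The resolvent of the weighted Neumann operator on the half space. -/
def resolvent : ResolventPair (L2 d σ) (L2Vec d (1 + σ)) :=
  graphResolvent (gradientGraph d σ) (fun _ hp h => fst_eq_zero_of_snd_eq_zero hp h)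
    eq_zero_of_inner_gradientGraph

theorem resolvent_mem (x : L2 d σ) :
    WithLp.toLp 2 ((resolvent d σ).J x, (resolvent d σ).E x) ∈ gradientGraph d σ := by
  unfold resolvent
  exact graphResolvent_mem x

theorem inner_resolvent_E (x : L2 d σ) {v : L2 d σ} {g : L2Vec d (1 + σ)}
    (hp : WithLp.toLp 2 (v, g) ∈ gradientGraph d σ) :
    ⟪(resolvent d σ).E x, g⟫ = ⟪(resolvent d σ).B x, v⟫ := by
  unfold resolvent
  exact inner_graphResolvent_E x hp

theorem norm_resolvent_E_le {v : L2 d σ} {g : L2Vec d (1 + σ)}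
    (hp : WithLp.toLp 2 (v, g) ∈ gradientGraph d σ) : ‖(resolvent d σ).E v‖ ≤ ‖g‖ := by
  have h := norm_graphResolvent_E_le (hker := fun _ hp h => fst_eq_zero_of_snd_eq_zero hp h)
    (hdense := eq_zero_of_inner_gradientGraph) hp
  exact h

theorem eventually_notMem_of_tendsto_right {k : Set ℝ} (hk : IsCompact k)
    (hks : ∀ t ∈ k, (t : EReal) < s₂) {b : ℕ → ℝ}
    (hb : Tendsto (fun n => (b n : EReal)) atTop (𝓝 s₂)) : ∀ᶠ n in atTop, b n ∉ k := by
  rcases k.eq_empty_or_nonempty with rfl | hne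
  · simp
  obtain ⟨m, hm, hmax⟩ := hk.exists_isGreatest hne
  filter_upwards [hb.eventually (lt_mem_nhds (hks m hm))] with n hn hmem
  exact absurd (hmax hmem) (not_le.mpr (EReal.coe_lt_coe_iff.mp hn))

theorem eventually_notMem_of_tendsto_bot {k : Set ℝ} (hk : IsCompact k) {a : ℕ → ℝ}
    (ha : Tendsto (fun n => (a n : EReal)) atTop (𝓝 ⊥)) : ∀ᶠ n in atTop, a n ∉ k := by
  rcases k.eq_empty_or_nonempty with rfl | hne
  · simp
  obtain ⟨m, hm, hmin⟩ := hk.exists_isLeast hne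
  filter_upwards [ha.eventually (gt_mem_nhds (EReal.bot_lt_coe m))] with n hn hmem
  exact absurd (hmin hmem) (not_le.mpr (EReal.coe_lt_coe_iff.mp hn))

theorem measurableSet_timeI : MeasurableSet (timeI s₁ s₂) := (isOpen_timeI s₁ s₂).measurableSet

theorem isClosed_left : IsClosed {s : ℝ | s₁ ≤ (s : EReal)} :=
  isClosed_le continuous_const continuous_coe_real_ereal

theorem isOpen_right : IsOpen {s : ℝ | (s : EReal) < s₂} :=
  isOpen_lt continuous_coe_real_ereal continuous_const

section Slice

variable {Φ : ℝ × Space d → ℝ} (hΦ : ContDiff ℝ ∞ Φ) (hc : HasCompactSupport Φ)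

theorem integral_mul_slice (v : L2 d σ) (s : ℝ) :
    ∫ y, v y * Φ (s, y) ∂(weighted d σ) = ⟪v, sliceLp σ hΦ.continuous hc s⟫ := by
  rw [sliceLp, inner_toLp_eq_integral]
  simp only [real_inner_eq_mul]

theorem integral_mul_deriv_slice (v : L2 d σ) (s : ℝ) :
    ∫ y, v y * deriv (fun t : ℝ => Φ (t, y)) s ∂(weighted d σ) =
      ⟪v, sliceLp σ (continuous_timeDeriv hΦ) (hasCompactSupport_timeDeriv hc) s⟫ := by
  rw [sliceLp, inner_toLp_eq_integral]
  simp only [real_inner_eq_mul, (hasDerivAt_time hΦ s _).deriv]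

theorem integral_inner_gradient_slice (G : L2Vec d (1 + σ)) (s : ℝ) :
    ∫ y, inner ℝ (G y) (gradient (fun z => Φ (s, z)) y) ∂(weighted d (1 + σ)) =
      ⟪G, sliceLp (1 + σ) (continuous_spaceGradient hΦ)
        (hasCompactSupport_spaceGradient hΦ hc) s⟫ := by
  rw [sliceLp, inner_toLp_eq_integral]
  rfl

/-- Φ is controlled only on the half-closed cylinder, not below the boundary; this suffices because
the weighted measure lives on H. -/
theorem sliceLp_eq_zero {K : Set (ℝ × Space d)}
    (hK : ∀ p ∈ timeIleft s₁ s₂ ×ˢ closedUpper d, p ∉ K → Φ p = 0) {s : ℝ}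
    (hs : s ∈ timeIleft s₁ s₂) (hsK : s ∉ Prod.fst '' K) :
    sliceLp σ hΦ.continuous hc s = 0 := by
  rw [Lp.eq_zero_iff_ae_eq_zero]
  filter_upwards [(memLp_slice (τ := σ) hΦ.continuous hc s).coeFn_toLp,
    ae_mem_upper (d := d) (τ := σ)] with y hy hmem
  have h0 : Φ (s, y) = 0 := hK _ ⟨hs, show 0 ≤ y (Fin.last d) from le_of_lt hmem⟩
    fun h => hsK ⟨_, h, rfl⟩
  rw [sliceLp, hy, h0]
  rfl

end Slice

theorem memL2Loc_of_continuous {X : Type*} [NormedAddCommGroup X] {u : ℝ → X} (hu : Continuous u)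
    {C : ℝ} (hC : ∀ s, ‖u s‖ ≤ C) [SecondCountableTopologyEither ℝ X] (J : Set ℝ) :
    MemL2Loc u J := fun K hK _ => by
  have : IsFiniteMeasure (volume.restrict K) := ⟨by simpa using hK.measure_lt_top⟩
  exact MemLp.of_bound hu.aestronglyMeasurable C (.of_forall hC)

/-- Existence of solutions. -/
theorem exists_solution (hs : s₁ < s₂) {f : ℝ → L2 d σ}
    (hf : MemLp f 1 (volume.restrict (timeI s₁ s₂))) {u₀ : L2 d σ} (hu₀ : s₁ = ⊥ → u₀ = 0) :
    ∃ (u : EReal → L2 d σ) (G : ℝ → L2Vec d (1 + σ)),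
      ContinuousOn u (Icc s₁ s₂) ∧ (∃ C, ∀ s, ‖u s‖ ≤ C) ∧ u s₁ = u₀ ∧
      IsSigmaSolution s₁ s₂ f u₀ (fun s : ℝ => u s) ∧
      HasSpatialGradient s₁ s₂ (fun s : ℝ => u s) G ∧
      IntegrableOn (fun s : ℝ => ⟪f s, u s⟫) (timeI s₁ s₂) ∧
      1 / 2 * ‖u s₂‖ ^ 2 + (∫ s in timeI s₁ s₂, ‖G s‖ ^ 2)
        = 1 / 2 * ‖u s₁‖ ^ 2 + ∫ s in timeI s₁ s₂, ⟪f s, u s⟫ := by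
  set F : ℝ → L2 d σ := (timeI s₁ s₂).indicator f with hFdef
  have hF : Integrable F := (integrable_indicator_iff measurableSet_timeI).mpr
    (memLp_one_iff_integrable.mp hf)
  have hFf : ∀ {s}, s ∈ timeI s₁ s₂ → F s = f s := fun h => indicator_of_mem h f
  obtain ⟨u, a, b, hcont, ⟨C, hC⟩, hleft, hm, huc, ha, hb⟩ :=
    (resolvent d σ).exists_mildSolution hs hF (fun r hr => indicator_of_notMem hr f) hu₀
  obtain ⟨G, hG, hmem, henergy, hweak⟩ := hm.exists_gradient
    (Γ := {p | WithLp.toLp 2 p ∈ gradientGraph d σ})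
    (isClosed_gradientGraph.preimage (WithLp.prod_continuous_toLp 2 _ _))
    (fun x => resolvent_mem x) fun x p hp => inner_resolvent_E x hp
  have hgrad : HasSpatialGradient s₁ s₂ (fun s : ℝ => u s) G := ⟨hG, hmem⟩
  have hFu : ∫ s in timeI s₁ s₂, ⟪F s, u s⟫ = ∫ s in timeI s₁ s₂, ⟪f s, u s⟫ :=
    setIntegral_congr_fun measurableSet_timeI fun s hs' => by simp only [hFf hs']
  refine ⟨u, G, hcont, ⟨C, hC⟩, hleft, ⟨memL2Loc_of_continuous huc (fun s => hC s) _, G, hgrad, ?_⟩,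
    hgrad, ?_, ?_⟩
  · rintro Φ ⟨hΦ, hΦc, K, hK, hKW, hK0⟩
    simp only [integral_mul_slice hΦ hΦc, integral_mul_deriv_slice hΦ hΦc,
      integral_inner_gradient_slice hΦ hΦc]
    set φ := sliceLp σ hΦ.continuous hΦc with hφ
    set φ' := sliceLp σ (continuous_timeDeriv hΦ) (hasCompactSupport_timeDeriv hΦc)
    set ψ := sliceLp (1 + σ) (continuous_spaceGradient hΦ) (hasCompactSupport_spaceGradient hΦ hΦc)
    have cφ : Continuous φ := continuous_sliceLp _ _
    have cφ' : Continuous φ' := continuous_sliceLp _ _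
    have cψ : Continuous ψ := continuous_sliceLp _ _
    have kφ : HasCompactSupport φ := hasCompactSupport_sliceLp _ _
    have kφ' : HasCompactSupport φ' := hasCompactSupport_sliceLp _ _
    have kψ : HasCompactSupport ψ := hasCompactSupport_sliceLp _ _
    obtain ⟨M, hM⟩ := cφ.bounded_above_of_compact_support kφ
    have hid := hweak φ φ' ψ (fun s => hasDerivAt_sliceLp _ _ _ _ (hasDerivAt_time hΦ) s) cφ' cψ
      fun s => sliceLp_mem_gradientGraph hΦ hΦc s
    have i1 : Integrable (fun s => ⟪F s, φ s⟫) (volume.restrict (timeI s₁ s₂)) := by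
      refine (hF.norm.mul_const M).mono' (hF.1.inner cφ.aestronglyMeasurable)
        (.of_forall fun s => ?_) |>.restrict
      exact (norm_inner_le_norm _ _).trans (mul_le_mul_of_nonneg_left (hM s) (norm_nonneg _))
    have i2 : Integrable (fun s => ⟪G s, ψ s⟫) (volume.restrict (timeI s₁ s₂)) :=
      (hG.norm.integrable_mul (q := 2) ((cψ.memLp_of_hasCompactSupport kψ).restrict _).norm).mono'
        (hG.1.inner cψ.aestronglyMeasurable) (.of_forall fun s => norm_inner_le_norm _ _)
    have i3 : Integrable (fun s : ℝ => ⟪u s, φ' s⟫) (volume.restrict (timeI s₁ s₂)) :=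
      ((huc.inner cφ').integrable_of_hasCompactSupport
        (kφ'.mono fun s hs' h0 => hs' (by simp only [h0, inner_zero_right]))).restrict
    have hlim := ((hm.tendsto_intervalIntegral i1).sub (hm.tendsto_intervalIntegral i2)).add
      (hm.tendsto_intervalIntegral i3)
    have hfst : IsCompact (Prod.fst '' K) := hK.image continuous_fst
    have mem_left : ∀ {s}, s ∈ timeI s₁ s₂ → s ∈ timeIleft s₁ s₂ := fun h => ⟨h.1.le, h.2⟩
    -- K is compact inside times strictly below s₂, so φ(b n) vanishes eventually. At the left end
    -- this fails for finite s₁, which is where the term with u₀ comes from.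
    have hzero : ∀ᶠ n in atTop, φ (b n) = 0 := by
      filter_upwards [eventually_notMem_of_tendsto_right hfst
        (fun t ⟨p, hp, hpt⟩ => hpt ▸ (hKW hp).1.2) hb] with n hn
      exact sliceLp_eq_zero hΦ hΦc hK0 (mem_left (hm.right_mem n)) hn
    have hright : Tendsto (fun n => ⟪u (b n), φ (b n)⟫) atTop (𝓝 0) :=
      tendsto_const_nhds.congr' (hzero.mono fun n hn => by
        simp only [hn, inner_zero_right])
    have hleft' : Tendsto (fun n => ⟪u (a n), φ (a n)⟫) atTop (𝓝 ⟪u₀, φ s₁.toReal⟫) := by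
      rcases eq_or_ne s₁ ⊥ with h | h
      · rw [hu₀ h, inner_zero_left]
        rw [h] at ha
        refine tendsto_const_nhds.congr' ?_
        filter_upwards [eventually_notMem_of_tendsto_bot hfst ha] with n hn
        rw [show φ (a n) = 0 from sliceLp_eq_zero hΦ hΦc hK0 (mem_left (hm.left_mem n)) hn,
          inner_zero_right]
      · rw [← EReal.coe_toReal (hs.trans_le le_top).ne h] at ha
        exact hm.tendsto_left.inner ((cφ.tendsto _).comp (EReal.tendsto_coe.mp ha))
    have hfin := tendsto_nhds_unique ((hright.sub hleft').congr hid) hlim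
    have hFφ : ∫ s in timeI s₁ s₂, ⟪F s, φ s⟫ = ∫ s in timeI s₁ s₂, ⟪f s, φ s⟫ :=
      setIntegral_congr_fun measurableSet_timeI fun s hs' => by simp only [hFf hs']
    rw [hFφ] at hfin
    linarith
  · have h := (hm.integrable_inner (ContinuousLinearMap.id ℝ _)
      (ContinuousLinearMap.id ℝ _)).integrableOn (s := timeI s₁ s₂)
    exact h.congr_fun (fun s hs' => by simp [hFf hs']) measurableSet_timeI
  · rw [hleft, ← hFu]
    exact henergy

/-- The compact part of the support with s ≥ s₁ lies in [s₁, s₂), where v is square integrable up to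
s₁; θ need not vanish there. -/
theorem MemL2Loc.integrableOn_smul {X : Type*} [NormedAddCommGroup X] [NormedSpace ℝ X] {v : ℝ → X}
    (hv : MemL2Loc v (timeIleft s₁ s₂)) {θ : ℝ → ℝ} (hθ : Continuous θ) (hc : HasCompactSupport θ)
    (hs : tsupport θ ⊆ {s : ℝ | (s : EReal) < s₂}) :
    IntegrableOn (fun s => θ s • v s) (timeI s₁ s₂) := by
  have hk : IsCompact (tsupport θ ∩ {s : ℝ | s₁ ≤ (s : EReal)}) :=
    hc.isCompact.inter_right isClosed_left
  have : IsFiniteMeasure (volume.restrict (tsupport θ ∩ {s : ℝ | s₁ ≤ (s : EReal)})) :=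
    ⟨by simpa using hk.measure_lt_top⟩
  have h1 : IntegrableOn v (tsupport θ ∩ {s : ℝ | s₁ ≤ (s : EReal)}) :=
    (hv _ hk fun s h => ⟨h.2, hs h.1⟩).integrable (by norm_num)
  refine (h1.continuousOn_smul hθ.continuousOn hk).of_forall_sdiff_eq_zero measurableSet_timeI
    fun s h => ?_
  have h2 : s ∉ tsupport θ := fun hmem => h.2 ⟨hmem, le_of_lt h.1.1⟩
  rw [image_eq_zero_of_notMem_tsupport h2, zero_smul]

section Tensor

variable {θ : ℝ → ℝ} (hθ : ContDiff ℝ ∞ θ) (hθc : HasCompactSupport θ)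
  (hθs : tsupport θ ⊆ {s : ℝ | (s : EReal) < s₂}) {χ : Space d → ℝ} (hχ : ContDiff ℝ ∞ χ)
  (hχc : HasCompactSupport χ)

-- θ is restricted only on the right. That it may be nonzero at s₁ is what makes the zero extension
-- in the uniqueness proof a solution across s₁.
include hθ hθc hθs hχ hχc in
theorem isTestOn_mul :
    IsTestOn (timeIleft s₁ s₂ ×ˢ closedUpper d) fun p : ℝ × Space d => θ p.1 * χ p.2 := by
  refine ⟨(hθ.comp contDiff_fst).mul (hχ.comp contDiff_snd),
    HasCompactSupport.intro (hθc.isCompact.prod hχc.isCompact) fun p hp => ?_,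
    (tsupport θ ∩ {s : ℝ | s₁ ≤ (s : EReal)}) ×ˢ (tsupport χ ∩ closedUpper d),
    (hθc.isCompact.inter_right isClosed_left).prod
      (hχc.isCompact.inter_right (isClosed_le continuous_const continuous_last)),
    fun p hp => ⟨⟨hp.1.2, hθs hp.1.1⟩, hp.2.2⟩, fun p hp hpK => ?_⟩
  · rw [mem_prod, not_and_or] at hp
    rcases hp with h | h
    · rw [image_eq_zero_of_notMem_tsupport h, zero_mul]
    · rw [image_eq_zero_of_notMem_tsupport h, mul_zero]
  · by_cases h : p.1 ∈ tsupport θ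
    · have h2 : p.2 ∉ tsupport χ := fun h2 => hpK ⟨⟨h, hp.1.1⟩, h2, hp.2⟩
      simp only
      rw [image_eq_zero_of_notMem_tsupport h2, mul_zero]
    · simp only
      rw [image_eq_zero_of_notMem_tsupport h, zero_mul]

include hθ hθc hθs in
theorem integral_mul_deriv_tensor {v : ℝ → L2 d σ} (hv : MemL2Loc v (timeIleft s₁ s₂)) :
    ∫ s in timeI s₁ s₂, ∫ y, v s y * deriv (fun t : ℝ => θ t * χ y) s ∂(weighted d σ) =
      ⟪∫ s in timeI s₁ s₂, deriv θ s • v s, (testPair σ hχ hχc).fst⟫ := by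
  have hint := hv.integrableOn_smul (hθ.continuous_deriv (by simp)) hθc.deriv
    ((closure_minimal support_deriv_subset (isClosed_tsupport θ)).trans hθs)
  rw [real_inner_comm, ← integral_inner hint]
  refine integral_congr_ae (.of_forall fun s => ?_)
  have h : ⟪v s, (testPair σ hχ hχc).fst⟫ = ∫ y, ⟪v s y, χ y⟫ ∂(weighted d σ) :=
    inner_toLp_eq_integral _ (memLp_test hχ hχc)
  simp only
  rw [inner_smul_right, real_inner_comm, h, ← integral_const_mul]
  refine integral_congr_ae (.of_forall fun y => ?_)
  simp only
  rw [deriv_mul_const ((hθ.differentiable (by simp)) s), real_inner_eq_mul]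
  ring

include hθ hθc in
theorem integral_inner_gradient_tensor {G : ℝ → L2Vec d (1 + σ)}
    (hG : MemLp G 2 (volume.restrict (timeI s₁ s₂))) :
    ∫ s in timeI s₁ s₂, ∫ y, inner ℝ (G s y) (gradient (fun z => θ s * χ z) y)
        ∂(weighted d (1 + σ)) =
      ⟪∫ s in timeI s₁ s₂, θ s • G s, (testPair σ hχ hχc).snd⟫ := by
  have hint : Integrable (fun s => θ s • G s) (volume.restrict (timeI s₁ s₂)) :=
    memLp_one_iff_integrable.mp
      (hG.smul (p := 2) ((hθ.continuous.memLp_of_hasCompactSupport hθc).restrict _))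
  rw [real_inner_comm, ← integral_inner hint]
  refine integral_congr_ae (.of_forall fun s => ?_)
  have h : ⟪G s, (testPair σ hχ hχc).snd⟫ = ∫ y, ⟪G s y, gradient χ y⟫ ∂(weighted d (1 + σ)) :=
    inner_toLp_eq_integral _ (memLp_gradient_test hχ hχc)
  simp only
  rw [inner_smul_right, real_inner_comm, h, ← integral_const_mul]
  refine integral_congr_ae (.of_forall fun y => ?_)
  simp only
  have hg : gradient (fun z => θ s * χ z) y = θ s • gradient χ y := by
    rw [gradient, fderiv_const_mul ((hχ.differentiable (by simp)) y), map_smul]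
    rfl
  rw [hg, inner_smul_right]

end Tensor

/-- Uniqueness of solutions. -/
theorem ae_eq_of_isSigmaSolution {f u v : ℝ → L2 d σ} {u₀ : L2 d σ}
    (hu : IsSigmaSolution s₁ s₂ f u₀ u) (hv : IsSigmaSolution s₁ s₂ f u₀ v) :
    ∀ᵐ s ∂(volume.restrict (timeI s₁ s₂)), v s = u s := by
  obtain ⟨hul, Gu, ⟨hGu, hgu⟩, hwu⟩ := hu
  obtain ⟨hvl, Gv, ⟨hGv, hgv⟩, hwv⟩ := hv
  set I := timeI s₁ s₂ with hI
  have hIm : MeasurableSet I := measurableSet_timeI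
  -- Extension by zero outside I: as both solutions have the same initial value, no jump term arises
  -- at s₁ and the homogeneous equation holds on (-∞, s₂).
  obtain ⟨w, hw⟩ : ∃ w : ℝ → L2 d σ, w = I.indicator fun s => v s - u s := ⟨_, rfl⟩
  obtain ⟨g, hg⟩ : ∃ g : ℝ → L2Vec d (1 + σ), g = I.indicator fun s => Gv s - Gu s := ⟨_, rfl⟩
  have hgL : MemLp g 2 := hg ▸ (memLp_indicator_iff_restrict hIm).mpr (hGv.sub hGu)
  have hgraph : ∀ᵐ s : ℝ, WithLp.toLp 2 (w s, g s) ∈ gradientGraph d σ := by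
    have h := (ae_restrict_iff' hIm).mp (hgv.and hgu)
    filter_upwards [h] with s hs
    by_cases hsI : s ∈ I
    · obtain ⟨h1, h2⟩ := hs hsI
      rw [hw, hg, indicator_of_mem hsI, indicator_of_mem hsI]
      exact (gradientGraph d σ).sub_mem (x := WithLp.toLp 2 (v s, Gv s))
        (y := WithLp.toLp 2 (u s, Gu s)) h1 h2
    · rw [hw, hg, indicator_of_notMem hsI, indicator_of_notMem hsI]
      exact (gradientGraph d σ).zero_mem
  have hwloc : LocallyIntegrableOn w {s : ℝ | (s : EReal) < s₂} := by
    rw [locallyIntegrableOn_iff isOpen_right.isLocallyClosed]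
    intro k hks hk
    have hk' : IsCompact (k ∩ {s : ℝ | s₁ ≤ (s : EReal)}) := hk.inter_right isClosed_left
    have : IsFiniteMeasure (volume.restrict (k ∩ {s : ℝ | s₁ ≤ (s : EReal)})) :=
      ⟨by simpa using hk'.measure_lt_top⟩
    have hsub : k ∩ {s : ℝ | s₁ ≤ (s : EReal)} ⊆ timeIleft s₁ s₂ := fun s h => ⟨h.2, hks h.1⟩
    have h1 : IntegrableOn (fun s => v s - u s) (k ∩ {s : ℝ | s₁ ≤ (s : EReal)}) :=
      ((hvl _ hk' hsub).sub (hul _ hk' hsub)).integrable (by norm_num)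
    rw [IntegrableOn, hw, integrable_indicator_iff hIm, IntegrableOn, Measure.restrict_restrict hIm]
    exact h1.mono_set fun s hs => ⟨hs.2, le_of_lt hs.1.1⟩
  have hwg : ∀ᵐ s : ℝ, (s : EReal) < s₂ → ‖(resolvent d σ).E (w s)‖ ≤ ‖g s‖ := by
    filter_upwards [hgraph] with s hs _
    exact norm_resolvent_E_le hs
  have hweak : ∀ θ : ℝ → ℝ, ContDiff ℝ ∞ θ → HasCompactSupport θ →
      tsupport θ ⊆ {s : ℝ | (s : EReal) < s₂} →
      (resolvent d σ).J (∫ s, deriv θ s • w s) = (resolvent d σ).B (∫ s, θ s • w s) := by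
    intro θ hθ hθc hθs
    have hθs' := (closure_minimal support_deriv_subset (isClosed_tsupport θ)).trans hθs
    have cθ' : Continuous (deriv θ) := hθ.continuous_deriv (by simp)
    have iθ : ∀ {G : ℝ → L2Vec d (1 + σ)}, MemLp G 2 (volume.restrict I) →
        Integrable (fun s => θ s • G s) (volume.restrict I) := fun hG =>
      memLp_one_iff_integrable.mp
        (hG.smul (p := 2) ((hθ.continuous.memLp_of_hasCompactSupport hθc).restrict _))
    have ew : ∫ s, deriv θ s • w s =
        (∫ s in I, deriv θ s • v s) - ∫ s in I, deriv θ s • u s := by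
      rw [← integral_sub (hvl.integrableOn_smul cθ' hθc.deriv hθs')
        (hul.integrableOn_smul cθ' hθc.deriv hθs'), ← integral_indicator hIm]
      refine integral_congr_ae (.of_forall fun s => ?_)
      by_cases hsI : s ∈ I <;> simp [hw, hsI, smul_sub]
    have eg : ∫ s, θ s • g s = (∫ s in I, θ s • Gv s) - ∫ s in I, θ s • Gu s := by
      rw [← integral_sub (iθ hGv) (iθ hGu), ← integral_indicator hIm]
      refine integral_congr_ae (.of_forall fun s => ?_)
      by_cases hsI : s ∈ I <;> simp [hg, hsI, smul_sub]
    -- Subtracting the two weak forms with test function θ(s)χ(y) gives this for test pairs; both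
    -- sides are continuous in p and test pairs are dense in the graph.
    have htest : ∀ p ∈ gradientGraph d σ,
        ⟪∫ s, deriv θ s • w s, p.fst⟫ = ⟪∫ s, θ s • g s, p.snd⟫ := by
      intro p hp
      have hcl : IsClosed {q : WithLp 2 (L2 d σ × L2Vec d (1 + σ)) |
          ⟪∫ s, deriv θ s • w s, q.fst⟫ = ⟪∫ s, θ s • g s, q.snd⟫} :=
        isClosed_eq (continuous_const.inner (WithLp.fstL 2 ℝ _ _).continuous)
          (continuous_const.inner (WithLp.sndL 2 ℝ _ _).continuous)
      refine closure_minimal ?_ hcl (mem_closure_testPair hp)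
      rintro q ⟨χ, hχ, hχc, rfl⟩
      have hT := isTestOn_mul (s₁ := s₁) hθ hθc hθs hχ hχc
      have h1 := hwv _ hT
      have h2 := hwu _ hT
      simp only at h1 h2
      rw [integral_mul_deriv_tensor hθ hθc hθs hχ hχc hvl,
        integral_inner_gradient_tensor hθ hθc hχ hχc hGv] at h1
      rw [integral_mul_deriv_tensor hθ hθc hθs hχ hχc hul,
        integral_inner_gradient_tensor hθ hθc hχ hχc hGu] at h2
      show ⟪∫ s, deriv θ s • w s, (testPair σ hχ hχc).fst⟫ =
        ⟪∫ s, θ s • g s, (testPair σ hχ hχc).snd⟫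
      rw [ew, eg, inner_sub_left, inner_sub_left]
      linarith
    have hiw : Integrable fun s => θ s • w s := by
      have h := (hvl.integrableOn_smul hθ.continuous hθc hθs).sub
        (hul.integrableOn_smul hθ.continuous hθc hθs)
      refine ((integrable_indicator_iff hIm).mpr h).congr (.of_forall fun s => ?_)
      by_cases hsI : s ∈ I <;> simp [hw, hsI, smul_sub]
    have hig : Integrable fun s => θ s • g s :=
      memLp_one_iff_integrable.mp
        (hgL.smul (p := 2) (hθ.continuous.memLp_of_hasCompactSupport hθc))
    -- Testing with the pair (Jx, Ex) gives ⟪∫θ'w, Jx⟫ = ⟪∫θg, Ex⟫ = ⟪∫θw, Bx⟫; symmetry of J and B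
    -- then gives the operator form.
    refine ext_inner_right ℝ fun x => ?_
    have e1 := htest _ (resolvent_mem x)
    have e2 : ⟪∫ s, θ s • g s, (resolvent d σ).E x⟫ = ⟪∫ s, θ s • w s, (resolvent d σ).B x⟫ := by
      rw [real_inner_comm, ← integral_inner hig, real_inner_comm, ← integral_inner hiw]
      refine integral_congr_ae ?_
      filter_upwards [hgraph] with s hs
      rw [inner_smul_right, inner_smul_right]
      exact congrArg (θ s * ·) (inner_resolvent_E x hs)
    have e3 := (resolvent d σ).symm (∫ s, deriv θ s • w s) x
    have e4 := (resolvent d σ).symm (∫ s, θ s • w s) x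
    have e5 : ⟪∫ s, deriv θ s • w s, (resolvent d σ).J x⟫ =
      ⟪∫ s, θ s • g s, (resolvent d σ).E x⟫ := e1
    rw [e2, ResolventPair.B_apply, inner_sub_right] at e5
    rw [ResolventPair.B_apply, inner_sub_left]
    linarith
  have h0 := (resolvent d σ).ae_eq_zero_of_weak hwloc hgL hwg hweak
  rw [ae_restrict_iff' hIm]
  filter_upwards [h0] with s hs hsI
  have h1 := hs hsI.2
  rw [hw, indicator_of_mem hsI] at h1
  exact sub_eq_zero.mp h1

end HalfSpace

end

end

/-! ### The proposition. -/

theorem proposition3p1 {d : ℕ} {σ : ℝ} (hσ : -1 < σ) {s₁ s₂ : EReal} (hs : s₁ < s₂)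
    (f : ℝ → HalfSpace.L2 d σ) (hf : MemLp f 1 (volume.restrict (HalfSpace.timeI s₁ s₂)))
    (u₀ : HalfSpace.L2 d σ) (hu₀ : s₁ = ⊥ → u₀ = 0) :
    ∃ u : EReal → HalfSpace.L2 d σ,
      -- `u` is a solution, and every solution agrees with it almost everywhere on `I`
      HalfSpace.IsSigmaSolution s₁ s₂ f u₀ (fun s : ℝ => u s) ∧
      (∀ v : ℝ → HalfSpace.L2 d σ, HalfSpace.IsSigmaSolution s₁ s₂ f u₀ v →
        ∀ᵐ s ∂(volume.restrict (HalfSpace.timeI s₁ s₂)), v s = u s) ∧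
      -- `u` is bounded and continuous on the closure of `I`, with limits at infinite end points
      ContinuousOn u (Icc s₁ s₂) ∧
      (∃ C : ℝ, ∀ s ∈ Icc s₁ s₂, ‖u s‖ ≤ C) ∧
      u s₁ = u₀ ∧
      -- the energy identity
      IntegrableOn (fun s : ℝ => inner ℝ (f s) (u s)) (HalfSpace.timeI s₁ s₂) ∧
      ∀ G : ℝ → HalfSpace.L2Vec d (1 + σ),
        HalfSpace.HasSpatialGradient s₁ s₂ (fun s : ℝ => u s) G →
        1 / 2 * ‖u s₂‖ ^ 2 + (∫ s in HalfSpace.timeI s₁ s₂, ‖G s‖ ^ 2)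
          = 1 / 2 * ‖u s₁‖ ^ 2 + ∫ s in HalfSpace.timeI s₁ s₂, inner ℝ (f s) (u s) := by
  have : Fact (-1 < σ) := ⟨hσ⟩
  obtain ⟨u, G₀, hcont, ⟨C, hC⟩, hleft, hsol, hG₀, hint, henergy⟩ :=
    HalfSpace.exists_solution hs hf hu₀
  refine ⟨u, hsol, fun v hv => HalfSpace.ae_eq_of_isSigmaSolution hsol hv, hcont,
    ⟨C, fun s _ => hC s⟩, hleft, hint, fun G hG => ?_⟩
  rw [← henergy]
  congr 1
  refine integral_congr_ae ?_
  -- The energy identity was obtained for one gradient; any other agrees with it at almost every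
  -- time by uniqueness of the weak gradient.
  filter_upwards [hG.2, hG₀.2] with s h1 h2
  rw [HalfSpace.weakGradient_unique h1 h2]
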